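/- **Setting.** Let $D\subsetneq\mathbb C$ be a simply connected domain, $w:D\to\mathbb D$ a conformal map (also used for prime ends, $w(\partial D)=\partial\mathbb D$), and $q_1,\dots,q_r$ distinct marked points in $D\cup\partial D$; $D^*=D\setminus\{q_1,\dots,q_r\}$. Points are referred to local charts (boundary charts, taking $D$ to the upper half-plane, at marked boundary points), and $\log w'$, $\log(w(x)-w(y))$ are multivalued; all statements hold for all choices of branches. Let $\Phi^\pm$ be the chiral parts of the Gaussian free field $\Phi=\Phi^++\Phi^-$ with Dirichlet boundary condition, i.e. $\Phi^-=\overline{\Phi^+}$ and, formally, $$\mathbf E\,\Phi^+(x)\Phi^+(y)=-\log(w(x)-w(y)),\qquad \mathbf E\,\Phi^+(x)\Phi^-(y)=\log\bigl(1-w(x)\overline{w(y)}\bigr).$$ Fock space fields are finite linear combinations, with non-random coefficients, of $\xi_1\odot\cdots\odot\xi_n\odot e^{\odot\eta}$, where $\xi_j$ are derivatives of $\Phi^\pm$ and $\eta$ is a complex linear combination of $\Phi^\pm$ at points; tensor products $XY$ and correlations $\mathbf E$ are given by Wick's formula. Identities and expansions *within correlations* are those which hold after taking correlations with Wick exponentials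 of Gaussians. For a double divisor $\tau=\sum(\tau^+_x\cdot x,\tau^-_x\cdot x)$ put $\Phi[\tau]=\sum\tau_x^+\Phi^+(x)-\tau_x^-\Phi^-(x)$ and $V^\odot[\tau]=e^{\odot i\Phi[\tau]}$. Fix $b\in\mathbb R$. A background charge is a double divisor $\beta=\sum_k(\beta_k^+\cdot q_k,\beta_k^-\cdot q_k)$ with complex coefficients, with $\beta_k^-=0$ if $q_k\in\partial D$, and with $$(\mathrm{NC}_b)\qquad \sum_k(\beta_k^++\beta_k^-)=2b.$$ Let $\Phi_\beta^\pm=\Phi^\pm+\varphi_\beta^\pm$, where $$\varphi_\beta^+(x)=-i\sum_k\Bigl(\beta_k^+\log(w(x)-w(q_k))+\beta_k^-\log\bigl(1-w(x)\overline{w(q_k)}\bigr)\Bigr)+ib\log w'(x),$$ $$\varphi_\beta^-(x)=i\sum_k\Bigl(\beta_k^-\overline{\log(w(x)-w(q_k))}+\beta_k^+\log\bigl(1-w(q_k)\overline{w(x)}\bigr)\Bigr)-ib\,\overline{\log w'(x)},$$ and, for a double divisor $\tau$ on $D^*$ with $(\mathrm{NC}_0)$: $\sum(\tau^+_x+\tau^-_x)=0$,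 $$\Phi_\beta[\tau]=\sum_x\tau_x^+\Phi_\beta^+(x)-\tau_x^-\Phi_\beta^-(x),\qquad \mathcal O_\beta[\tau]=\frac{C_{(b)}[\tau+\beta]}{C_{(b)}[\beta]}\,V^\odot[\tau].$$ In particular $\Phi_\beta(x)=\Phi_\beta^+(x)+\Phi_\beta^-(x)$ is $\Phi_\beta[\tau]$ for $\tau=(x,-x)$. Here $C_{(b)}[\sigma]$ is the Coulomb gas correlation function, the differential of conformal dimensions $\lambda_b(\sigma_j^\pm)$ at the points $z_j$, $\lambda_b(s)=s^2/2-sb$, whose value in $\mathbb D$ is $$\prod_{j<k}(z_j-z_k)^{\sigma_j^+\sigma_k^+}(\bar z_j-\bar z_k)^{\sigma_j^-\sigma_k^-}\prod_{j,k}(1-z_j\bar z_k)^{\sigma_j^+\sigma_k^-}.$$ The OPE family $\mathcal F_\beta(D^*)$ is the smallest class of (multi-node) Fock space fields which contains $1$ and all $\Phi_\beta[\tau]$, $\mathcal O_\beta[\tau]$ ($\tau$ on $D^*$ with $(\mathrm{NC}_0)$) and is closed under linear combinations, tensor products, $\partial$, $\bar\partial$, taking coefficients of operator product expansions as one node tends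 to another, and replacing a field by one equal to it within correlations. (Expansions are in the functions $t^a\bar t^{a'}(\log t)^p(\overline{\log t})^{p'}$ of the difference $t$ of the coordinates.) The extended OPE family $\mathcal F_\beta$ is the span of $\mathcal F_\beta(D^*)$ and of the strings obtained from fields $X\in\mathcal F_\beta(D^*)$ by letting some nodes $x$ of $X$, at each of which all terms of $X$ carry the same charges $(\sigma_x^+,\sigma_x^-)$, tend successively to marked points and taking coefficients of the successive expansions, as in $X_1\cdots X_m\,(Y_1*(\cdots*(Y_n*1_{q_k})))$. **Theorem.** Let $\check\beta,\beta$ be background charges at $q_1,\dots,q_r$ satisfying $(\mathrm{NC}_b)$. The insertion of $V^\odot[\beta-\check\beta]$ maps $\mathcal F_{\check\beta}$ onto $\mathcal F_\beta$ within correlations. In detail, let $X\mapsto\widehat X$ be the homomorphism of $\odot$-algebras, linear over non-random functions, with $\partial^m\Phi^+\mapsto\partial^m(\Phi^++\varphi^+_\beta-\varphi^+_{\check\beta})$ and $\bar\partial^m\Phi^-\mapsto\bar\partial^m(\Phi^-+\varphi^-_\beta-\varphi^-_{\check\beta})$. Then: 1. $\widehat{\Phi_{\check\beta}[\tau]}=\Phi_\beta[\tau]$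 and $\widehat{\mathcal O_{\check\beta}[\tau]}=\mathcal O_\beta[\tau]$ for all $\tau$ on $D^*$ with $(\mathrm{NC}_0)$; in particular $\widehat\Phi_{\check\beta}=\Phi_\beta$. 2. $X\mapsto\widehat X$ commutes with $\partial$ and $\bar\partial$, within correlations, on Fock space fields in $D^*$. 3. The image of $\mathcal F_{\check\beta}(D^*)$ under $X\mapsto\widehat X$ is $\mathcal F_\beta(D^*)$. 4. $\mathbf E\bigl[X\,V^\odot[\beta-\check\beta]\bigr]=\mathbf E\,\widehat X$ for all $X\in\mathcal F_{\check\beta}(D^*)$. 5. The same holds for the extended families. If $Y\in\mathcal F_{\check\beta}$ is the string given by certain coefficients of the successive expansions of $X\in\mathcal F_{\check\beta}(D^*)$ at marked points, let $W$ and $Z$ be the corresponding coefficients of the expansions of $X\,V^\odot[\beta-\check\beta]$ and of $\widehat X$: $W$ is the product of $Y$ and $V^\odot[\beta-\check\beta]$ in the sense of operator product expansions, $Z$ is the image of $Y$, and corresponding means that for a node with charges $(\sigma^+,\sigma^-)$ tending to $q_k$ the powers $t^a\bar t^{a'}$ are replaced by $t^{a+\sigma^+(\beta_k^+-\check\beta_k^+)}\bar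 t^{a'+\sigma^-(\beta_k^--\check\beta_k^-)}$ if $q_k\in D$, and with $\beta_k^+-\check\beta_k^+$ in both exponents if $q_k\in\partial D$. Extend the correspondence $(Y,W,Z)$ linearly. Then always $Y\in\mathcal F_{\check\beta}$, $Z\in\mathcal F_\beta$ and $\mathbf E\,W=\mathbf E\,Z$; every $Y\in\mathcal F_{\check\beta}$ has a product $W$ and an image $Z$; and every $Z\in\mathcal F_\beta$ is the image of some $Y\in\mathcal F_{\check\beta}$. -/

import Mathlib

open Filter Topology Asymptotics

noncomputable section

namespace CoulombGas

/-! ### Domains, charts, marked points -/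

/-- A simply connected domain `D` together with a conformal map of `D` onto the unit disc. The
prime ends of `D` are the points of the unit circle. -/
structure Uniformization where
  domain : Set ℂ
  isOpen_domain : IsOpen domain
  toDisc : ℂ → ℂ
  differentiableOn_toDisc : DifferentiableOn ℂ toDisc domain
  bijOn_toDisc : Set.BijOn toDisc domain (Metric.ball 0 1)

/-- A local chart `φ` of `D`, or of the Schottky double of `D` near a point of `D ∪ ∂D`, given by
its inverse: `source` is the range of coordinates, `point z = φ⁻¹ z`, and `disc` is `w ∘ φ⁻¹`,
where `w` is the uniformization; near a boundary point `disc` is the extension of `w ∘ φ⁻¹` across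
the unit circle. -/
structure LocalChart (U : Uniformization) where
  source : Set ℂ
  isOpen_source : IsOpen source
  disc : ℂ → ℂ
  differentiableOn_disc : DifferentiableOn ℂ disc source
  injOn_disc : Set.InjOn disc source
  point : ℂ → ℂ
  point_mem : ∀ z ∈ source, disc z ∈ Metric.ball (0 : ℂ) 1 → point z ∈ U.domain
  toDisc_point : ∀ z ∈ source, disc z ∈ Metric.ball (0 : ℂ) 1 → U.toDisc (point z) = disc z

/-- The identity chart of `D`. -/
def Uniformization.idChart (U : Uniformization) : LocalChart U where
  source := U.domain
  isOpen_source := U.isOpen_domain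
  disc := U.toDisc
  differentiableOn_disc := U.differentiableOn_toDisc
  injOn_disc := U.bijOn_toDisc.injOn
  point := id
  point_mem := fun _ hz _ => hz
  toDisc_point := fun _ _ _ => rfl

/-- A simply connected domain with a family of local charts and finitely many distinct marked
points in `D ∪ ∂D`. `mark k` is the image of the `k`-th marked point under the uniformization;
`markCoord k` is its coordinate in the chart `markChart k`. The chart at a marked boundary point is
a boundary chart: near the point it takes `D` to the upper half-plane and `∂D` to the real line. -/
structure MarkedDomain where
  unif : Uniformization
  ChartIndex : Type
  chart : ChartIndex → LocalChart unif
  numMarks : ℕ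
  mark : Fin numMarks → ℂ
  norm_mark_le : ∀ k, ‖mark k‖ ≤ 1
  mark_injective : Function.Injective mark
  markChart : Fin numMarks → ChartIndex
  markCoord : Fin numMarks → ℂ
  markCoord_mem : ∀ k, markCoord k ∈ (chart (markChart k)).source
  disc_markCoord : ∀ k, (chart (markChart k)).disc (markCoord k) = mark k
  markCoord_im : ∀ k, ‖mark k‖ = 1 → (markCoord k).im = 0
  boundary_chart : ∀ k, ‖mark k‖ = 1 → ∀ᶠ z in 𝓝 (markCoord k),
    ((chart (markChart k)).disc z ∈ Metric.ball (0 : ℂ) 1 ↔ 0 < z.im)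

/-- Labels of points: `node c n` is the `n`-th variable point whose position is recorded in the
chart `c`; `marked k` is the `k`-th marked point. -/
inductive Pt (M : MarkedDomain) : Type
  | node (c : M.ChartIndex) (n : ℕ)
  | marked (k : Fin M.numMarks)

instance (M : MarkedDomain) : DecidableEq (Pt M) := Classical.decEq _

variable {M : MarkedDomain}

def Pt.IsNode : Pt M → Prop
  | .node _ _ => True
  | .marked _ => False

def Pt.chart : Pt M → LocalChart M.unif
  | .node c _ => M.chart c
  | .marked k => M.chart (M.markChart k)

def Pt.chartIndex : Pt M → M.ChartIndex
  | .node c _ => c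
  | .marked k => M.markChart k

/-- The set of all marked points. -/
def marks (M : MarkedDomain) : Finset (Pt M) := Finset.univ.image Pt.marked

/-! ### Configurations with branches of the logarithms

Correlation functions are multivalued functions of the nodes. A point of the covering space on
which they are single-valued is a configuration of nodes together with a logarithm of each
difference of positions and of the derivative of each chart map. -/

structure State (M : MarkedDomain) where
  /-- the coordinate of a point in its chart -/
  coord : Pt M → ℂ
  /-- a branch of `log w'` at the point -/
  logDeriv : Pt M → ℂ
  /-- `logDiff x y` is a branch of `log (w x - w y)` -/
  logDiff : Pt M → Pt M → ℂ

namespace State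

/-- The position, in the unit disc, of a point. -/
def pos (st : State M) (x : Pt M) : ℂ := x.chart.disc (st.coord x)

/-- `st` is a configuration of distinct nodes `x ∈ S`, in the domain and away from the marked
points, together with branches of the logarithms. -/
structure Valid (S : Finset (Pt M)) (st : State M) : Prop where
  coord_marked : ∀ k, st.coord (.marked k) = M.markCoord k
  coord_mem : ∀ x ∈ S, st.coord x ∈ x.chart.source
  pos_mem : ∀ x ∈ S, x.IsNode → st.pos x ∈ Metric.ball (0 : ℂ) 1
  pos_ne : ∀ x ∈ S ∪ marks M, ∀ y ∈ S ∪ marks M, x ≠ y → st.pos x ≠ st.pos y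
  exp_logDeriv : ∀ x ∈ S ∪ marks M, Complex.exp (st.logDeriv x) = deriv x.chart.disc (st.coord x)
  exp_logDiff : ∀ x ∈ S ∪ marks M, ∀ y ∈ S ∪ marks M, x ≠ y →
    Complex.exp (st.logDiff x y) = st.pos x - st.pos y

/-- Two states agree on the points of `T`. -/
def AgreeOn (T : Finset (Pt M)) (st st' : State M) : Prop :=
  (∀ x ∈ T, st.coord x = st'.coord x ∧ st.logDeriv x = st'.logDeriv x) ∧
    ∀ x ∈ T, ∀ y ∈ T, st.logDiff x y = st'.logDiff x y

/-- Move the point `x` by `t` in its chart, continuing the branches of the logarithms (for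
small `t`). -/
def move (x : Pt M) (t : ℂ) (st : State M) : State M where
  coord := Function.update st.coord x (st.coord x + t)
  logDeriv := Function.update st.logDeriv x (st.logDeriv x +
    Complex.log (deriv x.chart.disc (st.coord x + t) / deriv x.chart.disc (st.coord x)))
  logDiff := fun a c =>
    if a = x ∧ c ≠ x then st.logDiff x c +
      Complex.log ((x.chart.disc (st.coord x + t) - st.pos c) / (st.pos x - st.pos c))
    else if c = x ∧ a ≠ x then st.logDiff a x +
      Complex.log ((st.pos a - x.chart.disc (st.coord x + t)) / (st.pos a - st.pos x))
    else st.logDiff a c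

/-- Place the point `x` (a node in the same chart as `y`) at the point with coordinate
`coord y + t`, with `log (w x - w y) = log t + log w' y + log ((w x - w y) / (t w' y))`, the
first and last logarithms being principal, and with the other branches of the logarithms continued
from those at `y`. -/
def collide (x y : Pt M) (t : ℂ) (st : State M) : State M where
  coord := Function.update st.coord x (st.coord y + t)
  logDeriv := Function.update st.logDeriv x (st.logDeriv y +
    Complex.log (deriv y.chart.disc (st.coord y + t) / deriv y.chart.disc (st.coord y)))
  logDiff :=
    let p : ℂ := y.chart.disc (st.coord y + t)
    let l : ℂ := Complex.log t + st.logDeriv y +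
      Complex.log ((p - st.pos y) / (t * deriv y.chart.disc (st.coord y)))
    fun a c =>
      if a = x ∧ c = x then 0
      else if a = x ∧ c = y then l
      else if a = y ∧ c = x then l + Real.pi * Complex.I
      else if a = x then st.logDiff y c + Complex.log ((p - st.pos c) / (st.pos y - st.pos c))
      else if c = x then st.logDiff a y + Complex.log ((st.pos a - p) / (st.pos a - st.pos y))
      else st.logDiff a c

end State

/-- Multivalued non-random functions of the nodes. -/
abbrev Coeff (M : MarkedDomain) := State M → ℂ

/-- `∂^m` in the chart coordinate of `x`, for functions holomorphic in that variable. -/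
def dHol (x : Pt M) (m : ℕ) (f : Coeff M) : Coeff M :=
  fun st => iteratedDeriv m (fun t => f (st.move x t)) 0

/-- `∂̄^m` in the chart coordinate of `x`, for functions antiholomorphic in that variable. -/
def dAnti (x : Pt M) (m : ℕ) (f : Coeff M) : Coeff M :=
  fun st => starRingEnd ℂ (iteratedDeriv m (fun t => starRingEnd ℂ (f (st.move x t))) 0)

/-- `∂^m` for sign `+` (`true`), `∂̄^m` for sign `-` (`false`). -/
def dSign : Bool → Pt M → ℕ → Coeff M → Coeff M
  | true => dHol
  | false => dAnti

/-! ### Formal Gaussian fields and Fock space fields -/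

/-- The symbol `(x, true, m)` is `∂^m Φ⁺(x)` and `(x, false, m)` is `∂̄^m Φ⁻(x)`. -/
abbrev Sym (M : MarkedDomain) := Pt M × Bool × ℕ

/-- Exponents `η = ∑ a_{x,±} Φ^±(x)` of Wick exponentials. -/
abbrev Expo (M : MarkedDomain) := (Pt M × Bool) →₀ ℂ

/-- Fock space fields: finite linear combinations, with non-random coefficients, of the basic
fields `ξ₁ ⊙ ⋯ ⊙ ξₙ ⊙ e^{⊙ η}`; a multiset of symbols `ξ` and an exponent `η` label a basic
field. The multiplication of this commutative algebra is the Wick product `⊙`. -/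
abbrev Fock (M : MarkedDomain) := AddMonoidAlgebra (Coeff M) ((Sym M →₀ ℕ) × Expo M)

/-- A non-random function as a Fock space field. -/
def nonrandom (f : Coeff M) : Fock M := AddMonoidAlgebra.single 0 f

/-- The Gaussian field `∂^m Φ^±(x)`. -/
def gauss (g : Sym M) : Fock M := AddMonoidAlgebra.single (Finsupp.single g 1, 0) 1

/-- The Wick exponential `e^{⊙ η}`. -/
def wickExp (η : Expo M) : Fock M := AddMonoidAlgebra.single (0, η) 1

/-- The homomorphism of `⊙`-algebras, linear over non-random functions, which substitutes
`ξ + c ξ` for each symbol `ξ` (so that `e^{⊙ η}` becomes `e^{c η} e^{⊙ η}`). -/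
def translate (c : Sym M → Coeff M) : Fock M →ₐ[Coeff M] Fock M :=
  AddMonoidAlgebra.lift (Coeff M) (Fock M) ((Sym M →₀ ℕ) × Expo M)
    { toFun := fun p =>
        (p.toAdd.1.prod fun g n => (gauss g + nonrandom (c g)) ^ n) *
          (nonrandom (fun st => Complex.exp (p.toAdd.2.sum fun x a => a * c (x.1, x.2, 0) st)) *
            wickExp p.toAdd.2)
      map_one' := by
        simp only [toAdd_one, Prod.fst_zero, Prod.snd_zero, Finsupp.prod_zero_index,
          Finsupp.sum_zero_index, Complex.exp_zero, one_mul]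
        have h : (fun _ : State M => (1 : ℂ)) = 1 := rfl
        simp only [nonrandom, wickExp, h, AddMonoidAlgebra.single_mul_single]
        simp [AddMonoidAlgebra.one_def]
        rfl
      map_mul' := by
        intro p q
        simp only [toAdd_mul, Prod.fst_add, Prod.snd_add]
        rw [Finsupp.prod_add_index' (by simp) (by intros; rw [pow_add])]
        have h : (nonrandom (fun st => Complex.exp
              ((p.toAdd.2 + q.toAdd.2).sum fun x a => a * c (x.1, x.2, 0) st)) *
              wickExp (p.toAdd.2 + q.toAdd.2) : Fock M) =
            (nonrandom (fun st => Complex.exp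
              (p.toAdd.2.sum fun x a => a * c (x.1, x.2, 0) st)) * wickExp p.toAdd.2) *
            (nonrandom (fun st => Complex.exp
              (q.toAdd.2.sum fun x a => a * c (x.1, x.2, 0) st)) * wickExp q.toAdd.2) := by
          simp only [nonrandom, wickExp, AddMonoidAlgebra.single_mul_single]
          congr 1
          · simp
          · funext st
            have hs : ((p.toAdd.2 + q.toAdd.2).sum fun x a => a * c (x.1, x.2, 0) st) =
                (p.toAdd.2.sum fun x a => a * c (x.1, x.2, 0) st) +
                  (q.toAdd.2.sum fun x a => a * c (x.1, x.2, 0) st) :=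
              Finsupp.sum_add_index' (by simp) (by intros; ring)
            simp [hs, Complex.exp_add]
        rw [h]; ring }

/-- Formal correlations in the unit disc: `E[Φ⁺(x)Φ⁺(y)] = log (1/(w x - w y))`,
`E[Φ⁺(x)Φ⁻(y)] = log (1 - w x * conj (w y))`, `Φ⁻ = conj Φ⁺`, and their derivatives. -/
def cov : Sym M → Sym M → Coeff M
  | (x, true, m), (y, true, n) => dHol x m (dHol y n fun st => -st.logDiff x y)
  | (x, false, m), (y, false, n) =>
      dAnti x m (dAnti y n fun st => -starRingEnd ℂ (st.logDiff x y))
  | (x, true, m), (y, false, n) =>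
      dHol x m (dAnti y n fun st => Complex.log (1 - st.pos x * starRingEnd ℂ (st.pos y)))
  | (x, false, m), (y, true, n) =>
      dAnti x m (dHol y n fun st => Complex.log (1 - st.pos y * starRingEnd ℂ (st.pos x)))

/-- `E[η ξ]` for a symbol `ξ` and an exponent `η`, the points of `η` coming first. -/
def covExpo (η : Expo M) (g : Sym M) : Coeff M :=
  fun st => η.sum fun x a => a * cov (x.1, x.2, 0) g st

/-- Contraction of the symbol `ξ` with one Gaussian factor of a field: the derivation of the
`⊙`-algebra with `ξ' ↦ E[ξ ξ']` and `e^{⊙ η} ↦ E[ξ η] e^{⊙ η}`. -/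
def contract (g : Sym M) (Y : Fock M) : Fock M :=
  Y.coeff.sum fun p f =>
    (p.1.sum fun g' n =>
      AddMonoidAlgebra.single (p.1 - Finsupp.single g' 1, p.2) ((n : ℂ) • (f * cov g g'))) +
    AddMonoidAlgebra.single p
      (fun st => f st * p.2.sum fun x a => a * cov g (x.1, x.2, 0) st)

/-- Wick's formula: each of the listed symbols is either left uncontracted or contracted with a
factor of `Y`; `A` collects the uncontracted ones. -/
def wickSum : List (Sym M) → Fock M → Fock M → Fock M
  | [], A, Y => A * Y
  | g :: l, A, Y => wickSum l (A * gauss g) Y + wickSum l A (contract g Y)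

/-- The tensor product `X Y` of Fock space fields with disjoint sets of nodes, by Wick's formula
(no contractions within `X` or within `Y`). -/
def tensor (X Y : Fock M) : Fock M :=
  X.coeff.sum fun p f =>
    f • wickSum p.1.toMultiset.toList (wickExp p.2) (translate (covExpo p.2) Y)

/-- The correlation function `E X`: Wick products of centered Gaussians have zero mean, and
`E e^{⊙ η} = 1`. -/
def expect (X : Fock M) : Coeff M :=
  fun st => X.coeff.sum fun p f => if p.1 = 0 then f st else 0

/-! ### Correlations with Wick exponentials, derivatives, operator product expansions -/

/-- `evalAt h X st` is the correlation `E[X e^{⊙ ξ}]` of `X` with the Wick exponential of a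
Gaussian `ξ` for which `E[Φ⁺(z) ξ] = h.1 (w z)` and `E[Φ⁻(z) ξ] = conj (h.2 (w z))`. -/
def evalAt (h : (ℂ → ℂ) × (ℂ → ℂ)) (X : Fock M) (st : State M) : ℂ :=
  let jet : Sym M → ℂ := fun g => match g with
    | (x, true, m) => iteratedDeriv m (fun z => h.1 (x.chart.disc z)) (st.coord x)
    | (x, false, m) =>
        starRingEnd ℂ (iteratedDeriv m (fun z => h.2 (x.chart.disc z)) (st.coord x))
  X.coeff.sum fun p f => f st * (p.1.prod fun g n => jet g ^ n) *
    Complex.exp (p.2.sum fun x a => a * jet (x.1, x.2, 0))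

/-- `h` is holomorphic near the nodes in `S` and near the marked points. -/
def IsTest (S : Finset (Pt M)) (st : State M) (h : (ℂ → ℂ) × (ℂ → ℂ)) : Prop :=
  ∀ x ∈ S ∪ marks M, AnalyticAt ℂ h.1 (st.pos x) ∧ AnalyticAt ℂ h.2 (st.pos x)

/-- `X` is a field whose symbols sit at points of `S` and whose coefficients are functions of the
points of `S` and of the marked points. -/
def FieldOn (S : Finset (Pt M)) (X : Fock M) : Prop :=
  ∀ p ∈ X.coeff.support,
    (∀ g ∈ p.1.support, g.1 ∈ S) ∧ (∀ x ∈ p.2.support, x.1 ∈ S) ∧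
    ∀ st st' : State M, State.AgreeOn (S ∪ marks M) st st' → X.coeff p st = X.coeff p st'

/-- Equality of fields within correlations. -/
def EqWithin (S : Finset (Pt M)) (X Y : Fock M) : Prop :=
  ∀ st : State M, st.Valid S → ∀ h, IsTest S st h → evalAt h X st = evalAt h Y st

/-- `Y = ∂ₓ X` and `Y' = ∂̄ₓ X` (within correlations), in the chart of the node `x`. -/
def HasDerivs (S : Finset (Pt M)) (X : Fock M) (x : Pt M) (Y Y' : Fock M) : Prop :=
  ∀ st : State M, st.Valid S → ∀ h, IsTest S st h →
    HasFDerivAt (𝕜 := ℝ) (fun t : ℂ => evalAt h X (st.move x t))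
      (evalAt h Y st • ContinuousLinearMap.id ℝ ℂ +
        evalAt h Y' st • (Complex.conjCLE : ℂ →L[ℝ] ℂ)) 0

/-- The members `t^a (conj t)^{a'} (log t)^p (conj (log t))^{p'}` of the asymptotic scale. -/
structure ScaleIndex where
  pow : ℂ
  powConj : ℂ
  log : ℕ
  logConj : ℕ

def ScaleIndex.toFun (I : ScaleIndex) (t : ℂ) : ℂ :=
  Complex.exp (I.pow * Complex.log t + I.powConj * starRingEnd ℂ (Complex.log t)) *
    Complex.log t ^ I.log * starRingEnd ℂ (Complex.log t) ^ I.logConj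

/-- How a node approaches the point: in a slit neighbourhood, or from inside the domain if the
point is a marked boundary point. -/
def approach : Pt M → Filter ℂ
  | .node _ _ => 𝓝[Complex.slitPlane] 0
  | .marked k => if ‖M.mark k‖ = 1 then 𝓝[{t : ℂ | 0 < t.im}] 0 else 𝓝[Complex.slitPlane] 0

/-- The operator product expansion (within correlations) of the field `X`, with nodes `S`, as its
node `x` tends to the point `y` in the common chart of `x` and `y`, is `∑ I.toFun t • C I`, where
`t` is the difference of the coordinates. The coefficients are fields on `T`. -/
def HasOPE (S : Finset (Pt M)) (X : Fock M) (x y : Pt M) (T : Finset (Pt M))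
    (C : ScaleIndex → Fock M) : Prop :=
  x ∈ S ∧ x ≠ y ∧ x.chartIndex = y.chartIndex ∧ (∀ I, FieldOn T (C I)) ∧
  ∃ F : ℝ → Finset ScaleIndex,
    (∀ N I, I ∈ F N ↔ C I ≠ 0 ∧ (I.pow + I.powConj).re ≤ N) ∧
    ∀ st : State M, st.Valid (S.erase x) → ∀ h, IsTest (S.erase x) st h → ∀ N : ℝ,
      (fun t : ℂ => evalAt h X (st.collide x y t) -
          ∑ I ∈ F N, I.toFun t * evalAt h (C I) st)
        =o[approach y] fun t : ℂ => ‖t‖ ^ N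

/-! ### Background charges, Coulomb gas correlations, generators -/

/-- A double background charge `(β⁺, β⁻)` at the marked points, with the neutrality
condition `∑ (β⁺ + β⁻) = 2b`; `β⁻` is a divisor in `D`. -/
structure BackgroundCharge (M : MarkedDomain) (b : ℝ) where
  plus : Fin M.numMarks → ℂ
  minus : Fin M.numMarks → ℂ
  minus_boundary : ∀ k, ‖M.mark k‖ = 1 → minus k = 0
  neutral : ∑ k, (plus k + minus k) = 2 * b

/-- A double divisor `∑ (σ⁺ · x, σ⁻ · x)`, as a list of `(x, σ⁺, σ⁻)`. -/
abbrev DoubleDivisor (M : MarkedDomain) := List (Pt M × ℂ × ℂ)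

/-- `τ` is a double divisor at distinct nodes with the neutrality condition `∑ (τ⁺ + τ⁻) = 0`. -/
def DoubleDivisor.IsNeutral (τ : DoubleDivisor M) : Prop :=
  (τ.map fun d => d.1).Nodup ∧ (∀ d ∈ τ, d.1.IsNode) ∧ (τ.map fun d => d.2.1 + d.2.2).sum = 0

def DoubleDivisor.nodes (τ : DoubleDivisor M) : Finset (Pt M) := (τ.map fun d => d.1).toFinset

/-- The conformal dimension `λ_b(σ) = σ²/2 - σ b`. -/
def dimension (b : ℝ) (σ : ℂ) : ℂ := σ ^ 2 / 2 - σ * b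

/-- Logarithm of the interaction of two charged points (in this order). -/
def pairLog (d e : Pt M × ℂ × ℂ) (st : State M) : ℂ :=
  d.2.1 * e.2.1 * st.logDiff d.1 e.1 + d.2.2 * e.2.2 * starRingEnd ℂ (st.logDiff d.1 e.1) +
  d.2.1 * e.2.2 * Complex.log (1 - st.pos d.1 * starRingEnd ℂ (st.pos e.1)) +
  e.2.1 * d.2.2 * Complex.log (1 - st.pos e.1 * starRingEnd ℂ (st.pos d.1))

/-- Logarithm of the self-interaction `(1 - |w x|²)^{σ⁺ σ⁻}` and of the factor
`(w' x)^{λ_b(σ⁺)} (conj (w' x))^{λ_b(σ⁻)}` of a differential evaluated in the chart at `x`. -/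
def selfLog (b : ℝ) (d : Pt M × ℂ × ℂ) (st : State M) : ℂ :=
  d.2.1 * d.2.2 * Complex.log (1 - st.pos d.1 * starRingEnd ℂ (st.pos d.1)) +
  dimension b d.2.1 * st.logDeriv d.1 + dimension b d.2.2 * starRingEnd ℂ (st.logDeriv d.1)

def coulombLog (b : ℝ) : DoubleDivisor M → State M → ℂ
  | [], _ => 0
  | d :: τ, st => selfLog b d st + (τ.map fun e => pairLog d e st).sum + coulombLog b τ st

/-- The Coulomb gas correlation function `C_(b)[σ⁺, σ⁻]`: the differential whose value in the unit
disc is `∏_{j<k} (z_j - z_k)^{σ_j⁺ σ_k⁺} (conj z_j - conj z_k)^{σ_j⁻ σ_k⁻}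
∏_{j,k} (1 - z_j conj z_k)^{σ_j⁺ σ_k⁻}`, evaluated in the charts of the points. -/
def coulomb (b : ℝ) (σ : DoubleDivisor M) : Coeff M := fun st => Complex.exp (coulombLog b σ st)

/-- The exponent `i Φ[τ] = ∑ i τ⁺ Φ⁺(x) - i τ⁻ Φ⁻(x)`. -/
def iPhi (τ : DoubleDivisor M) : Expo M :=
  (τ.map fun d => Finsupp.single (d.1, true) (Complex.I * d.2.1) +
    Finsupp.single (d.1, false) (-Complex.I * d.2.2)).sum

/-- The Wick exponential `V^⊙[τ] = e^{⊙ i Φ[τ]}`. -/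
def vertexWick (τ : DoubleDivisor M) : Fock M := wickExp (iPhi τ)

namespace BackgroundCharge

variable {b : ℝ}

/-- The background charge as a double divisor. -/
def divisor (β : BackgroundCharge M b) : DoubleDivisor M :=
  (List.finRange M.numMarks).map fun k => (.marked k, β.plus k, β.minus k)

/-- The divisor `β - β'`. -/
def diff (β β' : BackgroundCharge M b) : DoubleDivisor M :=
  (List.finRange M.numMarks).map fun k =>
    (.marked k, β.plus k - β'.plus k, β.minus k - β'.minus k)

/-- The non-random parts `φ_β^±` of the modified bosonic fields `Φ_β^± = Φ^± + φ_β^±`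
(sign `true` is `+`). -/
def phi (β : BackgroundCharge M b) : Bool → Pt M → Coeff M
  | true, x => fun st =>
      -Complex.I * (∑ k, (β.plus k * st.logDiff x (.marked k) +
        β.minus k * Complex.log (1 - st.pos x * starRingEnd ℂ (st.pos (.marked k))))) +
      Complex.I * b * st.logDeriv x
  | false, x => fun st =>
      Complex.I * (∑ k, (β.minus k * starRingEnd ℂ (st.logDiff x (.marked k)) +
        β.plus k * Complex.log (1 - st.pos (.marked k) * starRingEnd ℂ (st.pos x)))) -
      Complex.I * b * starRingEnd ℂ (st.logDeriv x)

/-- The modified bosonic field `Φ_β[τ] = ∑ τ⁺ Φ_β⁺(x) - τ⁻ Φ_β⁻(x)`; in particular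
`Φ_β(x) = Φ_β[(x, 1, -1)]`. -/
def bosonic (β : BackgroundCharge M b) (τ : DoubleDivisor M) : Fock M :=
  (τ.map fun d =>
    d.2.1 • (gauss (d.1, true, 0) + nonrandom (β.phi true d.1)) -
    d.2.2 • (gauss (d.1, false, 0) + nonrandom (β.phi false d.1))).sum

/-- The OPE exponential `O_β[τ] = (C_(b)[τ + β] / C_(b)[β]) V^⊙[τ]`. -/
def opeExp (β : BackgroundCharge M b) (τ : DoubleDivisor M) : Fock M :=
  (coulomb b (τ ++ β.divisor) / coulomb b β.divisor : Coeff M) • vertexWick τ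

/-- The OPE family `F_β(D*)`, where `D*` is the complement of the marked points in `D`: the algebra
of (multi-node) fields generated by `1`, `Φ_β[τ]` and `O_β[τ]` under linear combinations,
tensor products, differentiation and taking coefficients of operator product expansions.
`β.Family S X` says that `X` is a member with nodes `S`. -/
inductive Family (β : BackgroundCharge M b) : Finset (Pt M) → Fock M → Prop
  | one {S : Finset (Pt M)} (hS : ∀ x ∈ S, x.IsNode) : Family β S 1
  | bosonic {τ : DoubleDivisor M} (hτ : τ.IsNeutral) : Family β τ.nodes (β.bosonic τ)
  | opeExp {τ : DoubleDivisor M} (hτ : τ.IsNeutral) : Family β τ.nodes (β.opeExp τ)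
  | add {S : Finset (Pt M)} {X Y : Fock M} (hX : Family β S X) (hY : Family β S Y) :
      Family β S (X + Y)
  | smul {S : Finset (Pt M)} {X : Fock M} (a : ℂ) (hX : Family β S X) : Family β S (a • X)
  | tensor {S T : Finset (Pt M)} {X Y : Fock M} (hST : Disjoint S T) (hX : Family β S X)
      (hY : Family β T Y) : Family β (S ∪ T) (tensor X Y)
  | deriv {S : Finset (Pt M)} {X Y Y' : Fock M} {x : Pt M} (hX : Family β S X) (hx : x ∈ S)
      (hY : FieldOn S Y) (hY' : FieldOn S Y') (h : HasDerivs S X x Y Y') : Family β S Y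
  | derivConj {S : Finset (Pt M)} {X Y Y' : Fock M} {x : Pt M} (hX : Family β S X) (hx : x ∈ S)
      (hY : FieldOn S Y) (hY' : FieldOn S Y') (h : HasDerivs S X x Y Y') : Family β S Y'
  | ope {S : Finset (Pt M)} {X : Fock M} {x y : Pt M} {C : ScaleIndex → Fock M}
      (hX : Family β S X) (hy : y ∈ S) (h : HasOPE S X x y (S.erase x) C) (I : ScaleIndex) :
      Family β (S.erase x) (C I)
  | congr {S : Finset (Pt M)} {X Y : Fock M} (hX : Family β S X) (hY : FieldOn S Y)
      (h : EqWithin S X Y) : Family β S Y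

end BackgroundCharge

/-! ### The extended OPE family -/

/-- A list of operations "let the node `x` tend to the `k`-th marked point", performed in order. -/
abbrev Punctures (M : MarkedDomain) := List (Pt M × Fin M.numMarks)

/-- Iterated operator product expansion at the marked points: `C [I₁, …, Iₙ]` is the `Iₙ`-th
coefficient of the expansion of the … of the `I₁`-th coefficient of the expansion of `X`. For a
tensor product `X = X₁ ⋯ Xₙ`, whose last factor is expanded first, the coefficients are the
functionals `X₁ * (⋯ * (Xₙ * 1_q) ⋯)` at the marked point `q`. -/
def IteratedOPE : Punctures M → Finset (Pt M) → Fock M → (List ScaleIndex → Fock M) → Prop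
  | [], _, X, C => C [] = X
  | (x, k) :: L, S, X, C => ∃ D : ScaleIndex → Fock M,
      HasOPE S X x (.marked k) (S.erase x ∪ marks M) D ∧
      ∀ I, IteratedOPE L (S.erase x) (D I) fun l => C (I :: l)

/-- The nodes left after the operations. -/
def remaining (L : Punctures M) (S : Finset (Pt M)) : Finset (Pt M) :=
  S \ (L.map fun o => o.1).toFinset

/-- `X` has charges `σ x = (σ⁺, σ⁻)` at the nodes `x` of the list, i.e. the Wick exponential of
every basic field in `X` contains `i σ⁺ Φ⁺(x) - i σ⁻ Φ⁻(x)`. -/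
def HasCharges (L : Punctures M) (X : Fock M) (σ : Pt M → ℂ × ℂ) : Prop :=
  ∀ o ∈ L, ∀ p ∈ X.coeff.support,
    p.2 (o.1, true) = Complex.I * (σ o.1).1 ∧ p.2 (o.1, false) = -Complex.I * (σ o.1).2

namespace BackgroundCharge

variable {b : ℝ}

/-- The extended OPE family `F_β`: the span of the strings obtained from the fields in `F_β(D*)` by
operator product expansions at the marked points. -/
inductive ExtFamily (β : BackgroundCharge M b) : Finset (Pt M) → Fock M → Prop
  | string {S : Finset (Pt M)} {X : Fock M} {L : Punctures M} {σ : Pt M → ℂ × ℂ}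
      {C : List ScaleIndex → Fock M} {l : List ScaleIndex}
      (hX : β.Family S X) (hσ : HasCharges L X σ) (hC : IteratedOPE L S X C)
      (hl : l.length = L.length) : ExtFamily β (remaining L S) (C l)
  | add {S : Finset (Pt M)} {X Y : Fock M} (hX : ExtFamily β S X) (hY : ExtFamily β S Y) :
      ExtFamily β S (X + Y)
  | smul {S : Finset (Pt M)} {X : Fock M} (a : ℂ) (hX : ExtFamily β S X) :
      ExtFamily β S (a • X)

/-! ### The insertion of `V^⊙[β - β₀]` -/

/-- The operator `X ↦ X̂` on Fock space fields in `D*` given by the rules `∂X ↦ ∂X̂`, `∂̄X ↦ ∂̄X̂`,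
linearity, `X ⊙ Y ↦ X̂ ⊙ Ŷ` and by `Φ_β₀^± ↦ Φ_β^±`, i.e. `Φ^± ↦ Φ^± + φ_β^± - φ_β₀^±`. -/
def hat (β₀ β : BackgroundCharge M b) : Fock M →ₐ[Coeff M] Fock M :=
  translate fun g => dSign g.2.1 g.1 g.2.2 (β.phi g.2.1 g.1 - β₀.phi g.2.1 g.1)

/-- A node with charges `(σ⁺, σ⁻)` has the powers `t^{σ⁺ β⁺ + …} (conj t)^{σ⁻ β⁻ + …}` in its
expansions at a marked interior point with background charges `(β⁺, β⁻)`, and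
`t^{σ⁺ β⁺ + …} (conj t)^{σ⁻ β⁺ + …}` at a marked boundary point. The change from `β₀` to `β` shifts
the powers. -/
def shiftIndex (β₀ β : BackgroundCharge M b) (σ : Pt M → ℂ × ℂ) (o : Pt M × Fin M.numMarks)
    (I : ScaleIndex) : ScaleIndex where
  pow := I.pow + (σ o.1).1 * (β.plus o.2 - β₀.plus o.2)
  powConj := I.powConj + (σ o.1).2 *
    (if ‖M.mark o.2‖ = 1 then β.plus o.2 - β₀.plus o.2 else β.minus o.2 - β₀.minus o.2)
  log := I.log
  logConj := I.logConj

/-- `Inserted β₀ β S Y W Z`: the string `Y` of the extended family of `β₀`, its product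
`W` with `V^⊙[β - β₀]`, and its image `Z`. For a string without functionals at the marked points,
`W` is the tensor product and `Z = Ŷ`; for the others the product is understood in the sense of
operator product expansions at the marked points: the same coefficients (relative to the leading
power) are taken in the expansions of `X`, of `X V^⊙[β - β₀]` and of `X̂`. -/
inductive Inserted (β₀ β : BackgroundCharge M b) :
    Finset (Pt M) → Fock M → Fock M → Fock M → Prop
  | string {S : Finset (Pt M)} {X : Fock M} {L : Punctures M} {σ : Pt M → ℂ × ℂ}
      {C CV C' : List ScaleIndex → Fock M} {l : List ScaleIndex}
      (hX : β₀.Family S X) (hσ : HasCharges L X σ) (hC : IteratedOPE L S X C)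
      (hCV : IteratedOPE L S (CoulombGas.tensor X (vertexWick (β.diff β₀))) CV)
      (hC' : IteratedOPE L S (hat β₀ β X) C') (hl : l.length = L.length) :
      Inserted β₀ β (remaining L S) (C l)
        (CV (List.zipWith (shiftIndex β₀ β σ) L l)) (C' (List.zipWith (shiftIndex β₀ β σ) L l))
  | add {S : Finset (Pt M)} {Y W Z Y' W' Z' : Fock M} (h : Inserted β₀ β S Y W Z)
      (h' : Inserted β₀ β S Y' W' Z') : Inserted β₀ β S (Y + Y') (W + W') (Z + Z')
  | smul {S : Finset (Pt M)} {Y W Z : Fock M} (a : ℂ) (h : Inserted β₀ β S Y W Z) :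
      Inserted β₀ β S (a • Y) (a • W) (a • Z)

end BackgroundCharge

end CoulombGas

end

/-!
# Insertion of the Wick exponential of a difference of background charges

Throughout, `β₀` and `β` are background charges, and `u` denotes the non-random pair
`φ_β - φ_β₀`. The conformal anomaly `± i b log w'` is the same in `φ_β` and `φ_β₀`, so `u` consists
of multivalued holomorphic and antiholomorphic functions with logarithmic singularities at the
marked points only. The map `X ↦ X̂` translates each symbol `∂^m Φ^±` by the corresponding
derivative of `u`.

*The image of the family.* A field is determined within correlations by its evaluations `evalJet`,
in which the symbols are replaced by numbers. The translation of a field, evaluated at jets `j`, is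
the field evaluated at `j + u` (`evalJet_translate`). Translations commute with contractions, hence
with tensor products (`translate_tensor`), and map the generators of one family to those of the
other (`hat_bosonic`, `hat_opeExp`). Derivatives and operator product expansions at the nodes are
defined through correlations with Wick exponentials, i.e. through evaluations at the jets of test
functions. The nodes being distinct, the branches of `u` near them can be added to the test
functions (`exists_isShifted`), so that translation amounts to a change of the test functions
(`IsShifted.jet_eq`); thus it respects these operations (`hasDerivs_hat`, `hasOPE_hat`). Exchanging
`β₀` and `β` gives the inverse (`hat_hat`), and the translation is a bijection of the families
(`image_family`).

*The correlations.* By Wick's formula, insertion of a Wick exponential translates every symbol by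
its covariance with the exponent, as in the theorem of Girsanov (`tensor_wickExp`). The covariance
with `iΦ[β - β₀]` is `u` (`covRight_eq_shift`).

*The extended families: equality of expectations.* The expectations of the insertion and of the
image agree before the nodes tend to the marked points. An expansion in the scale
`t^a conj(t)^a' (log t)^p conj(log t)^p'` is unique (`scale_unique`): on a ray, a combination of
members of the scale of order at most `N`, divided by `|t|^N`, solves a recurrence in `log |t|`, and
the recurrence has no decaying solution other than zero; the members of the scale are independent,
as entire functions of `log t` and its conjugate. Therefore corresponding coefficients have equal
expectations (`IteratedOPE.expect_eq`).

*The extended families: existence of the expansions.* Near a marked point, `u` is a multiple of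
`log t` plus an analytic function of `t` (`potential_eq_regular`); at a boundary point the mirror
term contributes to the singularity. Hence the translations and their exponentials belong to the
algebra `iterAlg` of functions with iterated expansions (`shift_mem_iterAlg`). A field with
coefficients in this algebra has an iterated operator product expansion
(`exists_iteratedOPE`). What is given, conversely, is a field `X` with definite charges at the moving
nodes that has an iterated expansion, and its coefficients are shown to lie in the algebra
(`IteratedOPE.mem_fieldAlg`). They are combinations of evaluations of `X` at constant jets
(`exists_coeff_weights`), which are not correlations with a fixed test function, since the jets at a
node close to `q_k` and at `q_k` must be prescribed independently. With polynomial germs of test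
functions at `q_k`, however, the correlation is a polynomial in the coefficients of the germ, up to
an explicit exponential factor (`ChargedOn.exists_mvPolynomial`); this is where definite charges are
needed. A polynomial of bounded degree is determined by finitely many values, and Hermite
interpolation gives germs, with coefficients that are powers of `t`, having the prescribed jets at
both points (`IteratedOPE.evalJet_mem`). The charges of the coefficients of the expansion are again
definite (`ChargedOn.coeff`), so this can be repeated for the next node.

It follows that the image and the insertion have iterated expansions whenever `X` has
(`exists_iteratedOPE_tensor`); as the shift of the exponents is invertible, every string of the
family of `β` is an image.
-/

noncomputable section

namespace CoulombGas

variable {M : MarkedDomain}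

/-! ### Evaluation of Fock space fields at prescribed jets -/

/-- The value of the basic field with label `p` when the symbol `g` is replaced by the number
`j g`. -/
def monoVal (j : Sym M → ℂ) (p : (Sym M →₀ ℕ) × Expo M) : ℂ :=
  (p.1.prod fun g n => j g ^ n) * Complex.exp (p.2.sum fun x a => a * j (x.1, x.2, 0))

theorem monoVal_add (j : Sym M → ℂ) (p q : (Sym M →₀ ℕ) × Expo M) :
    monoVal j (p + q) = monoVal j p * monoVal j q := by
  unfold monoVal
  rw [Prod.fst_add, Prod.snd_add, Finsupp.prod_add_index' (by simp) (by intros; rw [pow_add]),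
    Finsupp.sum_add_index' (by simp) (by intros; ring), Complex.exp_add]
  ring

theorem monoVal_zero (j : Sym M → ℂ) : monoVal j 0 = 1 := by simp [monoVal]

/-- Evaluation of a field at the configuration `st`, every symbol `g` being replaced by the number
`j g`; this is a homomorphism of `⊙`-algebras. -/
def evalJet (st : State M) (j : Sym M → ℂ) : Fock M →ₐ[ℂ] ℂ :=
  AddMonoidAlgebra.liftNCAlgHom (Pi.evalAlgHom ℂ (fun _ : State M => ℂ) st)
    { toFun := fun p => monoVal j p.toAdd
      map_one' := monoVal_zero j
      map_mul' := fun _ _ => monoVal_add j _ _ } (fun _ _ => Commute.all _ _)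

theorem evalJet_single (st : State M) (j : Sym M → ℂ) (p : (Sym M →₀ ℕ) × Expo M) (f : Coeff M) :
    evalJet st j (AddMonoidAlgebra.single p f) = f st * monoVal j p := by
  simp [evalJet]

theorem evalJet_apply (st : State M) (j : Sym M → ℂ) (X : Fock M) :
    evalJet st j X = X.coeff.sum fun p f => f st * monoVal j p := by
  rw [← X.sum_coeff_single, map_finsuppSum]
  simp only [evalJet_single, AddMonoidAlgebra.sum_coeff_single]

theorem evalJet_nonrandom (st : State M) (j : Sym M → ℂ) (f : Coeff M) :
    evalJet st j (nonrandom f) = f st := by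
  simp [nonrandom, evalJet_single, monoVal_zero]

theorem evalJet_gauss (st : State M) (j : Sym M → ℂ) (g : Sym M) :
    evalJet st j (gauss g) = j g := by
  simp [gauss, evalJet_single, monoVal]

theorem evalJet_wickExp (st : State M) (j : Sym M → ℂ) (η : Expo M) :
    evalJet st j (wickExp η) = Complex.exp (η.sum fun x a => a * j (x.1, x.2, 0)) := by
  simp [wickExp, evalJet_single, monoVal]

/-- The derivatives at the points of the two functions of a test pair `h`. -/
def jet (h : (ℂ → ℂ) × (ℂ → ℂ)) (st : State M) : Sym M → ℂ
  | (x, true, m) => iteratedDeriv m (fun z => h.1 (x.chart.disc z)) (st.coord x)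
  | (x, false, m) => starRingEnd ℂ (iteratedDeriv m (fun z => h.2 (x.chart.disc z)) (st.coord x))

theorem evalAt_eq (h : (ℂ → ℂ) × (ℂ → ℂ)) (X : Fock M) (st : State M) :
    evalAt h X st = evalJet st (jet h st) X := by
  rw [evalJet_apply]
  unfold evalAt monoVal
  refine Finsupp.sum_congr fun p _ => ?_
  rw [← mul_assoc]
  rfl

/-! ### The algebra of Fock space fields -/

theorem nonrandom_mul (f : Coeff M) (X : Fock M) : nonrandom f * X = f • X := by
  induction X using AddMonoidAlgebra.induction_linear with
  | zero => simp
  | add X Y hX hY => rw [mul_add, hX, hY, smul_add]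
  | single p a => simp [nonrandom, AddMonoidAlgebra.single_mul_single]

theorem evalJet_smul (st : State M) (j : Sym M → ℂ) (f : Coeff M) (X : Fock M) :
    evalJet st j (f • X) = f st * evalJet st j X := by
  rw [← nonrandom_mul, map_mul, evalJet_nonrandom]

theorem single_eq_prod (p : (Sym M →₀ ℕ) × Expo M) (f : Coeff M) :
    (AddMonoidAlgebra.single p f : Fock M) =
      f • ((p.1.prod fun g n => gauss g ^ n) * wickExp p.2) := by
  have h : ∀ n : Sym M →₀ ℕ, (n.prod fun g k => gauss g ^ k : Fock M) =
      AddMonoidAlgebra.single (n, 0) 1 := by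
    intro n
    induction n using Finsupp.induction_linear with
    | zero => rfl
    | add a b ha hb =>
      rw [Finsupp.prod_add_index' (by simp) (by intros; rw [pow_add]), ha, hb,
        AddMonoidAlgebra.single_mul_single]
      simp
    | single g k =>
      rw [Finsupp.prod_single_index (by simp)]
      simp [gauss, AddMonoidAlgebra.single_pow]
  rw [h, wickExp, AddMonoidAlgebra.single_mul_single]
  simp

/-- Every field is built from Wick exponentials by Wick multiplication by symbols, by non-random
functions and by sums. -/
theorem fock_induction {P : Fock M → Prop} (hadd : ∀ X Y, P X → P Y → P (X + Y))
    (hsmul : ∀ (f : Coeff M) X, P X → P (f • X)) (hwick : ∀ η, P (wickExp η))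
    (hgauss : ∀ g X, P X → P (gauss g * X)) (X : Fock M) : P X := by
  induction X using AddMonoidAlgebra.induction_linear with
  | zero => simpa using hsmul 0 _ (hwick 0)
  | add X Y hX hY => exact hadd X Y hX hY
  | single p f =>
    rw [single_eq_prod]
    apply hsmul
    generalize p.2 = η
    generalize p.1 = n
    induction n using Finsupp.induction_linear generalizing η with
    | zero => simpa using hwick η
    | add a b ha hb =>
      rw [Finsupp.prod_add_index' (by simp) (by intros; rw [pow_add])]
      have key : ∀ (a : Sym M →₀ ℕ) (Y : Fock M), P Y →
          P ((a.prod fun g k => gauss g ^ k) * Y) := by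
        intro a Y hY
        rw [Finsupp.prod]
        induction a.support using Finset.induction_on with
        | empty => simpa using hY
        | insert g s hg ih =>
          rw [Finset.prod_insert hg, mul_assoc]
          generalize (∏ x ∈ s, gauss x ^ a x) * Y = Z at ih
          induction a g with
          | zero => simpa using ih
          | succ k ihk => rw [pow_succ', mul_assoc]; exact hgauss _ _ ihk
      rw [mul_assoc]
      exact key _ _ (hb η)
    | single g k =>
      rw [Finsupp.prod_single_index (by simp)]
      induction k with
      | zero => simpa using hwick η
      | succ k ihk => rw [pow_succ', mul_assoc]; exact hgauss _ _ ihk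

theorem translate_single (c : Sym M → Coeff M) (p : (Sym M →₀ ℕ) × Expo M) (f : Coeff M) :
    translate c (AddMonoidAlgebra.single p f) = f •
      ((p.1.prod fun g n => (gauss g + nonrandom (c g)) ^ n) *
        (nonrandom (fun st => Complex.exp (p.2.sum fun x a => a * c (x.1, x.2, 0) st)) *
          wickExp p.2)) := by
  rw [translate, AddMonoidAlgebra.lift_single]
  rfl

theorem translate_gauss (c : Sym M → Coeff M) (g : Sym M) :
    translate c (gauss g) = gauss g + nonrandom (c g) := by
  rw [gauss, translate_single, Finsupp.prod_single_index (by simp), pow_one]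
  have h : (nonrandom fun _ : State M => (1 : ℂ)) = 1 := rfl
  have h0 : (wickExp 0 : Fock M) = 1 := rfl
  simp only [Finsupp.sum_zero_index, Complex.exp_zero, h, h0, mul_one, one_smul]
  rfl

/-- The factor by which a translation multiplies the Wick exponential of `η`. -/
def expoFactor (c : Sym M → Coeff M) (η : Expo M) : Coeff M :=
  fun st => Complex.exp (η.sum fun x a => a * c (x.1, x.2, 0) st)

theorem translate_wickExp (c : Sym M → Coeff M) (η : Expo M) :
    translate c (wickExp η) = expoFactor c η • wickExp η := by
  rw [← nonrandom_mul]
  conv_lhs => rw [wickExp, translate_single]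
  simp
  rfl

theorem translate_nonrandom (c : Sym M → Coeff M) (f : Coeff M) :
    translate c (nonrandom f) = nonrandom f := by
  have h : (nonrandom f : Fock M) = f • (1 : Fock M) := by
    rw [← nonrandom_mul, mul_one]
  rw [h, map_smul, map_one]

theorem translate_gauss_mul (c : Sym M → Coeff M) (g : Sym M) (X : Fock M) :
    translate c (gauss g * X) = gauss g * translate c X + c g • translate c X := by
  rw [map_mul, translate_gauss, add_mul, nonrandom_mul]

theorem evalJet_translate (c : Sym M → Coeff M) (X : Fock M) (st : State M) (j : Sym M → ℂ) :
    evalJet st j (translate c X) = evalJet st (fun g => j g + c g st) X := by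
  induction X using fock_induction with
  | hadd X Y hX hY => simp [hX, hY]
  | hsmul f X hX => rw [map_smul, evalJet_smul, evalJet_smul, hX]
  | hwick η =>
    rw [translate_wickExp, evalJet_smul, evalJet_wickExp, evalJet_wickExp, expoFactor,
      ← Complex.exp_add]
    congr 1
    simp only [mul_add]
    rw [Finsupp.sum_add]
    ring
  | hgauss g X hX =>
    rw [translate_gauss_mul, map_add, map_mul, evalJet_smul, hX, map_mul, evalJet_gauss,
      evalJet_gauss]
    ring

/-- Translations compose additively, so they are invertible. -/
theorem translate_translate (c c' : Sym M → Coeff M) (X : Fock M) :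
    translate c (translate c' X) = translate (c + c') X := by
  induction X using fock_induction with
  | hadd X Y hX hY => simp [hX, hY]
  | hsmul f X hX => simp [hX]
  | hwick η =>
    rw [translate_wickExp, map_smul, translate_wickExp, translate_wickExp, smul_smul]
    congr 1
    funext st
    simp only [expoFactor, Pi.mul_apply, ← Complex.exp_add, Pi.add_apply]
    congr 1
    simp only [mul_add]
    rw [Finsupp.sum_add, add_comm]
  | hgauss g X hX =>
    rw [translate_gauss_mul, map_add, map_smul, translate_gauss_mul, translate_gauss_mul, hX,
      Pi.add_apply, add_smul]
    abel

theorem translate_zero (X : Fock M) : translate 0 X = X := by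
  induction X using fock_induction with
  | hadd X Y hX hY => simp [hX, hY]
  | hsmul f X hX => simp [hX]
  | hwick η =>
    rw [translate_wickExp]
    convert one_smul (Coeff M) (wickExp η)
    funext st
    simp [expoFactor]
  | hgauss g X hX => rw [translate_gauss_mul, hX]; simp

/-! ### Contractions and Wick's formula -/

theorem contract_single (g : Sym M) (p : (Sym M →₀ ℕ) × Expo M) (f : Coeff M) :
    contract g (AddMonoidAlgebra.single p f) = (p.1.sum fun g' n =>
      AddMonoidAlgebra.single (p.1 - Finsupp.single g' 1, p.2) ((n : ℂ) • (f * cov g g'))) +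
    AddMonoidAlgebra.single p
      (fun st => f st * p.2.sum fun x a => a * cov g (x.1, x.2, 0) st) := by
  unfold contract
  rw [AddMonoidAlgebra.coeff_single, Finsupp.sum_single_index]
  have h : (fun _ : State M => (0 : ℂ)) = 0 := rfl
  simp [h]

theorem contract_add (g : Sym M) (X Y : Fock M) :
    contract g (X + Y) = contract g X + contract g Y := by
  unfold contract
  rw [AddMonoidAlgebra.coeff_add, Finsupp.sum_add_index']
  · intro p
    have h : (fun _ : State M => (0 : ℂ)) = 0 := rfl
    simp [h]
  · intro p a b
    have h : (fun st => (a + b) st * p.2.sum fun x c => c * cov g (x.1, x.2, 0) st) =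
      (fun st => a st * p.2.sum fun x c => c * cov g (x.1, x.2, 0) st) +
      (fun st => b st * p.2.sum fun x c => c * cov g (x.1, x.2, 0) st) := by
      funext st; simp [add_mul]
    rw [h, AddMonoidAlgebra.single_add]
    simp only [add_mul, smul_add, AddMonoidAlgebra.single_add]
    rw [Finsupp.sum_add]
    abel

theorem contract_smul (g : Sym M) (f : Coeff M) (X : Fock M) :
    contract g (f • X) = f • contract g X := by
  induction X using AddMonoidAlgebra.induction_linear with
  | zero => simp [contract]
  | add X Y hX hY => rw [smul_add, contract_add, contract_add, hX, hY, smul_add]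
  | single p a =>
    rw [AddMonoidAlgebra.smul_single, contract_single, contract_single, smul_add,
      Finsupp.smul_sum]
    simp only [AddMonoidAlgebra.smul_single]
    congr 1
    · refine Finsupp.sum_congr fun x _ => ?_
      congr 1
      funext st
      simp
      ring
    · congr 1
      funext st
      simp
      ring

theorem contract_wickExp (g : Sym M) (η : Expo M) :
    contract g (wickExp η) =
      (fun st => η.sum fun x a => a * cov g (x.1, x.2, 0) st : Coeff M) • wickExp η := by
  rw [wickExp, contract_single, AddMonoidAlgebra.smul_single]
  simp

/-- Contraction with `g` is a derivation. -/
theorem contract_gauss_mul (g g' : Sym M) (X : Fock M) :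
    contract g (gauss g' * X) = cov g g' • X + gauss g' * contract g X := by
  induction X using AddMonoidAlgebra.induction_linear with
  | zero => simp [contract]
  | add X Y hX hY => rw [mul_add, contract_add, contract_add, hX, hY, smul_add, mul_add]; abel
  | single p f =>
    obtain ⟨n, η⟩ := p
    rw [gauss, AddMonoidAlgebra.single_mul_single, contract_single, contract_single, mul_add,
      AddMonoidAlgebra.single_mul_single, ← add_assoc]
    simp only [Prod.mk_add_mk, zero_add, one_mul]
    congr 1
    rw [Finsupp.mul_sum, AddMonoidAlgebra.smul_single]
    simp only [AddMonoidAlgebra.single_mul_single, Prod.mk_add_mk, zero_add, one_mul]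
    have hs : n.support ⊆ insert g' n.support := Finset.subset_insert _ _
    have hs' : (Finsupp.single g' 1 + n).support ⊆ insert g' n.support := by
      intro k hk
      simp only [Finsupp.mem_support_iff, Finsupp.add_apply, Finset.mem_insert] at hk ⊢
      by_contra hc
      push Not at hc
      rw [Finsupp.single_eq_of_ne hc.1, hc.2] at hk
      exact hk rfl
    rw [Finsupp.sum_of_support_subset _ hs' _ (by simp), Finsupp.sum_of_support_subset _ hs _
      (by simp)]
    have hmem : g' ∈ insert g' n.support := Finset.mem_insert_self _ _
    rw [← Finset.add_sum_erase _ _ hmem, ← Finset.add_sum_erase _ _ hmem, ← add_assoc]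
    congr 1
    · rw [add_tsub_cancel_left]
      rcases Nat.eq_zero_or_pos (n g') with h0 | h0
      · simp [h0, mul_comm]
      · have : Finsupp.single g' 1 + (n - Finsupp.single g' 1) = n :=
          add_tsub_cancel_of_le (Finsupp.single_le_iff.2 h0)
        rw [this, ← AddMonoidAlgebra.single_add]
        congr 1
        simp
        rw [add_smul, one_smul, mul_comm]
    · refine Finset.sum_congr rfl fun k hk => ?_
      have hne : k ≠ g' := (Finset.mem_erase.1 hk).1
      have hk' : k ∈ n.support := (Finset.mem_insert.1 (Finset.mem_erase.1 hk).2).resolve_left hne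
      have h1 : Finsupp.single k 1 ≤ n :=
        Finsupp.single_le_iff.2 (Nat.one_le_iff_ne_zero.2 (Finsupp.mem_support_iff.1 hk'))
      rw [add_tsub_assoc_of_le h1]
      simp [Finsupp.single_eq_of_ne hne]

theorem contract_translate (c : Sym M → Coeff M) (g : Sym M) (Y : Fock M) :
    contract g (translate c Y) = translate c (contract g Y) := by
  induction Y using fock_induction with
  | hadd X Y hX hY => simp [contract_add, hX, hY]
  | hsmul f X hX => simp [contract_smul, hX]
  | hwick η =>
    rw [translate_wickExp, contract_smul, contract_wickExp, map_smul, translate_wickExp, smul_comm]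
  | hgauss g' X hX =>
    rw [translate_gauss_mul, contract_add, contract_smul, contract_gauss_mul, contract_gauss_mul,
      map_add, map_smul, translate_gauss_mul, hX]
    abel

theorem contract_comm (g g' : Sym M) (Y : Fock M) :
    contract g (contract g' Y) = contract g' (contract g Y) := by
  induction Y using fock_induction with
  | hadd X Y hX hY => simp [contract_add, hX, hY]
  | hsmul f X hX => simp [contract_smul, hX]
  | hwick η =>
    rw [contract_wickExp, contract_smul, contract_wickExp, contract_smul, contract_wickExp,
      smul_comm]
  | hgauss k X hX =>
    rw [contract_gauss_mul, contract_add, contract_smul, contract_gauss_mul, contract_gauss_mul,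
      contract_add, contract_smul, contract_gauss_mul, hX]
    abel

theorem wickSum_mul_left (l : List (Sym M)) (A B Y : Fock M) :
    wickSum l (A * B) Y = A * wickSum l B Y := by
  induction l generalizing A B Y with
  | nil => simp [wickSum, mul_assoc]
  | cons g l ih => simp only [wickSum, mul_assoc, ih, mul_add]

/-- Wick's formula does not depend on the order in which the symbols are contracted. -/
theorem wickSum_perm {l l' : List (Sym M)} (h : l.Perm l') (A Y : Fock M) :
    wickSum l A Y = wickSum l' A Y := by
  induction h generalizing A Y with
  | nil => rfl
  | cons g _ ih => simp only [wickSum, ih]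
  | swap g g' l =>
    simp only [wickSum]
    rw [contract_comm g g', mul_right_comm A]
    abel
  | trans _ _ ih ih' => rw [ih, ih']

theorem tensor_single (p : (Sym M →₀ ℕ) × Expo M) (f : Coeff M) (Y : Fock M) :
    tensor (AddMonoidAlgebra.single p f) Y =
      f • wickSum p.1.toMultiset.toList (wickExp p.2) (translate (covExpo p.2) Y) := by
  simp [tensor]

theorem tensor_add_left (X X' Y : Fock M) : tensor (X + X') Y = tensor X Y + tensor X' Y := by
  unfold tensor
  rw [AddMonoidAlgebra.coeff_add, Finsupp.sum_add_index' (by simp) (by intros; rw [add_smul])]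

theorem tensor_smul_left (f : Coeff M) (X Y : Fock M) : tensor (f • X) Y = f • tensor X Y := by
  induction X using AddMonoidAlgebra.induction_linear with
  | zero => simp [tensor]
  | add X Z hX hZ => rw [smul_add, tensor_add_left, tensor_add_left, hX, hZ, smul_add]
  | single p a => rw [AddMonoidAlgebra.smul_single, tensor_single, tensor_single, smul_smul]; rfl

theorem tensor_wickExp_left (η : Expo M) (Y : Fock M) :
    tensor (wickExp η) Y = wickExp η * translate (covExpo η) Y := by
  conv_lhs => rw [wickExp, tensor_single]
  simp [wickSum]

theorem tensor_gauss_mul (g : Sym M) (X Y : Fock M) :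
    tensor (gauss g * X) Y = gauss g * tensor X Y + tensor X (contract g Y) := by
  induction X using AddMonoidAlgebra.induction_linear with
  | zero => simp [tensor]
  | add X Z hX hZ =>
    rw [mul_add, tensor_add_left, tensor_add_left, tensor_add_left, hX, hZ, mul_add]
    abel
  | single p f =>
    have h : (gauss g * AddMonoidAlgebra.single p f : Fock M) =
        AddMonoidAlgebra.single (Finsupp.single g 1 + p.1, p.2) f := by
      rw [gauss, AddMonoidAlgebra.single_mul_single]
      simp [Prod.ext_iff, Prod.fst_add, AddMonoidAlgebra.single_inj]
    rw [h, tensor_single, tensor_single, tensor_single]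
    have hp : (Finsupp.toMultiset (Finsupp.single g 1 + p.1)).toList.Perm
        (g :: (Finsupp.toMultiset p.1).toList) := by
      rw [← Multiset.coe_eq_coe, ← Multiset.cons_coe]
      simp
    rw [wickSum_perm hp, wickSum, smul_add, contract_translate, mul_comm (wickExp _),
      wickSum_mul_left, mul_smul_comm]

/-- Translations commute with tensor products, since they commute with contractions. -/
theorem translate_tensor (c : Sym M → Coeff M) (X Y : Fock M) :
    translate c (tensor X Y) = tensor (translate c X) (translate c Y) := by
  induction X using fock_induction generalizing Y with
  | hadd X Z hX hZ => simp [tensor_add_left, hX, hZ]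
  | hsmul f X hX => simp [tensor_smul_left, hX]
  | hwick η =>
    rw [tensor_wickExp_left, map_mul, translate_wickExp, tensor_smul_left, tensor_wickExp_left,
      translate_translate, translate_translate, add_comm, smul_mul_assoc]
  | hgauss g X hX =>
    rw [tensor_gauss_mul, map_add, translate_gauss_mul, hX, hX, translate_gauss_mul,
      tensor_add_left, tensor_smul_left, tensor_gauss_mul, contract_translate]
    abel

theorem tensor_smul_right (f : Coeff M) (X Y : Fock M) : tensor X (f • Y) = f • tensor X Y := by
  induction X using fock_induction generalizing Y with
  | hadd X Z hX hZ => simp [tensor_add_left, hX, hZ]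
  | hsmul f' X hX => rw [tensor_smul_left, tensor_smul_left, hX, smul_comm]
  | hwick η => rw [tensor_wickExp_left, tensor_wickExp_left, map_smul, mul_smul_comm]
  | hgauss g X hX => rw [tensor_gauss_mul, tensor_gauss_mul, contract_smul, hX, hX, mul_smul_comm,
      smul_add]

/-- The covariance of the symbol `g` with the Gaussian field `η`. -/
def covRight (η : Expo M) (g : Sym M) : Coeff M :=
  fun st => η.sum fun x a => a * cov g (x.1, x.2, 0) st

/-- Insertion of a Wick exponential translates every Gaussian by its covariance with the
exponent (Girsanov). -/
theorem tensor_wickExp (X : Fock M) (η : Expo M) :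
    tensor X (wickExp η) = translate (covRight η) X * wickExp η := by
  induction X using fock_induction with
  | hadd X Z hX hZ => rw [tensor_add_left, hX, hZ, map_add, add_mul]
  | hsmul f' X hX => rw [tensor_smul_left, map_smul, hX, smul_mul_assoc]
  | hwick η' =>
    rw [tensor_wickExp_left, translate_wickExp, translate_wickExp, mul_smul_comm, smul_mul_assoc]
    congr 1
    funext st
    simp only [expoFactor, covExpo, covRight, Finsupp.mul_sum]
    rw [Finsupp.sum_comm]
    congr 1
    refine Finsupp.sum_congr fun x _ => Finsupp.sum_congr fun y _ => ?_
    ring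
  | hgauss g X hX =>
    rw [tensor_gauss_mul, contract_wickExp, tensor_smul_right, hX, translate_gauss_mul, add_mul,
      smul_mul_assoc, mul_assoc]
    rfl

theorem expect_eq (X : Fock M) (st : State M) : expect X st = evalJet st 0 X := by
  rw [evalJet_apply, expect]
  refine Finsupp.sum_congr fun p _ => ?_
  rcases eq_or_ne p.1 0 with h | h
  · simp [monoVal, h]
  · obtain ⟨g, hg⟩ := Finsupp.support_nonempty_iff.2 h
    have : (p.1.prod fun g n => (0 : Sym M → ℂ) g ^ n) = 0 :=
      Finset.prod_eq_zero hg (by simpa using Finsupp.mem_support_iff.1 hg)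
    have h0 : monoVal 0 p = 0 := by rw [monoVal, this, zero_mul]
    rw [h0, mul_zero, if_neg h]

/-! ### The image of the generators -/

theorem State.move_zero (x : Pt M) (st : State M) : st.move x 0 = st := by
  have hl : ∀ z : ℂ, Complex.log (z / z) = 0 := by
    intro z
    rcases eq_or_ne z 0 with h | h
    · simp [h]
    · rw [div_self h, Complex.log_one]
  cases st with
  | mk coord logDeriv logDiff =>
    unfold State.move
    simp only [add_zero, hl, Function.update_eq_self, State.pos, State.mk.injEq, true_and]
    funext a c
    split_ifs with h1 h2
    · rw [h1.1]
    · rw [h2.1]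
    · rfl

theorem dSign_zero (s : Bool) (x : Pt M) (f : Coeff M) : dSign s x 0 f = f := by
  funext st
  cases s <;> simp [dSign, dHol, dAnti, State.move_zero]

theorem dSign_neg (s : Bool) (x : Pt M) (m : ℕ) (f : Coeff M) :
    dSign s x m (-f) = -dSign s x m f := by
  funext st
  cases s
  · simp only [dSign, dAnti, Pi.neg_apply, map_neg]
    rw [iteratedDeriv_fun_neg, map_neg]
  · simp only [dSign, dHol, Pi.neg_apply]
    rw [iteratedDeriv_fun_neg]

namespace BackgroundCharge

variable {b : ℝ}

/-- The non-random function by which `X ↦ X̂` translates the symbol `g`. -/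
def shift (β₀ β : BackgroundCharge M b) (g : Sym M) : Coeff M :=
  dSign g.2.1 g.1 g.2.2 (β.phi g.2.1 g.1 - β₀.phi g.2.1 g.1)

theorem hat_eq (β₀ β : BackgroundCharge M b) : hat β₀ β = translate (shift β₀ β) := rfl

theorem shift_add_shift (β₀ β : BackgroundCharge M b) : shift β₀ β + shift β β₀ = 0 := by
  funext g
  simp only [Pi.add_apply, shift, Pi.zero_apply]
  rw [← neg_sub, dSign_neg, neg_add_cancel]

theorem hat_hat (β₀ β : BackgroundCharge M b) (X : Fock M) : hat β₀ β (hat β β₀ X) = X := by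
  rw [hat_eq, hat_eq, translate_translate, shift_add_shift, translate_zero]

theorem shift_zero (β₀ β : BackgroundCharge M b) (x : Pt M) (s : Bool) :
    shift β₀ β (x, s, 0) = β.phi s x - β₀.phi s x := dSign_zero _ _ _

/-- The conformal anomaly `i b log w'` is the same for both background charges and cancels. -/
theorem phi_sub_true (β₀ β : BackgroundCharge M b) (x : Pt M) (st : State M) :
    (β.phi true x - β₀.phi true x) st = -Complex.I * ∑ k,
      ((β.plus k - β₀.plus k) * st.logDiff x (.marked k) + (β.minus k - β₀.minus k) *
        Complex.log (1 - st.pos x * starRingEnd ℂ (st.pos (.marked k)))) := by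
  simp only [Pi.sub_apply, phi]
  rw [add_sub_add_right_eq_sub, ← mul_sub, ← Finset.sum_sub_distrib]
  congr 1
  refine Finset.sum_congr rfl fun k _ => ?_
  ring

theorem phi_sub_false (β₀ β : BackgroundCharge M b) (x : Pt M) (st : State M) :
    (β.phi false x - β₀.phi false x) st = Complex.I * ∑ k,
      ((β.minus k - β₀.minus k) * starRingEnd ℂ (st.logDiff x (.marked k)) +
        (β.plus k - β₀.plus k) *
          Complex.log (1 - st.pos (.marked k) * starRingEnd ℂ (st.pos x))) := by
  simp only [Pi.sub_apply, phi]
  rw [sub_sub_sub_cancel_right, ← mul_sub, ← Finset.sum_sub_distrib]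
  congr 1
  refine Finset.sum_congr rfl fun k _ => ?_
  ring

theorem hat_bosonic (β₀ β : BackgroundCharge M b) (τ : DoubleDivisor M) :
    hat β₀ β (β₀.bosonic τ) = β.bosonic τ := by
  have hc : ∀ (s : Bool) (x : Pt M),
      hat β₀ β (gauss (x, s, 0) + nonrandom (β₀.phi s x)) =
        gauss (x, s, 0) + nonrandom (β.phi s x) := by
    intro s x
    rw [map_add, hat_eq, translate_gauss, translate_nonrandom, shift_zero, add_assoc, nonrandom,
      nonrandom, nonrandom, ← AddMonoidAlgebra.single_add, sub_add_cancel]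
  have hs : ∀ (a : ℂ) (X : Fock M), hat β₀ β (a • X) = a • hat β₀ β X := fun a X =>
    map_smul ((hat β₀ β).restrictScalars ℂ) a X
  unfold bosonic
  rw [map_list_sum, List.map_map]
  congr 2
  funext d
  simp only [Function.comp_apply, map_sub, hs, hc]

theorem coulombLog_append (τ σ : DoubleDivisor M) (st : State M) :
    coulombLog b (τ ++ σ) st = coulombLog b τ st + coulombLog b σ st +
      (τ.map fun d => (σ.map fun e => pairLog d e st).sum).sum := by
  induction τ with
  | nil => simp [coulombLog]
  | cons d τ ih =>
    simp only [List.cons_append, coulombLog, ih, List.map_append, List.sum_append, List.map_cons,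
      List.sum_cons]
    ring

theorem iPhi_sum (τ : DoubleDivisor M) (F : Pt M × Bool → ℂ → ℂ) (h0 : ∀ x, F x 0 = 0)
    (hadd : ∀ x a c, F x (a + c) = F x a + F x c) :
    (iPhi τ).sum F = (τ.map fun d => F (d.1, true) (Complex.I * d.2.1) +
      F (d.1, false) (-Complex.I * d.2.2)).sum := by
  unfold iPhi
  induction τ with
  | nil => simp
  | cons d τ ih =>
    simp only [List.map_cons, List.sum_cons]
    rw [Finsupp.sum_add_index' h0 hadd, Finsupp.sum_add_index' h0 hadd,
      Finsupp.sum_single_index (h0 _), Finsupp.sum_single_index (h0 _), ih]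

theorem hat_opeExp (β₀ β : BackgroundCharge M b) (τ : DoubleDivisor M) :
    hat β₀ β (β₀.opeExp τ) = β.opeExp τ := by
  unfold opeExp vertexWick
  rw [map_smul, hat_eq, translate_wickExp, smul_smul]
  congr 1
  funext st
  simp only [Pi.mul_apply, Pi.div_apply, coulomb, expoFactor, ← Complex.exp_sub,
    ← Complex.exp_add, coulombLog_append]
  congr 1
  rw [iPhi_sum _ _ (by simp) (by intros; ring)]
  rw [show ∀ a c d e : ℂ, a + c + d - c + e = a + (d + e) by intros; ring,
    show ∀ a c d : ℂ, a + c + d - c = a + d by intros; ring]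
  congr 1
  rw [← List.sum_map_add]
  congr 2
  funext d
  simp only [shift_zero, phi_sub_true, phi_sub_false, divisor, Function.comp_def,
    ← List.ofFn_eq_map, List.map_ofFn, List.sum_ofFn]
  have hI := Complex.I_mul_I
  rw [← mul_assoc, ← mul_assoc, show Complex.I * d.2.1 * -Complex.I = d.2.1 by
    linear_combination (-d.2.1) * hI, show -Complex.I * d.2.2 * Complex.I = d.2.2 by
    linear_combination (-d.2.2) * hI, Finset.mul_sum, Finset.mul_sum, ← Finset.sum_add_distrib,
    ← Finset.sum_add_distrib]
  refine Finset.sum_congr rfl fun k _ => ?_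
  simp only [pairLog]
  ring

end BackgroundCharge

/-! ### Locality -/

namespace State

theorem AgreeOn.mono {T T' : Finset (Pt M)} {st st' : State M} (h : AgreeOn T st st')
    (hT : T' ⊆ T) : AgreeOn T' st st' :=
  ⟨fun x hx => h.1 x (hT hx), fun x hx y hy => h.2 x (hT hx) y (hT hy)⟩

theorem AgreeOn.pos_eq {T : Finset (Pt M)} {st st' : State M} (h : AgreeOn T st st') {x : Pt M}
    (hx : x ∈ T) : st.pos x = st'.pos x := by
  unfold State.pos
  rw [(h.1 x hx).1]

theorem AgreeOn.move {T : Finset (Pt M)} {st st' : State M} (h : AgreeOn T st st') {x : Pt M}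
    (hx : x ∈ T) (t : ℂ) : AgreeOn T (st.move x t) (st'.move x t) := by
  refine ⟨fun y hy => ?_, fun y hy z hz => ?_⟩
  · rcases eq_or_ne y x with rfl | hne
    · simp [State.move, h.1 y hx]
    · simp [State.move, hne, h.1 y hy]
  · simp only [State.move]
    rw [(h.1 x hx).1, h.pos_eq hx, h.pos_eq hy, h.pos_eq hz, h.2 y hy z hz, h.2 x hx z hz,
      h.2 y hy x hx]

end State

/-- The functions which depend only on the points of `T` and the marked points. -/
def localAlg (T : Finset (Pt M)) : Subalgebra ℂ (Coeff M) where
  carrier := {f | ∀ st st', State.AgreeOn (T ∪ marks M) st st' → f st = f st'}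
  mul_mem' := fun hf hg st st' h => by rw [Pi.mul_apply, Pi.mul_apply, hf st st' h, hg st st' h]
  add_mem' := fun hf hg st st' h => by rw [Pi.add_apply, Pi.add_apply, hf st st' h, hg st st' h]
  algebraMap_mem' := fun _ _ _ _ => rfl

theorem localAlg_mono {T T' : Finset (Pt M)} (h : T ⊆ T') :
    localAlg T ≤ (localAlg T' : Subalgebra ℂ (Coeff M)) :=
  fun _ hf st st' ha => hf st st' (ha.mono (Finset.union_subset_union_left h))

theorem marks_union_marks (T : Finset (Pt M)) : T ∪ marks M ∪ marks M = T ∪ marks M := by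
  rw [Finset.union_assoc, Finset.union_self]

theorem localAlg_union_marks (T : Finset (Pt M)) :
    localAlg (T ∪ marks M) = (localAlg T : Subalgebra ℂ (Coeff M)) := by
  ext f
  change (∀ st st', _) ↔ (∀ st st', _)
  rw [marks_union_marks]

theorem dSign_mem_localAlg {T : Finset (Pt M)} {x : Pt M} (hx : x ∈ T ∪ marks M) (s : Bool)
    (m : ℕ) {f : Coeff M} (hf : f ∈ localAlg T) : dSign s x m f ∈ localAlg T := by
  intro st st' h
  have : ∀ t, f (st.move x t) = f (st'.move x t) := fun t => hf _ _ (h.move hx t)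
  cases s
  · simp only [dSign, dAnti, this]
  · simp only [dSign, dHol, this]

theorem cov_mem_localAlg {T : Finset (Pt M)} {g g' : Sym M} (hg : g.1 ∈ T ∪ marks M)
    (hg' : g'.1 ∈ T ∪ marks M) : cov g g' ∈ localAlg T := by
  obtain ⟨x, s, m⟩ := g
  obtain ⟨y, s', n⟩ := g'
  replace hg : x ∈ T ∪ marks M := hg
  replace hg' : y ∈ T ∪ marks M := hg'
  have h1 : (fun st => -st.logDiff x y : Coeff M) ∈ localAlg T :=
    fun st st' h => by simp only [h.2 x hg y hg']
  have h2 : (fun st => -starRingEnd ℂ (st.logDiff x y) : Coeff M) ∈ localAlg T :=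
    fun st st' h => by simp only [h.2 x hg y hg']
  have h3 : (fun st => Complex.log (1 - st.pos x * starRingEnd ℂ (st.pos y)) : Coeff M) ∈
      localAlg T := fun st st' h => by simp only [h.pos_eq hg, h.pos_eq hg']
  have h4 : (fun st => Complex.log (1 - st.pos y * starRingEnd ℂ (st.pos x)) : Coeff M) ∈
      localAlg T := fun st st' h => by simp only [h.pos_eq hg, h.pos_eq hg']
  cases s <;> cases s' <;> unfold cov
  · exact dSign_mem_localAlg hg false m (dSign_mem_localAlg hg' false n h2)
  · exact dSign_mem_localAlg hg false m (dSign_mem_localAlg hg' true n h4)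
  · exact dSign_mem_localAlg hg true m (dSign_mem_localAlg hg' false n h3)
  · exact dSign_mem_localAlg hg true m (dSign_mem_localAlg hg' true n h1)

theorem mark_mem_marks (k : Fin M.numMarks) : Pt.marked k ∈ marks M := by simp [marks]

theorem expoFactor_mem_localAlg {T : Finset (Pt M)} {c : Sym M → Coeff M} {η : Expo M}
    (h : ∀ x ∈ η.support, c (x.1, x.2, 0) ∈ localAlg T) : expoFactor c η ∈ localAlg T := by
  intro st st' ha
  unfold expoFactor
  congr 1
  exact Finset.sum_congr rfl fun x hx => congrArg (η x * ·) (h x hx st st' ha)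

/-- The labels of basic fields all of whose points lie in `T`. -/
def labelsOn (T : Finset (Pt M)) : AddSubmonoid ((Sym M →₀ ℕ) × Expo M) where
  carrier := {p | (∀ g ∈ p.1.support, g.1 ∈ T) ∧ ∀ x ∈ p.2.support, x.1 ∈ T}
  zero_mem' := by simp
  add_mem' := fun {p q} hp hq =>
    ⟨fun g hg => (Finset.mem_union.1 (Finsupp.support_add hg)).elim (hp.1 g) (hq.1 g),
      fun x hx => (Finset.mem_union.1 (Finsupp.support_add hx)).elim (hp.2 x) (hq.2 x)⟩

/-- The fields with coefficients in `B` whose basic fields have labels in `P`. -/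
def fieldAlg (B : Subalgebra ℂ (Coeff M)) (P : AddSubmonoid ((Sym M →₀ ℕ) × Expo M)) :
    Subalgebra ℂ (Fock M) :=
  let V : Submodule ℂ (Fock M) :=
    { carrier := {X | ∀ p ∈ X.coeff.support, p ∈ P ∧ X.coeff p ∈ B}
      zero_mem' := by simp
      add_mem' := by
        intro X Y hX hY p hp
        have hB : ∀ {X : Fock M}, (∀ p ∈ X.coeff.support, p ∈ P ∧ X.coeff p ∈ B) →
            X.coeff p ∈ B := by
          intro X hX
          by_cases h : p ∈ X.coeff.support
          · exact (hX p h).2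
          · rw [Finsupp.notMem_support_iff.1 h]; exact B.zero_mem
        refine ⟨?_, B.add_mem (hB hX) (hB hY)⟩
        rcases Finset.mem_union.1 (Finsupp.support_add hp) with h | h
        · exact (hX p h).1
        · exact (hY p h).1
      smul_mem' := by
        intro a X hX p hp
        have h := hX p (Finsupp.support_smul hp)
        exact ⟨h.1, B.smul_mem h.2 a⟩ }
  have hV : ∀ {p : (Sym M →₀ ℕ) × Expo M} {f : Coeff M}, p ∈ P → f ∈ B →
      AddMonoidAlgebra.single p f ∈ V := by
    intro p f hp hf q hq
    obtain rfl : q = p := Finset.mem_singleton.1 (Finsupp.support_single_subset hq)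
    exact ⟨hp, by simpa using hf⟩
  { carrier := V
    add_mem' := V.add_mem
    mul_mem' := by
      intro X Y hX hY
      rw [← X.sum_coeff_single, ← Y.sum_coeff_single, Finsupp.sum_mul]
      refine V.sum_mem fun p hp => ?_
      simp only [Finsupp.mul_sum, AddMonoidAlgebra.single_mul_single]
      refine V.sum_mem fun q hq => ?_
      exact hV (P.add_mem (hX p hp).1 (hY q hq).1) (B.mul_mem (hX p hp).2 (hY q hq).2)
    algebraMap_mem' := fun a => hV P.zero_mem (B.algebraMap_mem a) }

section fieldAlg

variable {B B' : Subalgebra ℂ (Coeff M)} {P P' : AddSubmonoid ((Sym M →₀ ℕ) × Expo M)}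

theorem mem_fieldAlg {X : Fock M} :
    X ∈ fieldAlg B P ↔ ∀ p ∈ X.coeff.support, p ∈ P ∧ X.coeff p ∈ B := Iff.rfl

theorem fieldAlg_mono (hB : B ≤ B') (hP : P ≤ P') : fieldAlg B P ≤ fieldAlg B' P' :=
  fun _ hX p hp => ⟨hP (hX p hp).1, hB (hX p hp).2⟩

theorem single_mem {p : (Sym M →₀ ℕ) × Expo M} {f : Coeff M} (hp : p ∈ P) (hf : f ∈ B) :
    AddMonoidAlgebra.single p f ∈ fieldAlg B P := by
  intro q hq
  obtain rfl : q = p := Finset.mem_singleton.1 (Finsupp.support_single_subset hq)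
  exact ⟨hp, by simpa using hf⟩

theorem nonrandom_mem {f : Coeff M} (hf : f ∈ B) : nonrandom f ∈ fieldAlg B P :=
  single_mem P.zero_mem hf

theorem coeff_smul_mem {f : Coeff M} {X : Fock M} (hf : f ∈ B) (hX : X ∈ fieldAlg B P) :
    f • X ∈ fieldAlg B P := by
  rw [← nonrandom_mul]
  exact (fieldAlg B P).mul_mem (nonrandom_mem hf) hX

theorem gauss_mem {T : Finset (Pt M)} {g : Sym M} (hg : g.1 ∈ T) :
    gauss g ∈ fieldAlg B (labelsOn T) := by
  refine single_mem ⟨fun g' hg' => ?_, by simp⟩ B.one_mem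
  rw [Finset.mem_singleton.1 (Finsupp.support_single_subset hg')]
  exact hg

theorem wickExp_mem {T : Finset (Pt M)} {η : Expo M} (hη : ∀ x ∈ η.support, x.1 ∈ T) :
    wickExp η ∈ fieldAlg B (labelsOn T) :=
  single_mem ⟨by simp, hη⟩ B.one_mem

theorem sum_single_mem {X : Fock M} {F : (Sym M →₀ ℕ) × Expo M → Coeff M → Fock M}
    (h : ∀ p ∈ X.coeff.support, F p (X.coeff p) ∈ fieldAlg B P) :
    X.coeff.sum F ∈ fieldAlg B P :=
  (fieldAlg B P).sum_mem h

theorem translate_mem {T : Finset (Pt M)} {c : Sym M → Coeff M} {X : Fock M}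
    (hX : X ∈ fieldAlg B (labelsOn T)) (hc : ∀ g : Sym M, g.1 ∈ T → c g ∈ B)
    (he : ∀ η : Expo M, (∀ x ∈ η.support, x.1 ∈ T) → expoFactor c η ∈ B) :
    translate c X ∈ fieldAlg B (labelsOn T) := by
  rw [← X.sum_coeff_single, map_finsuppSum]
  refine sum_single_mem fun p hp => ?_
  obtain ⟨hpT, hpB⟩ := hX p hp
  rw [translate_single]
  refine coeff_smul_mem hpB (Subalgebra.mul_mem _ ?_ (Subalgebra.mul_mem _ ?_ ?_))
  · refine Subalgebra.prod_mem _ fun g hg => Subalgebra.pow_mem _ (Subalgebra.add_mem _ ?_ ?_) _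
    · exact gauss_mem (hpT.1 g hg)
    · exact nonrandom_mem (hc g (hpT.1 g hg))
  · exact nonrandom_mem (he _ hpT.2)
  · exact wickExp_mem hpT.2

theorem contract_mem {T : Finset (Pt M)} {g : Sym M} {X : Fock M}
    (hX : X ∈ fieldAlg B (labelsOn T)) (hc : ∀ g' : Sym M, g'.1 ∈ T → cov g g' ∈ B) :
    contract g X ∈ fieldAlg B (labelsOn T) := by
  refine sum_single_mem fun p hp => ?_
  obtain ⟨hpT, hpB⟩ := hX p hp
  refine Subalgebra.add_mem _ (Subalgebra.sum_mem _ fun g' hg' => ?_) (single_mem hpT ?_)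
  · refine single_mem ⟨fun k hk => hpT.1 k ?_, hpT.2⟩
      (B.smul_mem (B.mul_mem hpB (hc g' (hpT.1 g' hg'))) _)
    exact Finsupp.support_mono tsub_le_self hk
  · refine B.mul_mem hpB ?_
    have : (fun st => p.2.sum fun x a => a * cov g (x.1, x.2, 0) st) =
        ∑ x ∈ p.2.support, p.2 x • cov g (x.1, x.2, 0) := by
      funext st
      simp [Finsupp.sum]
    rw [this]
    exact B.sum_mem fun x hx => B.smul_mem (hc _ (hpT.2 x hx)) _

theorem wickSum_mem {T : Finset (Pt M)} (l : List (Sym M)) (hl : ∀ g ∈ l, g.1 ∈ T)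
    (hc : ∀ g g' : Sym M, g.1 ∈ T → g'.1 ∈ T → cov g g' ∈ B) {A Y : Fock M}
    (hA : A ∈ fieldAlg B (labelsOn T)) (hY : Y ∈ fieldAlg B (labelsOn T)) :
    wickSum l A Y ∈ fieldAlg B (labelsOn T) := by
  induction l generalizing A Y with
  | nil => exact Subalgebra.mul_mem _ hA hY
  | cons g l ih =>
    have hg := hl g List.mem_cons_self
    have hl' := fun k hk => hl k (List.mem_cons_of_mem _ hk)
    exact Subalgebra.add_mem _ (ih hl' (Subalgebra.mul_mem _ hA (gauss_mem hg)) hY)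
      (ih hl' hA (contract_mem hY fun g' => hc g g' hg))

end fieldAlg

theorem fieldOn_iff {T : Finset (Pt M)} {X : Fock M} :
    FieldOn T X ↔ X ∈ fieldAlg (localAlg T) (labelsOn T) := by
  simp only [FieldOn, mem_fieldAlg, ← and_assoc]
  rfl

theorem fieldOn_union_marks_iff {T : Finset (Pt M)} {X : Fock M} :
    FieldOn (T ∪ marks M) X ↔ X ∈ fieldAlg (localAlg T) (labelsOn (T ∪ marks M)) := by
  rw [fieldOn_iff, localAlg_union_marks]

theorem labelsOn_mono {T T' : Finset (Pt M)} (h : T ⊆ T') :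
    (labelsOn T : AddSubmonoid ((Sym M →₀ ℕ) × Expo M)) ≤ labelsOn T' :=
  fun _ hp => ⟨fun g hg => h (hp.1 g hg), fun x hx => h (hp.2 x hx)⟩

theorem FieldOn.mono {T T' : Finset (Pt M)} {X : Fock M} (hX : FieldOn T X) (h : T ⊆ T') :
    FieldOn T' X :=
  fieldOn_iff.2 (fieldAlg_mono (localAlg_mono h) (labelsOn_mono h) (fieldOn_iff.1 hX))

theorem FieldOn.tensor {S T : Finset (Pt M)} {X Y : Fock M} (hX : FieldOn S X)
    (hY : FieldOn T Y) : FieldOn (S ∪ T) (tensor X Y) := by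
  have hX' := fieldOn_iff.1 (hX.mono Finset.subset_union_left (T' := S ∪ T))
  have hY' := fieldOn_iff.1 (hY.mono Finset.subset_union_right (T' := S ∪ T))
  rw [fieldOn_iff]
  have hcov : ∀ g g' : Sym M, g.1 ∈ S ∪ T → g'.1 ∈ S ∪ T → cov g g' ∈ localAlg (S ∪ T) :=
    fun g g' hg hg' => cov_mem_localAlg (Finset.mem_union_left _ hg) (Finset.mem_union_left _ hg')
  refine sum_single_mem fun p hp => ?_
  obtain ⟨hpT, hpB⟩ := hX' p hp
  refine coeff_smul_mem hpB (wickSum_mem _ (fun g hg => hpT.1 g ?_) hcov (wickExp_mem hpT.2) ?_)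
  · rw [Multiset.mem_toList] at hg
    exact Finsupp.mem_toMultiset p.1 g |>.1 hg
  · have hc : ∀ g : Sym M, g.1 ∈ S ∪ T → covExpo p.2 g ∈ localAlg (S ∪ T) := by
      intro g hg st st' ha
      exact Finset.sum_congr rfl fun x hx =>
        congrArg (p.2 x * ·) (hcov (x.1, x.2, 0) g (hpT.2 x hx) hg st st' ha)
    exact translate_mem hY' hc fun η hη => expoFactor_mem_localAlg fun x hx => hc _ (hη x hx)

namespace BackgroundCharge

variable {b : ℝ}

theorem phi_mem_localAlg (β : BackgroundCharge M b) (s : Bool) {T : Finset (Pt M)} {x : Pt M}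
    (hx : x ∈ T) : β.phi s x ∈ localAlg T := by
  intro st st' h
  have hx' : x ∈ T ∪ marks M := Finset.mem_union_left _ hx
  have hk : ∀ k, Pt.marked k ∈ T ∪ marks M := fun k => Finset.mem_union_right _ (mark_mem_marks k)
  cases s
  · simp only [phi, (h.1 x hx').2, h.pos_eq hx', h.pos_eq (hk _), h.2 x hx' _ (hk _)]
  · simp only [phi, (h.1 x hx').2, h.pos_eq hx', h.pos_eq (hk _), h.2 x hx' _ (hk _)]

theorem shift_mem_localAlg (β₀ β : BackgroundCharge M b) {T : Finset (Pt M)} {g : Sym M}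
    (hg : g.1 ∈ T) : shift β₀ β g ∈ localAlg T :=
  dSign_mem_localAlg (Finset.mem_union_left _ hg) _ _
    (Subalgebra.sub_mem _ (β.phi_mem_localAlg _ hg) (β₀.phi_mem_localAlg _ hg))

theorem fieldOn_hat (β₀ β : BackgroundCharge M b) {T : Finset (Pt M)} {X : Fock M}
    (hX : FieldOn T X) : FieldOn T (hat β₀ β X) := by
  rw [fieldOn_iff] at hX ⊢
  exact translate_mem hX (fun g hg => shift_mem_localAlg β₀ β hg)
    fun η hη => expoFactor_mem_localAlg fun x hx => shift_mem_localAlg β₀ β (hη x hx)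

theorem coulombLog_local {T : Finset (Pt M)} {σ : DoubleDivisor M}
    (hσ : ∀ d ∈ σ, d.1 ∈ T ∪ marks M) {st st' : State M}
    (h : State.AgreeOn (T ∪ marks M) st st') : coulombLog b σ st = coulombLog b σ st' := by
  induction σ with
  | nil => rfl
  | cons d σ ih =>
    have hd := hσ d List.mem_cons_self
    have hσ' := fun e he => hσ e (List.mem_cons_of_mem _ he)
    rw [coulombLog, coulombLog, ih hσ']
    congr 2
    · simp only [selfLog, h.pos_eq hd, (h.1 _ hd).2]
    · congr 1
      refine List.map_congr_left fun e he => ?_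
      simp only [pairLog, h.pos_eq hd, h.pos_eq (hσ' e he), h.2 _ hd _ (hσ' e he)]

theorem exists_mem_of_mem_support_iPhi {σ : DoubleDivisor M} {x : Pt M × Bool}
    (hx : x ∈ (iPhi σ).support) : ∃ d ∈ σ, d.1 = x.1 := by
  induction σ with
  | nil => simp [iPhi] at hx
  | cons d σ ih =>
    have hx' : x ∈ (Finsupp.single (d.1, true) (Complex.I * d.2.1) +
      Finsupp.single (d.1, false) (-Complex.I * d.2.2) + iPhi σ).support := hx
    rcases Finset.mem_union.1 (Finsupp.support_add hx') with h | h
    · rcases Finset.mem_union.1 (Finsupp.support_add h) with h | h <;>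
      · rw [Finset.mem_singleton.1 (Finsupp.support_single_subset h)]
        exact ⟨d, List.mem_cons_self, rfl⟩
    · obtain ⟨e, he, h⟩ := ih h
      exact ⟨e, List.mem_cons_of_mem _ he, h⟩

theorem Family.fieldOn {β : BackgroundCharge M b} {S : Finset (Pt M)} {X : Fock M}
    (hX : β.Family S X) : (∀ x ∈ S, x.IsNode) ∧ FieldOn S X := by
  induction hX with
  | one hS => exact ⟨hS, fieldOn_iff.2 (Subalgebra.one_mem _)⟩
  | @bosonic τ hτ =>
    have hn : ∀ d ∈ τ, d.1 ∈ τ.nodes := fun d hd => by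
      simp only [DoubleDivisor.nodes, List.mem_toFinset]
      exact List.mem_map_of_mem hd
    refine ⟨fun x hx => ?_, fieldOn_iff.2 ?_⟩
    · simp only [DoubleDivisor.nodes, List.mem_toFinset, List.mem_map] at hx
      obtain ⟨d, hd, rfl⟩ := hx
      exact hτ.2.1 d hd
    · refine Subalgebra.list_sum_mem _ fun Z hZ => ?_
      obtain ⟨d, hd, rfl⟩ := List.mem_map.1 hZ
      have key : ∀ s, gauss (d.1, s, 0) + nonrandom (β.phi s d.1) ∈
          fieldAlg (localAlg τ.nodes) (labelsOn τ.nodes) := fun s =>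
        Subalgebra.add_mem _ (gauss_mem (hn d hd))
          (nonrandom_mem (β.phi_mem_localAlg s (hn d hd)))
      exact Subalgebra.sub_mem _ (Subalgebra.smul_mem _ (key true) _)
        (Subalgebra.smul_mem _ (key false) _)
  | @opeExp τ hτ =>
    have hn : ∀ d ∈ τ, d.1 ∈ τ.nodes := fun d hd => by
      simp only [DoubleDivisor.nodes, List.mem_toFinset]
      exact List.mem_map_of_mem hd
    refine ⟨fun x hx => ?_, fieldOn_iff.2 ?_⟩
    · simp only [DoubleDivisor.nodes, List.mem_toFinset, List.mem_map] at hx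
      obtain ⟨d, hd, rfl⟩ := hx
      exact hτ.2.1 d hd
    · have hdiv : ∀ d ∈ β.divisor, d.1 ∈ τ.nodes ∪ marks M := by
        intro d hd
        obtain ⟨k, _, rfl⟩ := List.mem_map.1 hd
        exact Finset.mem_union_right _ (mark_mem_marks k)
      refine coeff_smul_mem (fun st st' h => ?_) (wickExp_mem fun x hx => ?_)
      · simp only [Pi.div_apply, coulomb]
        rw [coulombLog_local hdiv h, coulombLog_local (fun d hd => ?_) h]
        rcases List.mem_append.1 hd with hd | hd
        · exact Finset.mem_union_left _ (hn d hd)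
        · exact hdiv d hd
      · obtain ⟨d, hd, h⟩ := exists_mem_of_mem_support_iPhi hx
        exact h ▸ hn d hd
  | add _ _ ihX ihY =>
    exact ⟨ihX.1, fieldOn_iff.2 (Subalgebra.add_mem _ (fieldOn_iff.1 ihX.2)
      (fieldOn_iff.1 ihY.2))⟩
  | smul a _ ih => exact ⟨ih.1, fieldOn_iff.2 (Subalgebra.smul_mem _ (fieldOn_iff.1 ih.2) a)⟩
  | tensor _ _ _ ihX ihY =>
    exact ⟨fun x hx => (Finset.mem_union.1 hx).elim (ihX.1 x) (ihY.1 x), ihX.2.tensor ihY.2⟩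
  | deriv _ _ hY _ _ ih => exact ⟨ih.1, hY⟩
  | derivConj _ _ _ hY' _ ih => exact ⟨ih.1, hY'⟩
  | ope _ _ h I ih => exact ⟨fun x hx => ih.1 x (Finset.mem_of_mem_erase hx), h.2.2.2.1 I⟩
  | congr _ hY _ ih => exact ⟨ih.1, hY⟩

end BackgroundCharge

/-! ### The translation as a holomorphic test function -/

/-- The identity for the sign `+`, complex conjugation for the sign `-`. -/
def conjSign : Bool → ℂ →+* ℂ
  | true => RingHom.id ℂ
  | false => starRingEnd ℂ

/-- The component of a test pair of the given sign. -/
def component (h : (ℂ → ℂ) × (ℂ → ℂ)) : Bool → ℂ → ℂ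
  | true => h.1
  | false => h.2

theorem conjSign_conjSign (s : Bool) (z : ℂ) : conjSign s (conjSign s z) = z := by
  cases s <;> simp [conjSign]

theorem jet_eq (h : (ℂ → ℂ) × (ℂ → ℂ)) (st : State M) (x : Pt M) (s : Bool) (m : ℕ) :
    jet h st (x, s, m) = conjSign s
      (iteratedDeriv m (fun z => component h s (x.chart.disc z)) (st.coord x)) := by
  cases s <;> rfl

theorem dSign_eq (s : Bool) (x : Pt M) (m : ℕ) (f : Coeff M) (st : State M) :
    dSign s x m f st = conjSign s (iteratedDeriv m (fun t => conjSign s (f (st.move x t))) 0) := by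
  cases s <;> rfl

theorem evalJet_congr {B : Subalgebra ℂ (Coeff M)} {T : Finset (Pt M)} {X : Fock M}
    (hX : X ∈ fieldAlg B (labelsOn T)) (st : State M) {j j' : Sym M → ℂ}
    (h : ∀ g : Sym M, g.1 ∈ T → j g = j' g) : evalJet st j X = evalJet st j' X := by
  rw [evalJet_apply, evalJet_apply]
  refine Finsupp.sum_congr fun p hp => ?_
  have hpT := (hX p hp).1
  congr 1
  unfold monoVal
  congr 1
  · exact Finset.prod_congr rfl fun g hg => congrArg (· ^ p.1 g) (h g (hpT.1 g hg))
  · congr 1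
    exact Finset.sum_congr rfl fun x hx => congrArg (p.2 x * ·) (h (x.1, x.2, 0) (hpT.2 x hx))

/-- Logarithmic increments follow a continuous branch of the logarithm. -/
theorem log_div_of_branch {ℓ a : ℂ → ℂ} {t : ℂ} (hℓ : ContinuousAt ℓ t)
    (hexp : ∀ᶠ s in 𝓝 t, Complex.exp (ℓ s) = a s) :
    ∀ᶠ s in 𝓝 t, Complex.log (a s / a t) = ℓ s - ℓ t := by
  have h0 : Tendsto (fun s => ℓ s - ℓ t) (𝓝 t) (𝓝 0) := by
    simpa using hℓ.tendsto.sub_const (ℓ t)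
  have hb : ∀ᶠ s in 𝓝 t, ℓ s - ℓ t ∈ Metric.ball (0 : ℂ) 1 :=
    h0.eventually (Metric.ball_mem_nhds 0 one_pos)
  filter_upwards [hb, hexp] with s hs hes
  rw [← hes, ← hexp.self_of_nhds, ← Complex.exp_sub]
  rw [mem_ball_zero_iff] at hs
  have him := (Complex.abs_im_le_norm (ℓ s - ℓ t)).trans_lt hs
  rw [abs_lt] at him
  have hpi := Real.pi_gt_three
  exact Complex.log_exp (by linarith) (by linarith)

/-- Finitely many germs at distinct points are the germs of one function. -/
theorem exists_glue {ι : Type*} (T : Finset ι) (q : ι → ℂ) (hq : Set.InjOn q T)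
    (k : ι → ℂ → ℂ) : ∃ H : ℂ → ℂ, ∀ y ∈ T, H =ᶠ[𝓝 (q y)] k y := by
  classical
  induction T using Finset.induction_on with
  | empty => exact ⟨0, by simp⟩
  | insert y T hy ih =>
    obtain ⟨H, hH⟩ := ih (hq.mono (by simp))
    have hn : q y ∉ T.image q := by
      intro h
      obtain ⟨z, hz, hzy⟩ := Finset.mem_image.1 h
      have := hq (by simp [hz]) (by simp) hzy
      exact hy (this ▸ hz)
    obtain ⟨U, V, hU, hV, hyU, hTV, hUV⟩ :=
      SeparatedNhds.of_singleton_finset hn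
    refine ⟨fun z => if z ∈ U then k y z else H z, fun x hx => ?_⟩
    rcases Finset.mem_insert.1 hx with rfl | hx
    · filter_upwards [hU.mem_nhds (hyU rfl)] with z hz
      simp [hz]
    · filter_upwards [hH x hx, hV.mem_nhds (hTV (by simpa using ⟨x, hx, rfl⟩))] with z hz hzV
      have : z ∉ U := fun h => Set.disjoint_left.1 hUV h hzV
      simp [this, hz]

theorem slitPlane_of_norm_lt {p q : ℂ} (hp : ‖p‖ < 1) (hq : ‖q‖ ≤ 1) :
    1 - p * starRingEnd ℂ q ∈ Complex.slitPlane := by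
  refine Or.inl ?_
  have h : ‖p * starRingEnd ℂ q‖ < 1 := by
    rw [norm_mul, Complex.norm_conj]
    calc ‖p‖ * ‖q‖ ≤ ‖p‖ * 1 := mul_le_mul_of_nonneg_left hq (norm_nonneg _)
      _ < 1 := by simpa using hp
  have := (Complex.abs_re_le_norm _).trans_lt h
  rw [abs_lt] at this
  simp only [Complex.sub_re, Complex.one_re]
  linarith

namespace BackgroundCharge

variable {b : ℝ}

/-- The coefficients of `log (w - w q_k)` in the translation of `Φ⁺`, and of the conjugate of the
translation of `Φ⁻`. -/
def logCharge (β₀ β : BackgroundCharge M b) : Bool → Fin M.numMarks → ℂ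
  | true, k => β.plus k - β₀.plus k
  | false, k => starRingEnd ℂ (β.minus k - β₀.minus k)

/-- The coefficients of `log (1 - w conj (w q_k))` in the translation of `Φ⁺`, and of the conjugate
of the translation of `Φ⁻`. -/
def mirrorCharge (β₀ β : BackgroundCharge M b) : Bool → Fin M.numMarks → ℂ
  | true, k => β.minus k - β₀.minus k
  | false, k => starRingEnd ℂ (β.plus k - β₀.plus k)

/-- The translation of `Φ⁺`, or the conjugate of that of `Φ⁻`, at the point of the disc `p s`, when
`ℓ k s` is the logarithm of `p s - w q_k`. -/
def potential (β₀ β : BackgroundCharge M b) (s : Bool) (ℓ : Fin M.numMarks → ℂ → ℂ) (p : ℂ → ℂ) :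
    ℂ → ℂ := fun r => -Complex.I * ∑ k, (logCharge β₀ β s k * ℓ k r +
      mirrorCharge β₀ β s k * Complex.log (1 - p r * starRingEnd ℂ (M.mark k)))

/-- The state `σ` has its marked points in place. -/
def _root_.CoulombGas.State.MarksFixed (σ : State M) : Prop :=
  ∀ k, σ.coord (.marked k) = M.markCoord k

theorem _root_.CoulombGas.State.MarksFixed.pos_marked {σ : State M} (hσ : σ.MarksFixed)
    (k : Fin M.numMarks) : σ.pos (.marked k) = M.mark k := by
  unfold State.pos
  rw [hσ k]
  exact M.disc_markCoord k

theorem conjSign_phi_sub (β₀ β : BackgroundCharge M b) (s : Bool) {σ : State M}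
    (hσ : σ.MarksFixed) {x : Pt M} (hx : ‖σ.pos x‖ < 1) :
    conjSign s ((β.phi s x - β₀.phi s x) σ) =
      potential β₀ β s (fun k _ => σ.logDiff x (.marked k)) (fun _ => σ.pos x) 0 := by
  cases s
  · rw [phi_sub_false]
    simp only [conjSign, potential, logCharge, mirrorCharge, map_mul, map_sum, map_add,
      Complex.conj_I, Complex.conj_conj, hσ.pos_marked]
    congr 1
    refine Finset.sum_congr rfl fun k _ => ?_
    congr 2
    have hs := slitPlane_of_norm_lt hx (M.norm_mark_le k)
    have := Complex.log_conj _ (Complex.mem_slitPlane_iff_arg.1 hs).1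
    rw [← Complex.conj_conj (Complex.log (1 - σ.pos x * _)), ← this]
    simp [mul_comm]
  · rw [phi_sub_true]
    simp only [conjSign, potential, logCharge, mirrorCharge, hσ.pos_marked, RingHom.id_apply]

/-- The translation of the symbols at a node which has moved along continuous branches `ℓ` of the
logarithms. -/
theorem shift_eq_of_branch (β₀ β : BackgroundCharge M b) {σ : State M} (hσ : σ.MarksFixed)
    {x : Pt M} (hx : x.IsNode) {z₀ t : ℂ} (hcoord : σ.coord x = z₀ + t)
    (hdisc : ∀ᶠ r in 𝓝 t, ‖x.chart.disc (z₀ + r)‖ < 1) {ℓ : Fin M.numMarks → ℂ → ℂ}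
    (hℓ : ∀ k, ContinuousAt (ℓ k) t)
    (hexp : ∀ k, ∀ᶠ r in 𝓝 t, Complex.exp (ℓ k r) = x.chart.disc (z₀ + r) - M.mark k)
    (hlog : ∀ k, σ.logDiff x (.marked k) = ℓ k t) (s : Bool) (m : ℕ) :
    shift β₀ β (x, s, m) σ = conjSign s
      (iteratedDeriv m (potential β₀ β s ℓ fun r => x.chart.disc (z₀ + r)) t) := by
  have hne : ∀ k, Pt.marked k ≠ x := by
    rintro k rfl
    exact hx
  have hmove : ∀ r, (σ.move x r).MarksFixed := by
    intro r k
    simp [State.move, hne k, hσ k]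
  have hcx : ∀ r, (σ.move x r).pos x = x.chart.disc (z₀ + (t + r)) := by
    intro r
    simp [State.move, State.pos, hcoord, add_assoc]
  have htend : Tendsto (fun r : ℂ => t + r) (𝓝 0) (𝓝 t) := by
    have h := (continuous_const_add t).tendsto 0
    rwa [add_zero] at h
  have hbr : ∀ᶠ r in 𝓝 t, ∀ k, Complex.log ((x.chart.disc (z₀ + r) - M.mark k) /
      (x.chart.disc (z₀ + t) - M.mark k)) = ℓ k r - ℓ k t :=
    eventually_all.2 fun k => log_div_of_branch (hℓ k) (hexp k)
  have hev : (fun r => conjSign s ((β.phi s x - β₀.phi s x) (σ.move x r))) =ᶠ[𝓝 0]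
      fun r => potential β₀ β s ℓ (fun r => x.chart.disc (z₀ + r)) (t + r) := by
    filter_upwards [htend.eventually hbr, htend.eventually hdisc] with r hr hd
    rw [conjSign_phi_sub β₀ β s (hmove r) (by rw [hcx]; exact hd)]
    unfold potential
    have hlk : ∀ k, (σ.move x r).logDiff x (.marked k) = ℓ k (t + r) := by
      intro k
      simp only [State.move, hne k, ne_eq, not_false_eq_true, and_self, if_true]
      rw [hlog k, hσ.pos_marked, State.pos, hcoord, add_assoc, hr k]
      ring
    simp only [hlk, hcx]
  rw [shift, dSign_eq]
  congr 1
  rw [hev.iteratedDeriv_eq, iteratedDeriv_comp_const_add]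
  simp

/-- The branch of `log (z - w q_k)` near the position of `y` prescribed by `st`. -/
def _root_.CoulombGas.State.branch (st : State M) (y : Pt M) (k : Fin M.numMarks) (z : ℂ) : ℂ :=
  st.logDiff y (.marked k) + Complex.log ((z - M.mark k) / (st.pos y - M.mark k))

end BackgroundCharge

section Valid

variable {S : Finset (Pt M)} {st : State M}

theorem State.Valid.marksFixed (hst : st.Valid S) : st.MarksFixed := hst.coord_marked

theorem Pt.IsNode.ne_marked {x : Pt M} (hx : x.IsNode) (k : Fin M.numMarks) : x ≠ .marked k := by
  rintro rfl
  exact hx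

theorem State.Valid.coord_mem' (hst : st.Valid S) {x : Pt M} (hx : x ∈ S ∪ marks M) :
    st.coord x ∈ x.chart.source := by
  rcases Finset.mem_union.1 hx with h | h
  · exact hst.coord_mem x h
  · obtain ⟨k, _, rfl⟩ := Finset.mem_image.1 h
    rw [hst.coord_marked]
    exact M.markCoord_mem k

theorem LocalChart.analyticAt_disc {U : Uniformization} (c : LocalChart U) {z : ℂ}
    (hz : z ∈ c.source) : AnalyticAt ℂ c.disc z :=
  c.differentiableOn_disc.analyticAt (c.isOpen_source.mem_nhds hz)

theorem State.Valid.deriv_ne_zero (hst : st.Valid S) {x : Pt M} (hx : x ∈ S ∪ marks M) :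
    deriv x.chart.disc (st.coord x) ≠ 0 := by
  rw [← hst.exp_logDeriv x hx]
  exact Complex.exp_ne_zero _

theorem State.Valid.norm_pos_lt (hst : st.Valid S) {x : Pt M} (hx : x ∈ S) (hn : x.IsNode) :
    ‖st.pos x‖ < 1 := by
  simpa using hst.pos_mem x hx hn

theorem State.Valid.pos_sub_mark_ne_zero (hst : st.Valid S) {x : Pt M} (hx : x ∈ S ∪ marks M)
    {k : Fin M.numMarks} (hk : x ≠ .marked k) : st.pos x - M.mark k ≠ 0 := by
  rw [sub_ne_zero, ← hst.marksFixed.pos_marked k]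
  exact hst.pos_ne x hx _ (Finset.mem_union_right _ (mark_mem_marks k)) hk

theorem State.Valid.exp_branch (hst : st.Valid S) {x : Pt M} (hx : x ∈ S ∪ marks M)
    {k : Fin M.numMarks} (hk : x ≠ .marked k) {z : ℂ} (hz : z ≠ M.mark k) :
    Complex.exp (st.branch x k z) = z - M.mark k := by
  have h0 := hst.pos_sub_mark_ne_zero hx hk
  rw [State.branch, Complex.exp_add, Complex.exp_log (div_ne_zero (sub_ne_zero.2 hz) h0),
    hst.exp_logDiff x hx _ (Finset.mem_union_right _ (mark_mem_marks k)) hk,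
    hst.marksFixed.pos_marked]
  field_simp

theorem State.Valid.branch_pos (hst : st.Valid S) {x : Pt M} (hx : x ∈ S ∪ marks M)
    {k : Fin M.numMarks} (hk : x ≠ .marked k) :
    st.branch x k (st.pos x) = st.logDiff x (.marked k) := by
  rw [State.branch, div_self (hst.pos_sub_mark_ne_zero hx hk), Complex.log_one, add_zero]

theorem State.Valid.analyticAt_branch (hst : st.Valid S) {x : Pt M} (hx : x ∈ S ∪ marks M)
    {k : Fin M.numMarks} (hk : x ≠ .marked k) : AnalyticAt ℂ (st.branch x k) (st.pos x) := by
  have h0 := hst.pos_sub_mark_ne_zero hx hk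
  refine analyticAt_const.add (AnalyticAt.clog ?_ ?_)
  · exact (analyticAt_id.sub analyticAt_const).div analyticAt_const h0
  · simp [div_self h0]

end Valid

namespace BackgroundCharge

variable {b : ℝ} {S : Finset (Pt M)} {st : State M}

theorem analyticAt_potential (β₀ β : BackgroundCharge M b) (s : Bool)
    {ℓ : Fin M.numMarks → ℂ → ℂ} {p : ℂ → ℂ} {t : ℂ} (hℓ : ∀ k, AnalyticAt ℂ (ℓ k) t)
    (hp : AnalyticAt ℂ p t) (hn : ‖p t‖ < 1) : AnalyticAt ℂ (potential β₀ β s ℓ p) t := by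
  refine analyticAt_const.mul (Finset.analyticAt_fun_sum _ fun k _ => ?_)
  refine (analyticAt_const.mul (hℓ k)).add (analyticAt_const.mul (AnalyticAt.clog ?_ ?_))
  · exact analyticAt_const.sub (hp.mul analyticAt_const)
  · exact slitPlane_of_norm_lt hn (M.norm_mark_le k)

/-- The germ at the node `y` of the function of which the translations are the derivatives. -/
def germ (β₀ β : BackgroundCharge M b) (st : State M) (s : Bool) (y : Pt M) : ℂ → ℂ :=
  potential β₀ β s (st.branch y) id

theorem analyticAt_germ (β₀ β : BackgroundCharge M b) (hst : st.Valid S) {y : Pt M} (hy : y ∈ S)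
    (hn : y.IsNode) (s : Bool) : AnalyticAt ℂ (germ β₀ β st s y) (st.pos y) :=
  analyticAt_potential β₀ β s
    (fun k => hst.analyticAt_branch (Finset.mem_union_left _ hy) (hn.ne_marked k)) analyticAt_id
    (hst.norm_pos_lt hy hn)

/-- `h'` differs from the test pair `h` by the potential of `β - β₀` near the nodes, and agrees
with it near the marked points. -/
def IsShifted (β₀ β : BackgroundCharge M b) (S : Finset (Pt M)) (st : State M)
    (h h' : (ℂ → ℂ) × (ℂ → ℂ)) : Prop :=
  ∀ s, (∀ y ∈ S, component h' s =ᶠ[𝓝 (st.pos y)] component h s + germ β₀ β st s y) ∧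
    ∀ y ∈ marks M, component h' s =ᶠ[𝓝 (st.pos y)] component h s

/-- Test pairs are arbitrary germs at the positions of the points, which are distinct: the
potential, with the branches prescribed at each node, can be added near the nodes only. -/
theorem exists_isShifted (β₀ β : BackgroundCharge M b) (hS : ∀ x ∈ S, x.IsNode)
    (hst : st.Valid S) (h : (ℂ → ℂ) × (ℂ → ℂ)) : ∃ h', IsShifted β₀ β S st h h' := by
  have hinj : Set.InjOn st.pos (S ∪ marks M : Finset (Pt M)) := by
    intro x hx y hy hxy
    by_contra hne
    exact hst.pos_ne x hx y hy hne hxy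
  have hg : ∀ s, ∃ H : ℂ → ℂ, ∀ y ∈ S ∪ marks M, H =ᶠ[𝓝 (st.pos y)]
      (if y ∈ S then component h s + germ β₀ β st s y else component h s) := fun s =>
    exists_glue _ _ hinj _
  choose H hH using hg
  have hc : ∀ s, component (H true, H false) s = H s := by
    intro s
    cases s <;> rfl
  refine ⟨(H true, H false), fun s => ⟨fun y hy => ?_, fun y hy => ?_⟩⟩
  · have := hH s y (Finset.mem_union_left _ hy)
    rwa [if_pos hy, ← hc s] at this
  · have := hH s y (Finset.mem_union_right _ hy)
    have hyS : y ∉ S := fun hyS => by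
      obtain ⟨k, _, rfl⟩ := Finset.mem_image.1 hy
      exact hS _ hyS
    rwa [if_neg hyS, ← hc s] at this

theorem _root_.CoulombGas.isTest_iff {h : (ℂ → ℂ) × (ℂ → ℂ)} :
    IsTest S st h ↔ ∀ x ∈ S ∪ marks M, ∀ s, AnalyticAt ℂ (component h s) (st.pos x) := by
  refine forall₂_congr fun x _ => ?_
  simp [component]
  tauto

theorem IsShifted.isTest {β₀ β : BackgroundCharge M b} {h h' : (ℂ → ℂ) × (ℂ → ℂ)}
    (hh : IsShifted β₀ β S st h h') (hS : ∀ x ∈ S, x.IsNode) (hst : st.Valid S)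
    (ht : IsTest S st h) : IsTest S st h' := by
  rw [isTest_iff] at ht ⊢
  intro x hx s
  rcases Finset.mem_union.1 hx with hxS | hxm
  · exact ((ht x hx s).add (analyticAt_germ β₀ β hst hxS (hS x hxS) s)).congr
      ((hh s).1 x hxS).symm
  · exact (ht x hx s).congr ((hh s).2 x hxm).symm

/-- At a node displaced slightly from `y`, the jets of `h'` are the translated jets of `h`. -/
theorem IsShifted.jet_eq {β₀ β : BackgroundCharge M b} {h h' : (ℂ → ℂ) × (ℂ → ℂ)}
    (hh : IsShifted β₀ β S st h h') (hst : st.Valid S) (ht : IsTest S st h) {y : Pt M}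
    (hy : y ∈ S) (hyn : y.IsNode) :
    ∀ᶠ t in 𝓝 (0 : ℂ), ∀ (x : Pt M) (σ : State M), x.IsNode → x.chart = y.chart →
      σ.MarksFixed → σ.coord x = st.coord y + t →
      (∀ k, σ.logDiff x (.marked k) = st.branch y k (y.chart.disc (st.coord y + t))) →
      ∀ s m, jet h' σ (x, s, m) = jet h σ (x, s, m) + shift β₀ β (x, s, m) σ := by
  have hy' : y ∈ S ∪ marks M := Finset.mem_union_left _ hy
  have hadd : AnalyticAt ℂ (fun r : ℂ => st.coord y + r) 0 := analyticAt_const.add analyticAt_id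
  have hdisc : AnalyticAt ℂ (fun r : ℂ => y.chart.disc (st.coord y + r)) 0 :=
    AnalyticAt.fun_comp (g := y.chart.disc) (by
      simpa using y.chart.analyticAt_disc (hst.coord_mem' hy')) hadd
  have hp0 : y.chart.disc (st.coord y + 0) = st.pos y := by simp [State.pos]
  have htend : Tendsto (fun r : ℂ => y.chart.disc (st.coord y + r)) (𝓝 0) (𝓝 (st.pos y)) := by
    rw [← hp0]; exact hdisc.continuousAt
  have hnorm : ∀ᶠ r in 𝓝 (0 : ℂ), ‖y.chart.disc (st.coord y + r)‖ < 1 :=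
    htend.norm.eventually (gt_mem_nhds (hst.norm_pos_lt hy hyn))
  have hne : ∀ᶠ r in 𝓝 (0 : ℂ), ∀ k, y.chart.disc (st.coord y + r) ≠ M.mark k :=
    eventually_all.2 fun k => htend.eventually_ne
      (sub_ne_zero.1 (hst.pos_sub_mark_ne_zero hy' (hyn.ne_marked k)))
  have hbr : ∀ k, AnalyticAt ℂ (fun r => st.branch y k (y.chart.disc (st.coord y + r))) 0 :=
    fun k => AnalyticAt.fun_comp (g := st.branch y k)
      (by rw [hp0]; exact hst.analyticAt_branch hy' (hyn.ne_marked k)) hdisc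
  have hF : ∀ s, AnalyticAt ℂ (fun r => component h s (y.chart.disc (st.coord y + r))) 0 :=
    fun s => AnalyticAt.fun_comp (g := component h s)
      (by rw [hp0]; exact isTest_iff.1 ht y hy' s) hdisc
  have hG : ∀ s, AnalyticAt ℂ (fun r => germ β₀ β st s y (y.chart.disc (st.coord y + r))) 0 :=
    fun s => AnalyticAt.fun_comp (g := germ β₀ β st s y)
      (by rw [hp0]; exact analyticAt_germ β₀ β hst hy hyn s) hdisc
  have hev : ∀ᶠ r in 𝓝 (0 : ℂ), ∀ s, component h' s (y.chart.disc (st.coord y + r)) =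
      component h s (y.chart.disc (st.coord y + r)) +
        germ β₀ β st s y (y.chart.disc (st.coord y + r)) :=
    eventually_all.2 fun s => htend.eventually ((hh s).1 y hy)
  filter_upwards [hnorm.eventually_nhds, hne.eventually_nhds,
    eventually_all.2 fun k => (hbr k).eventually_analyticAt,
    eventually_all.2 fun s => (hF s).eventually_analyticAt,
    eventually_all.2 fun s => (hG s).eventually_analyticAt, hev.eventually_nhds]
    with t hnorm hne hbr hF hG hev x σ hxn hxy hσ hcoord hlog s m
  have hsh := shift_eq_of_branch β₀ β hσ hxn hcoord (by rw [hxy]; exact hnorm)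
    (fun k => (hbr k).continuousAt)
    (fun k => by
      filter_upwards [hne] with r hr
      rw [hxy]
      exact hst.exp_branch hy' (hyn.ne_marked k) (hr k)) hlog s m
  rw [hsh, CoulombGas.jet_eq, CoulombGas.jet_eq, ← map_add, hxy, hcoord]
  congr 1
  have hc : ∀ f : ℂ → ℂ, iteratedDeriv m (fun z => f (y.chart.disc z)) (st.coord y + t) =
      iteratedDeriv m (fun r => f (y.chart.disc (st.coord y + r))) t := by
    intro f
    rw [iteratedDeriv_comp_const_add m (fun z => f (y.chart.disc z))]
  rw [hc, hc]
  have he : (fun r => component h' s (y.chart.disc (st.coord y + r))) =ᶠ[𝓝 t]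
      (fun r => component h s (y.chart.disc (st.coord y + r))) +
        fun r => germ β₀ β st s y (y.chart.disc (st.coord y + r)) := by
    filter_upwards [hev] with r hr using hr s
  rw [he.iteratedDeriv_eq, iteratedDeriv_add (hF s).contDiffAt (hG s).contDiffAt]
  rfl

/-- The translation of a field, tested against `h`, is the field tested against any `h'` with the
translated jets. -/
theorem evalAt_hat_eq {β₀ β : BackgroundCharge M b} {X : Fock M} (hX : FieldOn S X)
    {h h' : (ℂ → ℂ) × (ℂ → ℂ)} {σ : State M}
    (hj : ∀ y ∈ S, ∀ s m, jet h' σ (y, s, m) = jet h σ (y, s, m) + shift β₀ β (y, s, m) σ) :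
    evalAt h (hat β₀ β X) σ = evalAt h' X σ := by
  rw [evalAt_eq, evalAt_eq, hat_eq, evalJet_translate]
  exact evalJet_congr (fieldOn_iff.1 hX) σ fun g hg => (hj g.1 hg g.2.1 g.2.2).symm

/-- A state which agrees with `st` at the node `y` has the translated jets there. -/
theorem IsShifted.jet_eq_of_eq {β₀ β : BackgroundCharge M b} {h h' : (ℂ → ℂ) × (ℂ → ℂ)}
    (hh : IsShifted β₀ β S st h h') (hst : st.Valid S) (ht : IsTest S st h) {y : Pt M}
    (hy : y ∈ S) (hyn : y.IsNode) {σ : State M} (hσ : σ.MarksFixed)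
    (hcoord : σ.coord y = st.coord y)
    (hlog : ∀ k, σ.logDiff y (.marked k) = st.logDiff y (.marked k)) (s : Bool) (m : ℕ) :
    jet h' σ (y, s, m) = jet h σ (y, s, m) + shift β₀ β (y, s, m) σ := by
  refine (hh.jet_eq hst ht hy hyn).self_of_nhds y σ hyn rfl hσ (by simpa using hcoord)
    (fun k => ?_) s m
  rw [add_zero, hlog]
  exact (hst.branch_pos (Finset.mem_union_left _ hy) (hyn.ne_marked k)).symm

theorem IsShifted.evalAt_hat {β₀ β : BackgroundCharge M b} {h h' : (ℂ → ℂ) × (ℂ → ℂ)}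
    (hh : IsShifted β₀ β S st h h') (hS : ∀ x ∈ S, x.IsNode) (hst : st.Valid S)
    (ht : IsTest S st h) {X : Fock M} (hX : FieldOn S X) :
    evalAt h (hat β₀ β X) st = evalAt h' X st :=
  evalAt_hat_eq hX fun y hy s m => hh.jet_eq_of_eq hst ht hy (hS y hy) hst.marksFixed rfl
    (fun _ => rfl) s m

theorem eqWithin_hat (β₀ β : BackgroundCharge M b) (hS : ∀ x ∈ S, x.IsNode) {X Y : Fock M}
    (hX : FieldOn S X) (hY : FieldOn S Y) (h : EqWithin S X Y) :
    EqWithin S (hat β₀ β X) (hat β₀ β Y) := by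
  intro st hst g hg
  obtain ⟨g', hg'⟩ := exists_isShifted β₀ β hS hst g
  rw [hg'.evalAt_hat hS hst hg hX, hg'.evalAt_hat hS hst hg hY]
  exact h st hst g' (hg'.isTest hS hst hg)

theorem _root_.CoulombGas.State.MarksFixed.move {σ : State M} (hσ : σ.MarksFixed) {x : Pt M}
    (hx : x.IsNode) (t : ℂ) : (σ.move x t).MarksFixed := fun k => by
  simp [State.move, (hx.ne_marked k).symm, hσ k]

theorem _root_.CoulombGas.State.MarksFixed.collide {σ : State M} (hσ : σ.MarksFixed) {x : Pt M}
    (hx : x.IsNode) (y : Pt M) (t : ℂ) : (σ.collide x y t).MarksFixed := fun k => by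
  simp [State.collide, (hx.ne_marked k).symm, hσ k]

/-- Translation commutes with differentiation at a node within correlations: the test functions `h'`
for which the jets are translated can be chosen once for all small displacements of the node. -/
theorem hasDerivs_hat (β₀ β : BackgroundCharge M b) (hS : ∀ x ∈ S, x.IsNode)
    {X Y Y' : Fock M} {x : Pt M} (hx : x ∈ S) (hX : FieldOn S X) (hY : FieldOn S Y)
    (hY' : FieldOn S Y') (h : HasDerivs S X x Y Y') :
    HasDerivs S (hat β₀ β X) x (hat β₀ β Y) (hat β₀ β Y') := by
  intro st hst g hg
  obtain ⟨g', hg'⟩ := exists_isShifted β₀ β hS hst g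
  rw [hg'.evalAt_hat hS hst hg hY, hg'.evalAt_hat hS hst hg hY']
  refine (h st hst g' (hg'.isTest hS hst hg)).congr_of_eventuallyEq ?_
  have hxn := hS x hx
  filter_upwards [hg'.jet_eq hst hg hx hxn] with t ht
  have hm := hst.marksFixed.move hxn t
  refine evalAt_hat_eq hX fun y hy s m => ?_
  rcases eq_or_ne y x with rfl | hne
  · refine ht y _ hxn rfl hm (by simp [State.move]) (fun k => ?_) s m
    simp [State.move, State.branch, (hxn.ne_marked k).symm, hst.marksFixed.pos_marked]
  · refine hg'.jet_eq_of_eq hst hg hy (hS y hy) hm (by simp [State.move, hne]) (fun k => ?_) s m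
    simp [State.move, hne, (hxn.ne_marked k).symm]

theorem _root_.CoulombGas.approach_le (y : Pt M) : approach y ≤ 𝓝 0 := by
  cases y with
  | node c n => exact nhdsWithin_le_nhds
  | marked k =>
    rw [approach]
    split_ifs <;> exact nhdsWithin_le_nhds

theorem _root_.CoulombGas.chart_eq_of_chartIndex_eq {x y : Pt M}
    (h : x.chartIndex = y.chartIndex) : x.chart = y.chart := by
  cases x <;> cases y <;> simp_all [Pt.chartIndex, Pt.chart]

theorem hat_injective (β₀ β : BackgroundCharge M b) : Function.Injective (hat β₀ β) :=
  Function.LeftInverse.injective (g := hat β β₀) fun X => hat_hat β β₀ X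

/-- Translation commutes with the operator product expansion at a node. -/
theorem hasOPE_hat (β₀ β : BackgroundCharge M b) (hS : ∀ x ∈ S, x.IsNode) {X : Fock M}
    {x y : Pt M} {C : ScaleIndex → Fock M} (hX : FieldOn S X) (hy : y ∈ S)
    (h : HasOPE S X x y (S.erase x) C) :
    HasOPE S (hat β₀ β X) x y (S.erase x) fun I => hat β₀ β (C I) := by
  obtain ⟨hx, hxy, hch, hC, F, hF, hexp⟩ := h
  refine ⟨hx, hxy, hch, fun I => fieldOn_hat β₀ β (hC I), F, fun N I => ?_, ?_⟩
  · rw [hF, ← (hat_injective β₀ β).ne_iff (x := C I), map_zero]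
  · intro st hst g hg N
    have hS' : ∀ z ∈ S.erase x, z.IsNode := fun z hz => hS z (Finset.mem_of_mem_erase hz)
    obtain ⟨g', hg'⟩ := exists_isShifted β₀ β hS' hst g
    have hmain := hexp st hst g' (hg'.isTest hS' hst hg) N
    refine hmain.congr' ?_ EventuallyEq.rfl
    have hxn := hS x hx
    have hyn := hS y hy
    have hy' : y ∈ S.erase x := Finset.mem_erase.2 ⟨hxy.symm, hy⟩
    filter_upwards [approach_le y (hg'.jet_eq hst hg hy' hyn)] with t ht
    have hm := hst.marksFixed.collide hxn y t
    congr 1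
    · refine (evalAt_hat_eq hX fun z hz s m => ?_).symm
      rcases eq_or_ne z x with rfl | hne
      · refine ht z _ hxn (chart_eq_of_chartIndex_eq hch) hm (by simp [State.collide])
          (fun k => ?_) s m
        simp [State.collide, State.branch, (hxn.ne_marked k).symm, (hyn.ne_marked k).symm,
          hst.marksFixed.pos_marked]
      · refine hg'.jet_eq_of_eq hst hg (Finset.mem_erase.2 ⟨hne, hz⟩) (hS z hz) hm
          (by simp [State.collide, hne]) (fun k => ?_) s m
        simp [State.collide, hne, (hxn.ne_marked k).symm]
    · refine Finset.sum_congr rfl fun I _ => ?_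
      rw [hg'.evalAt_hat hS' hst hg (hC I)]

theorem hat_smul (β₀ β : BackgroundCharge M b) (a : ℂ) (X : Fock M) :
    hat β₀ β (a • X) = a • hat β₀ β X :=
  map_smul ((hat β₀ β).restrictScalars ℂ) a X

theorem Family.hat {β₀ : BackgroundCharge M b} {X : Fock M} (β : BackgroundCharge M b)
    (hX : β₀.Family S X) : β.Family S (hat β₀ β X) := by
  induction hX with
  | one hS => rw [map_one]; exact .one hS
  | bosonic hτ => rw [hat_bosonic]; exact .bosonic hτ
  | opeExp hτ => rw [hat_opeExp]; exact .opeExp hτ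
  | add _ _ ihX ihY => rw [map_add]; exact .add ihX ihY
  | smul a _ ih => rw [hat_smul]; exact .smul a ih
  | tensor hST _ _ ihX ihY => rw [hat_eq, translate_tensor]; exact .tensor hST ihX ihY
  | deriv hX hx hY hY' h ih =>
    exact .deriv ih hx (fieldOn_hat _ _ hY) (fieldOn_hat _ _ hY')
      (hasDerivs_hat β₀ β hX.fieldOn.1 hx hX.fieldOn.2 hY hY' h)
  | derivConj hX hx hY hY' h ih =>
    exact .derivConj ih hx (fieldOn_hat _ _ hY) (fieldOn_hat _ _ hY')
      (hasDerivs_hat β₀ β hX.fieldOn.1 hx hX.fieldOn.2 hY hY' h)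
  | ope hX hy h I ih => exact .ope ih hy (hasOPE_hat β₀ β hX.fieldOn.1 hX.fieldOn.2 hy h) I
  | congr hX hY h ih =>
    exact .congr ih (fieldOn_hat _ _ hY)
      (eqWithin_hat β₀ β hX.fieldOn.1 hX.fieldOn.2 hY h)

theorem image_family (β₀ β : BackgroundCharge M b) (S : Finset (Pt M)) :
    BackgroundCharge.hat β₀ β '' {X | β₀.Family S X} = {X | β.Family S X} := by
  refine Set.Subset.antisymm ?_ fun X hX => ⟨_, Family.hat β₀ hX, hat_hat β₀ β X⟩
  rintro _ ⟨X, hX, rfl⟩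
  exact Family.hat β hX

end BackgroundCharge

/-! ### Insertion of the Wick exponential of the background charge -/

/-- The covariance `E[Φ^s(x) Φ^s'(q_k)]`. -/
def markCov (x : Pt M) (k : Fin M.numMarks) : Bool → Bool → Coeff M
  | true, true => fun st => -st.logDiff x (.marked k)
  | false, false => fun st => -starRingEnd ℂ (st.logDiff x (.marked k))
  | true, false => fun st => Complex.log (1 - st.pos x * starRingEnd ℂ (st.pos (.marked k)))
  | false, true => fun st => Complex.log (1 - st.pos (.marked k) * starRingEnd ℂ (st.pos x))

theorem cov_marked (x : Pt M) (s s' : Bool) (m : ℕ) (k : Fin M.numMarks) :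
    cov (x, s, m) (.marked k, s', 0) = dSign s x m (markCov x k s s') := by
  cases s <;> cases s' <;> unfold cov
  · exact congrArg (dSign false x m) (dSign_zero false (.marked k) (markCov x k false false))
  · exact congrArg (dSign false x m) (dSign_zero true (.marked k) (markCov x k false true))
  · exact congrArg (dSign true x m) (dSign_zero false (.marked k) (markCov x k true false))
  · exact congrArg (dSign true x m) (dSign_zero true (.marked k) (markCov x k true true))

theorem State.Valid.analyticAt_disc_add {S : Finset (Pt M)} {st : State M} (hst : st.Valid S)
    {y : Pt M} (hy : y ∈ S ∪ marks M) :
    AnalyticAt ℂ (fun r : ℂ => y.chart.disc (st.coord y + r)) 0 :=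
  AnalyticAt.fun_comp (g := y.chart.disc) (by
    simpa using y.chart.analyticAt_disc (hst.coord_mem' hy)) (analyticAt_const.add analyticAt_id)

theorem State.Valid.analyticAt_markCov {S : Finset (Pt M)} {st : State M} (hst : st.Valid S)
    {x : Pt M} (hx : x ∈ S) (hn : x.IsNode) (k : Fin M.numMarks) (s s' : Bool) :
    AnalyticAt ℂ (fun r => conjSign s (markCov x k s s' (st.move x r))) 0 := by
  have hx' : x ∈ S ∪ marks M := Finset.mem_union_left _ hx
  have hne := (hn.ne_marked k).symm
  have hdisc := hst.analyticAt_disc_add hx'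
  have hp0 : x.chart.disc (st.coord x + 0) = st.pos x := by simp [State.pos]
  have hlog : ∀ r, (st.move x r).logDiff x (.marked k) =
      st.branch x k (x.chart.disc (st.coord x + r)) := by
    intro r
    simp [State.move, State.branch, hne, hst.marksFixed.pos_marked]
  have hpos : ∀ r, (st.move x r).pos x = x.chart.disc (st.coord x + r) := by
    intro r
    simp [State.move, State.pos]
  have hposk : ∀ r, (st.move x r).pos (.marked k) = M.mark k := fun r =>
    (hst.marksFixed.move hn r).pos_marked k
  have hA : AnalyticAt ℂ (fun r => st.branch x k (x.chart.disc (st.coord x + r))) 0 :=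
    AnalyticAt.fun_comp (g := st.branch x k)
      (by rw [hp0]; exact hst.analyticAt_branch hx' (hn.ne_marked k)) hdisc
  have hslit : ∀ᶠ r in 𝓝 (0 : ℂ), ‖x.chart.disc (st.coord x + r)‖ < 1 := by
    refine hdisc.continuousAt.norm.eventually (gt_mem_nhds ?_)
    change ‖x.chart.disc (st.coord x + 0)‖ < 1
    rw [hp0]
    exact hst.norm_pos_lt hx hn
  have hB : AnalyticAt ℂ (fun r => Complex.log
      (1 - x.chart.disc (st.coord x + r) * starRingEnd ℂ (M.mark k))) 0 :=
    AnalyticAt.clog (analyticAt_const.sub (hdisc.mul analyticAt_const))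
      (slitPlane_of_norm_lt hslit.self_of_nhds (M.norm_mark_le k))
  cases s <;> cases s'
  · simp only [markCov, conjSign, hlog, map_neg, Complex.conj_conj]
    exact hA.neg
  · refine hB.congr ?_
    filter_upwards [hslit] with r hr
    have hs := slitPlane_of_norm_lt hr (M.norm_mark_le k)
    have h := Complex.log_conj _ (Complex.mem_slitPlane_iff_arg.1 hs).1
    simp only [markCov, conjSign, hpos, hposk]
    rw [← Complex.conj_conj (Complex.log (1 - x.chart.disc (st.coord x + r) * _)), ← h]
    simp [mul_comm]
  · simpa [markCov, conjSign, hpos, hposk] using hB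
  · simp only [markCov, conjSign, hlog, map_neg, RingHom.id_apply]
    exact hA.neg

namespace BackgroundCharge

variable {b : ℝ}

/-- The covariance of the symbols with the Gaussian field `iΦ[β - β₀]` is the translation. -/
theorem covRight_eq_shift (β₀ β : BackgroundCharge M b) {S : Finset (Pt M)} {st : State M}
    (hst : st.Valid S) {g : Sym M} (hg : g.1 ∈ S) (hn : g.1.IsNode) :
    covRight (iPhi (β.diff β₀)) g st = shift β₀ β g st := by
  obtain ⟨x, s, m⟩ := g
  replace hg : x ∈ S := hg
  replace hn : x.IsNode := hn
  have hphi : (β.phi s x - β₀.phi s x) = fun st => ∑ k,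
      (Complex.I * (β.plus k - β₀.plus k) * markCov x k s true st +
        -Complex.I * (β.minus k - β₀.minus k) * markCov x k s false st) := by
    funext st
    cases s
    · rw [phi_sub_false, Finset.mul_sum]
      refine Finset.sum_congr rfl fun k _ => ?_
      simp only [markCov]
      ring
    · rw [phi_sub_true, Finset.mul_sum]
      refine Finset.sum_congr rfl fun k _ => ?_
      simp only [markCov]
      ring
  have han : ∀ (c : ℂ) (k : Fin M.numMarks) (s' : Bool), ContDiffAt ℂ m
      (fun r => conjSign s c * conjSign s (markCov x k s s' (st.move x r))) 0 := fun c k s' =>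
    (analyticAt_const.mul (hst.analyticAt_markCov hg hn k s s')).contDiffAt
  rw [shift, dSign_eq, hphi]
  simp only [map_sum, map_add, map_mul]
  rw [iteratedDeriv_fun_sum fun k _ => ?_, map_sum]
  · rw [covRight, iPhi_sum _ _ (by simp) (by intros; ring), diff, List.map_map,
      ← List.ofFn_eq_map, List.sum_ofFn]
    refine Finset.sum_congr rfl fun k _ => ?_
    simp only [Function.comp_apply]
    have h1 := han (Complex.I * (β.plus k - β₀.plus k)) k true
    have h2 := han (-Complex.I * (β.minus k - β₀.minus k)) k false
    simp only [map_mul] at h1 h2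
    rw [iteratedDeriv_fun_add h1 h2, iteratedDeriv_const_mul_field,
      iteratedDeriv_const_mul_field, map_add, cov_marked, cov_marked, dSign_eq, dSign_eq]
    simp only [map_mul, conjSign_conjSign]
  · have h1 := han (Complex.I * (β.plus k - β₀.plus k)) k true
    have h2 := han (-Complex.I * (β.minus k - β₀.minus k)) k false
    simp only [map_mul] at h1 h2
    exact h1.add h2

/-- Insertion of `V^⊙[β - β₀]`, within correlations. -/
theorem evalJet_tensor_vertexWick (β₀ β : BackgroundCharge M b) {S : Finset (Pt M)}
    (hS : ∀ x ∈ S, x.IsNode) {X : Fock M} (hX : FieldOn S X) {st : State M} (hst : st.Valid S)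
    (j : Sym M → ℂ) : evalJet st j (CoulombGas.tensor X (vertexWick (β.diff β₀))) =
      evalJet st j (BackgroundCharge.hat β₀ β X * vertexWick (β.diff β₀)) := by
  rw [vertexWick, tensor_wickExp, map_mul, map_mul, evalJet_translate, hat_eq, evalJet_translate]
  congr 1
  refine evalJet_congr (fieldOn_iff.1 hX) st fun g hg => ?_
  rw [covRight_eq_shift β₀ β hst hg (hS _ hg)]

theorem expect_tensor_vertexWick (β₀ β : BackgroundCharge M b) {S : Finset (Pt M)}
    (hS : ∀ x ∈ S, x.IsNode) {X : Fock M} (hX : FieldOn S X) {st : State M} (hst : st.Valid S) :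
    expect (CoulombGas.tensor X (vertexWick (β.diff β₀))) st =
      expect (BackgroundCharge.hat β₀ β X) st := by
  rw [expect_eq, expect_eq, evalJet_tensor_vertexWick β₀ β hS hX hst, map_mul, vertexWick,
    evalJet_wickExp]
  simp

end BackgroundCharge

/-! ### Linear independence of exponential monomials -/

/-- The exponential monomial `∏ j_v^{n_v} exp (∑ a_v j_v)` with label `p = (n, a)`. -/
def expMono {V : Type*} (p : (V →₀ ℕ) × (V →₀ ℂ)) (j : V → ℂ) : ℂ :=
  (p.1.prod fun v n => j v ^ n) * Complex.exp (p.2.sum fun v a => a * j v)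

/-- The operator `F ↦ F (· + s)`. -/
def shiftOp {V : Type*} (s : V → ℂ) : Module.End ℂ ((V → ℂ) → ℂ) :=
  LinearMap.funLeft ℂ ℂ fun j => j + s

theorem shiftOp_apply {V : Type*} (s : V → ℂ) (F : (V → ℂ) → ℂ) (j : V → ℂ) :
    shiftOp s F j = F (j + s) := rfl

/-- Multiplication by a coordinate raises the nilpotency order of `T - μ` by one at most. -/
theorem pow_coord_mul_eq_zero {A : Type*} {T : Module.End ℂ (A → ℂ)} {x : A → ℂ}
    {c : ℂ} (hT : ∀ F, T (x * F) = x * T F + c • T F) (μ : ℂ) (k : ℕ) {F : A → ℂ}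
    (hF : ((T - μ • (1 : Module.End ℂ (A → ℂ))) ^ k) F = 0) :
    ((T - μ • (1 : Module.End ℂ (A → ℂ))) ^ (k + 1)) (x * F) = 0 := by
  induction k generalizing F with
  | zero =>
    have : F = 0 := by simpa using hF
    simp [this]
  | succ k ih =>
    have h1 : (T - μ • (1 : Module.End ℂ (A → ℂ))) (x * F) =
        x * (T - μ • (1 : Module.End ℂ (A → ℂ))) F + c • T F := by
      simp only [LinearMap.sub_apply, LinearMap.smul_apply, Module.End.one_apply, hT]
      rw [mul_sub, mul_smul_comm]
      abel
    rw [pow_succ, Module.End.mul_apply, h1, map_add]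
    rw [pow_succ, Module.End.mul_apply] at hF
    rw [ih hF, zero_add, map_smul]
    have hc : Commute ((T - μ • (1 : Module.End ℂ (A → ℂ))) ^ (k + 1)) T :=
      ((Commute.refl T).sub_left ((Commute.one_left T).smul_left μ)).pow_left _
    rw [← Module.End.mul_apply, hc.eq, Module.End.mul_apply, pow_succ, Module.End.mul_apply, hF,
      map_zero, smul_zero]

/-- Exponential monomials are generalized eigenvectors of the translations; the eigenvalue is given
by the exponential part. -/
theorem expMono_mem_maxGenEigenspace {V : Type*} (p : (V →₀ ℕ) × (V →₀ ℂ)) (s : V → ℂ) :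
    expMono p ∈ (shiftOp s).maxGenEigenspace (Complex.exp (p.2.sum fun v a => a * s v)) := by
  set μ := Complex.exp (p.2.sum fun v a => a * s v) with hμ
  set W := (shiftOp s).maxGenEigenspace μ
  have hcoord : ∀ (v : V) (F : (V → ℂ) → ℂ), F ∈ W → (fun j : V → ℂ => j v) * F ∈ W := by
    intro v F hF
    obtain ⟨k, hk⟩ := (Module.End.mem_maxGenEigenspace _ _ _).1 hF
    refine (Module.End.mem_maxGenEigenspace _ _ _).2 ⟨k + 1, ?_⟩
    refine pow_coord_mul_eq_zero (c := s v) (fun F => ?_) μ k hk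
    funext j
    simp [shiftOp_apply, add_mul]
  have hprod : ∀ F ∈ W, (fun j : V → ℂ => p.1.prod fun v n => j v ^ n) * F ∈ W := by
    have h : (fun j : V → ℂ => p.1.prod fun v n => j v ^ n) =
        ∏ v ∈ p.1.support, (fun j : V → ℂ => j v) ^ p.1 v := by
      funext j
      simp [Finsupp.prod]
    rw [h]
    refine Finset.prod_induction (fun v => (fun j : V → ℂ => j v) ^ p.1 v)
      (fun f => ∀ F ∈ W, f * F ∈ W) ?_ ?_ ?_
    · intro f g hf hg F hF
      rw [mul_assoc]
      exact hf _ (hg _ hF)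
    · intro F hF
      rwa [one_mul]
    · intro v _
      induction p.1 v with
      | zero => intro F hF; rwa [pow_zero, one_mul]
      | succ n ih => intro F hF; rw [pow_succ', mul_assoc]; exact hcoord _ _ (ih _ hF)
  refine hprod (fun j => Complex.exp (p.2.sum fun v a => a * j v)) ?_
  refine (Module.End.mem_maxGenEigenspace _ _ _).2 ⟨1, ?_⟩
  rw [pow_one]
  funext j
  simp only [LinearMap.sub_apply, LinearMap.smul_apply, Module.End.one_apply, Pi.sub_apply,
    Pi.smul_apply, shiftOp_apply, Pi.add_apply, mul_add, smul_eq_mul, Pi.zero_apply]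
  rw [Finsupp.sum_add, Complex.exp_add, hμ]
  ring

theorem character_injective {V : Type*} {a a' : V →₀ ℂ}
    (h : ∀ s : V → ℂ, Complex.exp (a.sum fun v c => c * s v) =
      Complex.exp (a'.sum fun v c => c * s v)) : a = a' := by
  classical
  ext v
  have hsum : ∀ (a : V →₀ ℂ) (z : ℂ),
      (a.sum fun w c => c * (Pi.single v z : V → ℂ) w) = a v * z := by
    intro a z
    rw [Finsupp.sum, Finset.sum_eq_single v]
    · simp
    · intro w _ hw; simp [hw]
    · intro hv; simp [Finsupp.notMem_support_iff.1 hv]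
  have h1 : ∀ z : ℂ, Complex.exp (a v * z) = Complex.exp (a' v * z) := by
    intro z
    simpa only [hsum] using h (Pi.single v z)
  have hd : ∀ c : ℂ, HasDerivAt (fun z : ℂ => Complex.exp (c * z)) c 0 := by
    intro c
    simpa using (((hasDerivAt_id (0 : ℂ)).const_mul c).cexp)
  have h2 : (fun z : ℂ => Complex.exp (a v * z)) = fun z => Complex.exp (a' v * z) := funext h1
  exact (hd (a v)).unique (h2 ▸ hd (a' v))

/-- Exponential monomials with different exponential parts lie in independent generalized
eigenspaces of the translations; those with the same exponential part reduce to monomials. -/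
theorem expMono_independent {V : Type*} (P : Finset ((V →₀ ℕ) × (V →₀ ℂ)))
    (c : (V →₀ ℕ) × (V →₀ ℂ) → ℂ) (h : ∀ j : V → ℂ, ∑ p ∈ P, c p * expMono p j = 0) :
    ∀ p ∈ P, c p = 0 := by
  classical
  have hind := Module.End.independent_iInf_maxGenEigenspace_of_forall_mapsTo
    (f := fun s : V → ℂ => (shiftOp s)) (fun s s' φ => by
      refine Module.End.mapsTo_maxGenEigenspace_of_comm ?_ φ
      ext F j
      simp [shiftOp_apply, add_comm, add_left_comm])
  rw [iSupIndep_iff_finsetSum_eq_zero_imp_eq_zero] at hind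
  let χ : (V →₀ ℂ) → (V → ℂ) → ℂ := fun a s => Complex.exp (a.sum fun v c => c * s v)
  have hχ : Function.Injective χ := fun a a' haa =>
    character_injective fun s => congrFun haa s
  intro p₀ hp₀
  have hgroup : ∀ j : V → ℂ, ∑ p ∈ P with p.2 = p₀.2, c p * expMono p j = 0 := by
    have := hind (P.image fun p => χ p.2)
      (fun φ => ∑ p ∈ P with χ p.2 = φ, c p • expMono p) ?_ ?_ (χ p₀.2)
      (Finset.mem_image_of_mem _ hp₀)
    · intro j
      have hj := congrFun this j
      simpa [hχ.eq_iff] using hj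
    · intro φ _
      refine Submodule.sum_mem _ fun p hp => Submodule.smul_mem _ _ ?_
      rw [Submodule.mem_iInf]
      intro s
      rw [← (Finset.mem_filter.1 hp).2]
      exact expMono_mem_maxGenEigenspace p s
    · refine (Finset.sum_fiberwise_of_maps_to (s := P)
        (g := fun p : (V →₀ ℕ) × (V →₀ ℂ) => χ p.2)
        (fun p hp => Finset.mem_image_of_mem (fun p => χ p.2) hp)
        (fun p => c p • expMono p)).trans ?_
      funext j
      simpa using h j
  have hpoly : ∑ p ∈ P with p.2 = p₀.2, MvPolynomial.monomial p.1 (c p) = 0 := by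
    refine MvPolynomial.funext fun j => ?_
    have hj := hgroup j
    rw [map_zero, map_sum]
    have he : ∀ p ∈ P.filter (fun p => p.2 = p₀.2), c p * expMono p j =
        MvPolynomial.eval j (MvPolynomial.monomial p.1 (c p)) *
          Complex.exp (p₀.2.sum fun v a => a * j v) := by
      intro p hp
      rw [MvPolynomial.eval_monomial, expMono, (Finset.mem_filter.1 hp).2, mul_assoc]
    rw [Finset.sum_congr rfl he, ← Finset.sum_mul] at hj
    exact (mul_eq_zero.1 hj).resolve_right (Complex.exp_ne_zero _)
  have hcoeff := congrArg (MvPolynomial.coeff p₀.1) hpoly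
  rw [MvPolynomial.coeff_sum, MvPolynomial.coeff_zero, Finset.sum_eq_single p₀] at hcoeff
  · simpa using hcoeff
  · intro p hp hne
    rw [MvPolynomial.coeff_monomial, if_neg]
    intro h1
    exact hne (Prod.ext h1 (Finset.mem_filter.1 hp).2)
  · intro hn
    exact absurd (Finset.mem_filter.2 ⟨hp₀, (rfl : p₀.2 = p₀.2)⟩) hn

/-- Linearly independent functions are separated by finite combinations of evaluations. -/
theorem exists_weights {A ι : Type*} [DecidableEq ι] (P : Finset ι) (e : ι → A → ℂ)
    (h : ∀ c : ι → ℂ, (∀ a, ∑ p ∈ P, c p * e p a = 0) → ∀ p ∈ P, c p = 0) (p₀ : ι) :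
    ∃ w : A →₀ ℂ, ∀ p ∈ P, (w.sum fun a c => c * e p a) = if p = p₀ then 1 else 0 := by
  let ev : A → (P → ℂ) := fun a p => e p a
  have htop : Submodule.span ℂ (Set.range ev) = ⊤ := by
    by_contra hne
    obtain ⟨f, hf0, hf⟩ := Submodule.exists_le_ker_of_lt_top _ (lt_top_iff_ne_top.2 hne)
    apply hf0
    let c : ι → ℂ := fun p => if hp : p ∈ P then f (Pi.single ⟨p, hp⟩ 1) else 0
    have hc : ∀ v : P → ℂ, f v = ∑ p : P, c p * v p := by
      intro v
      conv_lhs => rw [pi_eq_sum_univ' v, map_sum]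
      refine Finset.sum_congr rfl fun p _ => ?_
      rw [map_smul, smul_eq_mul, mul_comm]
      congr 1
      simp only [c, p.2, dif_pos]
    have h0 := h c fun a => by
      have ha : f (ev a) = 0 := hf (Submodule.subset_span ⟨a, rfl⟩)
      rw [hc] at ha
      rw [← Finset.sum_coe_sort P]
      exact ha
    refine LinearMap.ext fun v => ?_
    rw [hc, LinearMap.zero_apply]
    exact Finset.sum_eq_zero fun p _ => by rw [h0 p p.2, zero_mul]
  have hmem : (fun p : P => if (p : ι) = p₀ then (1 : ℂ) else 0) ∈
      Submodule.span ℂ (Set.range ev) := by rw [htop]; trivial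
  obtain ⟨w, hw⟩ := (Finsupp.mem_span_range_iff_exists_finsupp).1 hmem
  refine ⟨w, fun p hp => ?_⟩
  have := congrFun hw ⟨p, hp⟩
  rw [← this, Finsupp.sum, Finsupp.sum, Finset.sum_apply]
  rfl

/-! ### The asymptotic scale -/

namespace ScaleIndex

theorem ext' {I J : ScaleIndex} (h1 : I.pow = J.pow) (h2 : I.powConj = J.powConj)
    (h3 : I.log = J.log) (h4 : I.logConj = J.logConj) : I = J := by
  cases I; cases J; simp_all

/-- The exponent of `‖t‖` in the size of a member of the scale. -/
def order (I : ScaleIndex) : ℝ := (I.pow + I.powConj).re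

instance : Add ScaleIndex :=
  ⟨fun I J => ⟨I.pow + J.pow, I.powConj + J.powConj, I.log + J.log, I.logConj + J.logConj⟩⟩

theorem order_add (I J : ScaleIndex) : (I + J).order = I.order + J.order := by
  change (I.pow + J.pow + (I.powConj + J.powConj)).re = _
  simp only [order, Complex.add_re]
  ring

theorem toFun_add (I J : ScaleIndex) (t : ℂ) : (I + J).toFun t = I.toFun t * J.toFun t := by
  change Complex.exp ((I.pow + J.pow) * _ + (I.powConj + J.powConj) * _) *
    Complex.log t ^ (I.log + J.log) * _ ^ (I.logConj + J.logConj) = _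
  unfold toFun
  rw [show ∀ a b c d L L' : ℂ, (a + b) * L + (c + d) * L' = (a * L + c * L') + (b * L + d * L') by
    intros; ring, Complex.exp_add, pow_add, pow_add]
  ring

/-- The constant function `1`. -/
def zero : ScaleIndex := ⟨0, 0, 0, 0⟩

theorem toFun_zero (t : ℂ) : zero.toFun t = 1 := by simp [zero, toFun]

theorem norm_toFun_le (I : ScaleIndex) {t : ℂ} (ht : t ≠ 0) :
    ‖I.toFun t‖ ≤ Real.exp (Real.pi * (|I.pow.im| + |I.powConj.im|)) * ‖t‖ ^ I.order *
      ‖Complex.log t‖ ^ (I.log + I.logConj) := by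
  have ht' : 0 < ‖t‖ := norm_pos_iff.2 ht
  unfold toFun
  rw [norm_mul, norm_mul, norm_pow, norm_pow, Complex.norm_conj, Complex.norm_exp, pow_add,
    mul_assoc]
  refine mul_le_mul_of_nonneg_right ?_ (by positivity)
  rw [Real.rpow_def_of_pos ht', ← Real.exp_add]
  apply Real.exp_le_exp.2
  have harg := Complex.abs_arg_le_pi t
  have h1 : |I.pow.im * t.arg| ≤ |I.pow.im| * Real.pi := by
    rw [abs_mul]; gcongr
  have h2 : |I.powConj.im * t.arg| ≤ |I.powConj.im| * Real.pi := by
    rw [abs_mul]; gcongr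
  have h3 := neg_abs_le (I.pow.im * t.arg)
  have h4 := le_abs_self (I.powConj.im * t.arg)
  simp only [Complex.add_re, Complex.mul_re, Complex.log_re, Complex.log_im, Complex.conj_re,
    Complex.conj_im, order]
  nlinarith

theorem norm_log_pow_isLittleO (n : ℕ) {ε : ℝ} (hε : 0 < ε) :
    (fun t : ℂ => ‖Complex.log t‖ ^ n) =o[𝓝[≠] 0] fun t => ‖t‖ ^ (-ε) := by
  have htend : Tendsto (fun t : ℂ => ‖t‖) (𝓝[≠] 0) (𝓝[>] 0) := tendsto_norm_nhdsNE_zero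
  have h1 : (fun t : ℂ => |Real.log ‖t‖| ^ (n : ℝ)) =o[𝓝[≠] 0] fun t => ‖t‖ ^ (-ε) :=
    (isLittleO_abs_log_rpow_rpow_nhdsGT_zero (n : ℝ) (neg_lt_zero.2 hε)).comp_tendsto htend
  refine IsBigO.trans_isLittleO (g := fun t : ℂ => |Real.log ‖t‖| ^ (n : ℝ)) ?_ h1
  refine IsBigO.of_bound ((1 + Real.pi) ^ n) ?_
  have hlog : ∀ᶠ t : ℂ in 𝓝[≠] 0, 1 ≤ |Real.log ‖t‖| :=
    (tendsto_abs_atBot_atTop.comp (Real.tendsto_log_nhdsGT_zero.comp htend)).eventually_ge_atTop 1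
  filter_upwards [hlog] with t ht
  rw [Real.rpow_natCast, norm_pow, norm_pow, norm_norm, Real.norm_eq_abs, abs_abs, ← mul_pow]
  gcongr
  have h2 : ‖Complex.log t‖ ≤ |(Complex.log t).re| + |(Complex.log t).im| :=
    Complex.norm_le_abs_re_add_abs_im _
  rw [Complex.log_re, Complex.log_im] at h2
  have h3 := Complex.abs_arg_le_pi t
  nlinarith [Real.pi_pos]

theorem toFun_isLittleO (I : ScaleIndex) {N : ℝ} (h : N < I.order) :
    I.toFun =o[𝓝[≠] 0] fun t => ‖t‖ ^ N := by
  have h1 := norm_log_pow_isLittleO (I.log + I.logConj) (sub_pos.2 h)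
  have h2 : (fun t : ℂ => ‖t‖ ^ I.order * ‖Complex.log t‖ ^ (I.log + I.logConj)) =o[𝓝[≠] 0]
      fun t => ‖t‖ ^ N := by
    refine ((isBigO_refl (fun t : ℂ => ‖t‖ ^ I.order) (𝓝[≠] 0)).mul_isLittleO h1).congr'
      EventuallyEq.rfl ?_
    filter_upwards [self_mem_nhdsWithin] with t ht
    rw [← Real.rpow_add (norm_pos_iff.2 ht)]
    congr 1
    ring
  refine IsBigO.trans_isLittleO (IsBigO.of_bound
    (Real.exp (Real.pi * (|I.pow.im| + |I.powConj.im|))) ?_) h2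
  filter_upwards [self_mem_nhdsWithin] with t ht
  have := norm_toFun_le I ht
  rw [mul_assoc] at this
  rwa [Real.norm_of_nonneg (by positivity)]

theorem toFun_mul_const_isLittleO {l : Filter ℂ} (hl : l ≤ 𝓝[≠] 0) (I : ScaleIndex) {N : ℝ}
    (h : N < I.order) (c : ℂ) : (fun t => I.toFun t * c) =o[l] fun t => ‖t‖ ^ N := by
  have h1 : I.toFun =o[l] fun t => ‖t‖ ^ N := (I.toFun_isLittleO h).mono hl
  have h2 : (fun t => c * I.toFun t) =o[l] fun t => ‖t‖ ^ N := h1.const_mul_left c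
  simpa only [mul_comm c] using h2

end ScaleIndex

theorem rpow_norm_isBigO {N N' : ℝ} (h : N ≤ N') :
    (fun t : ℂ => ‖t‖ ^ N') =O[𝓝[≠] 0] fun t => ‖t‖ ^ N := by
  refine IsBigO.of_bound 1 ?_
  have h1 : ∀ᶠ t : ℂ in 𝓝[≠] 0, ‖t‖ < 1 :=
    nhdsWithin_le_nhds ((continuous_norm.tendsto (0 : ℂ)).eventually (gt_mem_nhds (by simp)))
  filter_upwards [h1, self_mem_nhdsWithin] with t ht ht0
  rw [one_mul, Real.norm_of_nonneg (by positivity), Real.norm_of_nonneg (by positivity)]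
  exact Real.rpow_le_rpow_of_exponent_ge (norm_pos_iff.2 ht0) ht.le h

/-! ### Families of functions with expansions -/

/-- The functions `G ω`, for parameters `ω`, have asymptotic expansions along `l` in the scale, with
coefficients `ev ω (C i)` coming from elements `C i` of the algebra `A`. Several terms of the
expansion may carry the same member of the scale; there are finitely many of each order. -/
def Expands {R Ω : Type*} [CommRing R] [Algebra ℂ R] (l : Filter ℂ) (ev : Ω → R →ₐ[ℂ] ℂ)
    (A : Subalgebra ℂ R) (G : Ω → ℂ → ℂ) : Prop :=
  ∃ (ι : Type) (idx : ι → ScaleIndex) (C : ι → R) (F : ℝ → Finset ι),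
    (∀ N i, i ∈ F N ↔ (idx i).order ≤ N) ∧ (∀ i, C i ∈ A) ∧
    ∀ ω N, (fun t => G ω t - ∑ i ∈ F N, (idx i).toFun t * ev ω (C i)) =o[l] fun t => ‖t‖ ^ N

/-- It suffices to bound the remainder with more terms. -/
theorem remainder_of_le {ι : Type*} {l : Filter ℂ} (hl : l ≤ 𝓝[≠] 0) {idx : ι → ScaleIndex}
    {F : ℝ → Finset ι} (hF : ∀ N i, i ∈ F N ↔ (idx i).order ≤ N) {g : ℂ → ℂ} {c : ι → ℂ}
    {N N' : ℝ} (hN : N ≤ N')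
    (h : (fun t => g t - ∑ i ∈ F N', (idx i).toFun t * c i) =o[l] fun t => ‖t‖ ^ N) :
    (fun t => g t - ∑ i ∈ F N, (idx i).toFun t * c i) =o[l] fun t => ‖t‖ ^ N := by
  classical
  have hsub : F N ⊆ F N' := fun i hi => (hF _ _).2 (((hF _ _).1 hi).trans hN)
  have h2 : (fun t => ∑ i ∈ F N' \ F N, (idx i).toFun t * c i) =o[l] fun t => ‖t‖ ^ N := by
    refine IsLittleO.fun_sum fun i hi => ?_
    have hi' : N < (idx i).order := by
      have := (Finset.mem_sdiff.1 hi).2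
      rw [hF] at this
      exact not_le.1 this
    exact (idx i).toFun_mul_const_isLittleO hl hi' (c i)
  refine (h.add h2).congr' (Eventually.of_forall fun t => ?_) EventuallyEq.rfl
  have := Finset.sum_sdiff hsub (f := fun i => (idx i).toFun t * c i)
  linear_combination this

theorem exists_order_bound {ι : Type*} {idx : ι → ScaleIndex} {F : ℝ → Finset ι}
    (hF : ∀ N i, i ∈ F N ↔ (idx i).order ≤ N) : ∃ m : ℝ, 0 ≤ m ∧ ∀ i, -m ≤ (idx i).order := by
  refine ⟨∑ i ∈ F 0, |(idx i).order|, Finset.sum_nonneg fun _ _ => abs_nonneg _, fun i => ?_⟩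
  have h0 : 0 ≤ ∑ i ∈ F 0, |(idx i).order| := Finset.sum_nonneg fun _ _ => abs_nonneg _
  by_cases hi : i ∈ F 0
  · have := Finset.single_le_sum (f := fun i => |(idx i).order|) (fun _ _ => abs_nonneg _) hi
    have h2 := neg_abs_le (idx i).order
    linarith
  · rw [hF, not_le] at hi
    linarith

theorem partialSum_isBigO {ι : Type*} {l : Filter ℂ} (hl : l ≤ 𝓝[≠] 0) {idx : ι → ScaleIndex}
    {m : ℝ} (hm : ∀ i, -m ≤ (idx i).order) (s : Finset ι) (c : ι → ℂ) :
    (fun t => ∑ i ∈ s, (idx i).toFun t * c i) =O[l] fun t => ‖t‖ ^ (-m - 1) := by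
  refine IsBigO.fun_sum fun i _ => ?_
  exact ((idx i).toFun_mul_const_isLittleO hl (by linarith [hm i]) (c i)).isBigO

section Expands

variable {R Ω : Type*} [CommRing R] [Algebra ℂ R] {l : Filter ℂ} {ev : Ω → R →ₐ[ℂ] ℂ}
  {A : Subalgebra ℂ R} {G G' : Ω → ℂ → ℂ}

theorem Expands.congr (h : Expands l ev A G) (hG : ∀ ω, G' ω =ᶠ[l] G ω) : Expands l ev A G' := by
  obtain ⟨ι, idx, C, F, hF, hC, hexp⟩ := h
  refine ⟨ι, idx, C, F, hF, hC, fun ω N => (hexp ω N).congr' ?_ EventuallyEq.rfl⟩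
  filter_upwards [hG ω] with t ht
  rw [ht]

theorem Expands.add (h : Expands l ev A G) (h' : Expands l ev A G') :
    Expands l ev A fun ω t => G ω t + G' ω t := by
  obtain ⟨ι, idx, C, F, hF, hC, hexp⟩ := h
  obtain ⟨κ, idx', C', F', hF', hC', hexp'⟩ := h'
  refine ⟨ι ⊕ κ, Sum.elim idx idx', Sum.elim C C', fun N => (F N).disjSum (F' N), ?_, ?_, ?_⟩
  · rintro N (i | i) <;> simp [hF, hF']
  · rintro (i | i)
    · exact hC i
    · exact hC' i
  · intro ω N
    refine ((hexp ω N).add (hexp' ω N)).congr' (Eventually.of_forall fun t => ?_) EventuallyEq.rfl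
    simp only [Finset.sum_disjSum, Sum.elim_inl, Sum.elim_inr]
    ring

/-- The product of two expansions: the remainder of a product is of order `N` if the factors are
expanded to the order `N + m + 1`, where `-m` bounds all orders from below. -/
theorem Expands.mul (hl : l ≤ 𝓝[≠] 0) (h : Expands l ev A G) (h' : Expands l ev A G') :
    Expands l ev A fun ω t => G ω t * G' ω t := by
  classical
  obtain ⟨ι, idx, C, F, hF, hC, hexp⟩ := h
  obtain ⟨κ, idx', C', F', hF', hC', hexp'⟩ := h'
  obtain ⟨m₁, hm₁, hm⟩ := exists_order_bound hF
  obtain ⟨m₂, hm₂, hm'⟩ := exists_order_bound hF'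
  obtain ⟨m, h1m, h2m⟩ : ∃ m : ℝ, m₁ ≤ m ∧ m₂ ≤ m := ⟨max m₁ m₂, le_max_left _ _, le_max_right _ _⟩
  replace hm : ∀ i, -m ≤ (idx i).order := fun i => by linarith [hm i]
  replace hm' : ∀ i, -m ≤ (idx' i).order := fun i => by linarith [hm' i]
  let F₂ : ℝ → Finset (ι × κ) := fun N =>
    ((F (N + m)) ×ˢ (F' (N + m))).filter fun p => (idx p.1 + idx' p.2).order ≤ N
  have hF₂ : ∀ N p, p ∈ F₂ N ↔ (idx p.1 + idx' p.2).order ≤ N := by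
    intro N p
    simp only [F₂, Finset.mem_filter, Finset.mem_product, hF, hF', and_iff_right_iff_imp,
      ScaleIndex.order_add]
    intro hp
    constructor <;> linarith [hm p.1, hm' p.2]
  refine ⟨ι × κ, fun p => idx p.1 + idx' p.2, fun p => C p.1 * C' p.2, F₂, hF₂,
    fun p => A.mul_mem (hC _) (hC' _), fun ω N => ?_⟩
  refine remainder_of_le hl hF₂ (le_max_left N 0) ?_
  refine IsLittleO.trans_isBigO ?_ ((rpow_norm_isBigO (le_max_left N 0)).mono hl)
  have hN0 : 0 ≤ max N 0 := le_max_right _ _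
  generalize max N 0 = N at hN0
  set N₁ := N + m + 1 with hN₁
  set P : ℂ → ℂ := fun t => ∑ i ∈ F N₁, (idx i).toFun t * ev ω (C i) with hP
  set P' : ℂ → ℂ := fun t => ∑ i ∈ F' N₁, (idx' i).toFun t * ev ω (C' i) with hP'
  have hPO : P =O[l] fun t => ‖t‖ ^ (-m - 1) := partialSum_isBigO hl hm _ _
  have hPO' : P' =O[l] fun t => ‖t‖ ^ (-m - 1) := partialSum_isBigO hl hm' _ _
  have hGo := hexp ω N₁
  have hGo' := hexp' ω N₁
  have hGO' : (fun t => G' ω t) =O[l] fun t => ‖t‖ ^ (-m - 1) := by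
    have h1 := (hGo'.isBigO.trans
      ((rpow_norm_isBigO (N := -m - 1) (by linarith)).mono hl)).add hPO'
    simpa [hP'] using h1
  have hpow : (fun t : ℂ => ‖t‖ ^ N₁ * ‖t‖ ^ (-m - 1)) =ᶠ[l] fun t => ‖t‖ ^ N := by
    filter_upwards [hl self_mem_nhdsWithin] with t ht
    rw [← Real.rpow_add (norm_pos_iff.2 ht)]
    congr 1
    rw [hN₁]
    ring
  have e1 : (fun t => (G ω t - P t) * G' ω t) =o[l] fun t => ‖t‖ ^ N :=
    (hGo.mul_isBigO hGO').congr' EventuallyEq.rfl hpow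
  have e2 : (fun t => P t * (G' ω t - P' t)) =o[l] fun t => ‖t‖ ^ N := by
    refine (hPO.mul_isLittleO hGo').congr' EventuallyEq.rfl ?_
    filter_upwards [hpow] with t ht
    rw [mul_comm, ht]
  have hsub : F₂ N ⊆ F N₁ ×ˢ F' N₁ := by
    intro p hp
    rw [hF₂, ScaleIndex.order_add] at hp
    rw [Finset.mem_product, hF, hF']
    constructor <;> linarith [hm p.1, hm' p.2]
  have e3 : (fun t => ∑ p ∈ (F N₁ ×ˢ F' N₁) \ F₂ N,
      (idx p.1 + idx' p.2).toFun t * ev ω (C p.1 * C' p.2)) =o[l] fun t => ‖t‖ ^ N := by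
    refine IsLittleO.fun_sum fun p hp => ?_
    have hp' : N < (idx p.1 + idx' p.2).order := by
      have := (Finset.mem_sdiff.1 hp).2
      rw [hF₂] at this
      exact not_le.1 this
    exact (idx p.1 + idx' p.2).toFun_mul_const_isLittleO hl hp' _
  refine ((e1.add e2).add e3).congr' (Eventually.of_forall fun t => ?_) EventuallyEq.rfl
  have hPP : P t * P' t = ∑ p ∈ F N₁ ×ˢ F' N₁,
      (idx p.1 + idx' p.2).toFun t * ev ω (C p.1 * C' p.2) := by
    rw [hP, hP', Finset.sum_mul_sum, ← Finset.sum_product']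
    refine Finset.sum_congr rfl fun p _ => ?_
    rw [ScaleIndex.toFun_add, map_mul]
    ring
  rw [← Finset.sum_sdiff hsub] at hPP
  linear_combination -hPP

/-- A single term of the scale. -/
theorem Expands.term (hl : l ≤ 𝓝[≠] 0) (I : ScaleIndex) {r : R} (hr : r ∈ A) :
    Expands l ev A fun ω t => I.toFun t * ev ω r := by
  classical
  have hF : ∀ N (i : Unit), i ∈ (if I.order ≤ N then {()} else ∅ : Finset Unit) ↔ I.order ≤ N := by
    intro N i
    split_ifs with h <;> simp [h]
  refine ⟨Unit, fun _ => I, fun _ => r, fun N => if I.order ≤ N then {()} else ∅, hF,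
    fun _ => hr, fun ω N => remainder_of_le hl (N' := max N I.order) hF (le_max_left _ _) ?_⟩
  rw [if_pos (le_max_right _ _)]
  simp

theorem Expands.const (hl : l ≤ 𝓝[≠] 0) {r : R} (hr : r ∈ A) :
    Expands l ev A fun ω _ => ev ω r :=
  (Expands.term hl ScaleIndex.zero hr).congr fun ω => by simp [ScaleIndex.toFun_zero]

theorem Expands.sum (hl : l ≤ 𝓝[≠] 0) {κ : Type*} (s : Finset κ) {G : κ → Ω → ℂ → ℂ}
    (h : ∀ i ∈ s, Expands l ev A (G i)) : Expands l ev A fun ω t => ∑ i ∈ s, G i ω t := by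
  classical
  induction s using Finset.induction_on with
  | empty => simpa using Expands.const (ev := ev) hl A.zero_mem
  | insert i s hi ih =>
    simp only [Finset.sum_insert hi]
    exact (h i (Finset.mem_insert_self _ _)).add
      (ih fun j hj => h j (Finset.mem_insert_of_mem hj))

theorem Expands.prod (hl : l ≤ 𝓝[≠] 0) {κ : Type*} (s : Finset κ) {G : κ → Ω → ℂ → ℂ}
    (h : ∀ i ∈ s, Expands l ev A (G i)) : Expands l ev A fun ω t => ∏ i ∈ s, G i ω t := by
  classical
  induction s using Finset.induction_on with
  | empty => simpa using Expands.const (ev := ev) hl A.one_mem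
  | insert i s hi ih =>
    simp only [Finset.prod_insert hi]
    exact (h i (Finset.mem_insert_self _ _)).mul hl
      (ih fun j hj => h j (Finset.mem_insert_of_mem hj))

theorem Expands.pow (hl : l ≤ 𝓝[≠] 0) (h : Expands l ev A G) (n : ℕ) :
    Expands l ev A fun ω t => G ω t ^ n := by
  simpa using Expands.prod hl (Finset.range n) (fun _ _ => h)

/-- Change of the ring of coefficients. -/
theorem Expands.map {R' Ω' : Type*} [CommRing R'] [Algebra ℂ R'] {ev' : Ω' → R' →ₐ[ℂ] ℂ}
    {A' : Subalgebra ℂ R'} (Φ : R → R') (ρ : Ω' → Ω) (hev : ∀ ω r, ev' ω (Φ r) = ev (ρ ω) r)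
    (hA : ∀ r ∈ A, Φ r ∈ A') (h : Expands l ev A G) :
    Expands l ev' A' fun ω t => G (ρ ω) t := by
  obtain ⟨ι, idx, C, F, hF, hC, hexp⟩ := h
  exact ⟨ι, idx, fun i => Φ (C i), F, hF, fun i => hA _ (hC i), fun ω N => by
    simpa only [hev] using hexp (ρ ω) N⟩

/-- The member `t ^ n` of the scale for the sign `+`, `conj t ^ n` for the sign `-`. -/
def natIndex : Bool → ℕ → ScaleIndex
  | true, n => ⟨n, 0, 0, 0⟩
  | false, n => ⟨0, n, 0, 0⟩

theorem order_natIndex (s : Bool) (n : ℕ) : (natIndex s n).order = n := by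
  cases s <;> simp [natIndex, ScaleIndex.order]

theorem exp_nat_mul_log {t : ℂ} (ht : t ≠ 0) (n : ℕ) :
    Complex.exp (n * Complex.log t) = t ^ n := by
  rw [Complex.exp_nat_mul, Complex.exp_log ht]

theorem toFun_natIndex (s : Bool) (n : ℕ) {t : ℂ} (ht : t ≠ 0) :
    (natIndex s n).toFun t = conjSign s (t ^ n) := by
  cases s
  · simp only [natIndex, ScaleIndex.toFun, conjSign, zero_mul, zero_add, pow_zero, mul_one]
    rw [← exp_nat_mul_log ht, ← Complex.exp_conj, map_mul, Complex.conj_natCast]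
  · simp only [natIndex, ScaleIndex.toFun, conjSign, zero_mul, add_zero, pow_zero, mul_one]
    rw [exp_nat_mul_log ht]
    rfl

theorem norm_conjSign (s : Bool) (z : ℂ) : ‖conjSign s z‖ = ‖z‖ := by
  cases s
  · exact Complex.norm_conj z
  · rfl

theorem analyticAt_taylor {f : ℂ → ℂ} (hf : AnalyticAt ℂ f 0) (n : ℕ) :
    (fun t => f t - ∑ k ∈ Finset.range n, t ^ k * (iteratedDeriv k f 0 / k.factorial)) =O[𝓝 0]
      fun t => ‖t‖ ^ n := by
  have h := hf.hasFPowerSeriesAt.isBigO_sub_partialSum_pow n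
  simp only [zero_add] at h
  refine h.congr_left fun t => ?_
  congr 1
  simp only [FormalMultilinearSeries.partialSum, FormalMultilinearSeries.ofScalars_apply_eq]
  refine Finset.sum_congr rfl fun k _ => ?_
  simp [div_eq_mul_inv, mul_comm]

/-- Taylor's formula as an expansion in the scale. -/
theorem Expands.analytic (hl : l ≤ 𝓝[≠] 0) (s : Bool) {f : Ω → ℂ → ℂ}
    (hf : ∀ ω, AnalyticAt ℂ (f ω) 0) {c : ℕ → R} (hc : ∀ n, c n ∈ A)
    (hcf : ∀ ω n, ev ω (c n) = conjSign s (iteratedDeriv n (f ω) 0)) :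
    Expands l ev A fun ω t => conjSign s (f ω t) := by
  have hF : ∀ (N : ℝ) (n : ℕ), n ∈ (if 0 ≤ N then Finset.range (⌊N⌋₊ + 1) else ∅) ↔
      (natIndex s n).order ≤ N := by
    intro N n
    rw [order_natIndex]
    split_ifs with h
    · rw [Finset.mem_range, Nat.lt_succ_iff, Nat.le_floor_iff h]
    · simp only [Finset.notMem_empty, false_iff, not_le]
      exact (not_le.1 h).trans_le n.cast_nonneg
  refine ⟨ℕ, natIndex s, fun n => (1 / n.factorial : ℂ) • c n,
    fun N => if 0 ≤ N then Finset.range (⌊N⌋₊ + 1) else ∅, hF, fun n => A.smul_mem (hc n) _,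
    fun ω N => remainder_of_le hl (N' := max N 0) hF (le_max_left _ _) ?_⟩
  rw [if_pos (le_max_right _ _)]
  set k := ⌊max N 0⌋₊ + 1 with hk
  have hlt : N < (k : ℝ) := by
    rw [hk]
    push_cast
    exact (le_max_left N 0).trans_lt (Nat.lt_floor_add_one _)
  have h1 := ((analyticAt_taylor (hf ω) k).mono (nhdsWithin_le_nhds (s := {0}ᶜ))).mono hl
  have h2 : (fun t : ℂ => ‖t‖ ^ k) =o[l] fun t => ‖t‖ ^ N := by
    have h3 := (((natIndex true k).toFun_isLittleO (N := N)
      (by rwa [order_natIndex])).mono hl).norm_left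
    refine h3.congr' ?_ EventuallyEq.rfl
    filter_upwards [hl self_mem_nhdsWithin] with t ht
    rw [toFun_natIndex true k ht, norm_conjSign, norm_pow]
  have h3 := h1.trans_isLittleO h2
  refine (isLittleO_norm_left.1 (h3.norm_left.congr' ?_ EventuallyEq.rfl))
  filter_upwards [hl self_mem_nhdsWithin] with t ht
  rw [← norm_conjSign s, map_sub, map_sum]
  congr 2
  refine Finset.sum_congr rfl fun n _ => ?_
  rw [toFun_natIndex s n ht, map_smul, hcf, map_mul, map_div₀, map_natCast, smul_eq_mul]
  ring

end Expands

/-! ### Uniqueness of expansions -/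

/-- The operator `F ↦ F (· - 1)` on functions of a real variable. -/
def backShift : Module.End ℂ (ℝ → ℂ) := LinearMap.funLeft ℂ ℂ fun s => s - 1

theorem backShift_apply (F : ℝ → ℂ) (s : ℝ) : backShift F s = F (s - 1) := rfl

/-- A function with limit zero at `-∞` that solves a linear recurrence, all of whose characteristic
roots have modulus at least one, vanishes. -/
theorem eq_zero_of_recurrence (l : List ℂ) (hl : ∀ μ ∈ l, 1 ≤ ‖μ‖) {F : ℝ → ℂ}
    (hF : Tendsto F atBot (𝓝 0))
    (h : Polynomial.aeval backShift (l.map fun μ => Polynomial.X - Polynomial.C μ).prod F = 0) :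
    F = 0 := by
  induction l using List.reverseRecOn generalizing F with
  | nil => simpa using h
  | append_singleton l μ ih =>
    rw [List.map_append, List.prod_append, map_mul, Module.End.mul_apply] at h
    simp only [List.map_cons, List.map_nil, List.prod_singleton, map_sub, Polynomial.aeval_X,
      Polynomial.aeval_C, Algebra.algebraMap_eq_smul_one] at h
    have hsub : Tendsto (fun s : ℝ => s - 1) atBot atBot :=
      tendsto_atBot_add_const_right _ _ tendsto_id
    have h0 : (backShift - μ • (1 : Module.End ℂ (ℝ → ℂ))) F = 0 := by
      refine ih (fun ν hν => hl ν (by simp [hν])) ?_ h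
      have h1 : Tendsto (fun s => F (s - 1) - μ * F s) atBot (𝓝 (0 - μ * 0)) :=
        (hF.comp hsub).sub (hF.const_mul μ)
      simp only [mul_zero, sub_zero] at h1
      exact h1
    have hrec : ∀ s, F (s - 1) = μ * F s := fun s => by
      have := congrFun h0 s
      simpa [backShift_apply, sub_eq_zero] using this
    have hμ : 1 ≤ ‖μ‖ := hl μ (by simp)
    have hn : ∀ (n : ℕ) (s : ℝ), ‖F s‖ ≤ ‖F (s - n)‖ := by
      intro n
      induction n with
      | zero => intro s; simp
      | succ n ihn =>
        intro s
        have h2 : F (s - (n + 1 : ℕ)) = μ * F (s - n) := by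
          rw [← hrec]; push_cast; congr 1; ring
        rw [h2, norm_mul]
        calc ‖F s‖ ≤ ‖F (s - n)‖ := ihn s
          _ ≤ ‖μ‖ * ‖F (s - n)‖ := le_mul_of_one_le_left (norm_nonneg _) hμ
    funext s
    have hs : Tendsto (fun n : ℕ => s - n) atTop atBot := by
      simpa [sub_eq_add_neg] using
        tendsto_atBot_add_const_left _ s (tendsto_neg_atTop_atBot.comp tendsto_natCast_atTop_atTop)
    have h3 : Tendsto (fun n : ℕ => ‖F (s - n)‖) atTop (𝓝 0) := by
      simpa using (hF.comp hs).norm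
    exact norm_le_zero_iff.1 (ge_of_tendsto' h3 fun n => hn n s)

/-- The entire function of `(u, v)` whose values at `u = log t`, `v = conj (log t)` are those of a
member of the scale. -/
def ScaleIndex.entire (I : ScaleIndex) (u v : ℂ) : ℂ :=
  Complex.exp (I.pow * u + I.powConj * v) * u ^ I.log * v ^ I.logConj

/-- The function on a ray of a member of the scale, divided by `‖t‖ ^ N`, is annihilated by a power
of `T - μ`. -/
theorem ScaleIndex.annihilated (I : ScaleIndex) (N θ : ℝ) :
    ((backShift - Complex.exp (-(I.pow + I.powConj - N)) • (1 : Module.End ℂ (ℝ → ℂ))) ^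
      (1 + I.logConj + I.log)) (fun s : ℝ => Complex.exp (-N * s) *
        I.entire (s + θ * Complex.I) (s - θ * Complex.I)) = 0 := by
  have h1 : ((backShift - Complex.exp (-(I.pow + I.powConj - N)) •
      (1 : Module.End ℂ (ℝ → ℂ))) ^ 1) (fun s : ℝ => Complex.exp (-N * s +
        (I.pow * (s + θ * Complex.I) + I.powConj * (s - θ * Complex.I)))) = 0 := by
    rw [pow_one]
    funext s
    simp only [LinearMap.sub_apply, LinearMap.smul_apply, Module.End.one_apply, Pi.sub_apply,
      Pi.smul_apply, backShift_apply, smul_eq_mul, Pi.zero_apply, ← Complex.exp_add]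
    rw [sub_eq_zero]
    congr 1
    push_cast
    ring
  have hmul : ∀ (σ : ℂ) (n k : ℕ) (F : ℝ → ℂ), ((backShift -
      Complex.exp (-(I.pow + I.powConj - N)) • (1 : Module.End ℂ (ℝ → ℂ))) ^ k) F = 0 →
      ((backShift - Complex.exp (-(I.pow + I.powConj - N)) •
        (1 : Module.End ℂ (ℝ → ℂ))) ^ (k + n)) ((fun s : ℝ => ((s : ℂ) + σ) ^ n) * F) = 0 := by
    intro σ n k F hF
    induction n with
    | zero =>
      simp only [pow_zero]
      exact (congrArg _ (one_mul F)).trans hF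
    | succ n ih =>
      have := pow_coord_mul_eq_zero (T := backShift) (x := fun s : ℝ => (s : ℂ) + σ) (c := -1)
        (fun F => by funext s; simp [backShift_apply]; ring) _ _ ih
      rw [← add_assoc]
      refine Eq.trans (congrArg _ ?_) this
      funext s
      simp only [Pi.mul_apply]
      ring
  have h2 := hmul (θ * Complex.I) I.log _ _ (hmul (-(θ * Complex.I)) I.logConj 1 _ h1)
  refine Eq.trans (congrArg _ ?_) h2
  funext s
  simp only [Pi.mul_apply, ScaleIndex.entire, Complex.exp_add, sub_eq_add_neg]
  ring

theorem eq_zero_of_real_interval {f : ℂ → ℂ} (hf : Differentiable ℂ f) {a b : ℝ} (hab : a < b)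
    (h : ∀ x : ℝ, a < x → x < b → f x = 0) (z : ℂ) : f z = 0 := by
  obtain ⟨c, hac, hcb⟩ := exists_between hab
  have han : AnalyticOnNhd ℂ f Set.univ := fun z _ => hf.analyticAt z
  have hfr : ∃ᶠ z in 𝓝[≠] (c : ℂ), f z = 0 := by
    have ht : Tendsto (fun x : ℝ => (x : ℂ)) (𝓝[≠] c) (𝓝[≠] (c : ℂ)) :=
      tendsto_nhdsWithin_of_tendsto_nhds_of_eventually_within _
        ((Complex.continuous_ofReal.tendsto c).mono_left nhdsWithin_le_nhds)
        (by filter_upwards [self_mem_nhdsWithin] with x hx using by simpa using hx)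
    refine ht.frequently (Eventually.frequently ?_)
    filter_upwards [nhdsWithin_le_nhds (Ioo_mem_nhds hac hcb)] with x hx using h x hx.1 hx.2
  exact han.eqOn_zero_of_preconnected_of_frequently_eq_zero isPreconnected_univ
    (Set.mem_univ _) hfr (Set.mem_univ z)

/-- The entire functions of the scale are exponential monomials in two variables. -/
theorem ScaleIndex.entire_independent (F : Finset ScaleIndex) (c : ScaleIndex → ℂ)
    (h : ∀ u v : ℂ, ∑ I ∈ F, I.entire u v * c I = 0) : ∀ I ∈ F, c I = 0 := by
  classical
  let lbl : ScaleIndex → (Bool →₀ ℕ) × (Bool →₀ ℂ) := fun I =>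
    (Finsupp.equivFunOnFinite.symm fun s => cond s I.log I.logConj,
      Finsupp.equivFunOnFinite.symm fun s => cond s I.pow I.powConj)
  have hinj : Function.Injective lbl := by
    intro I J hIJ
    have h1 := congrArg Prod.fst hIJ
    have h2 := congrArg Prod.snd hIJ
    refine ScaleIndex.ext' ?_ ?_ ?_ ?_
    · exact DFunLike.congr_fun h2 true
    · exact DFunLike.congr_fun h2 false
    · exact DFunLike.congr_fun h1 true
    · exact DFunLike.congr_fun h1 false
  have hval : ∀ I (j : Bool → ℂ), expMono (lbl I) j = I.entire (j true) (j false) := by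
    intro I j
    simp only [expMono, lbl, ScaleIndex.entire]
    rw [Finsupp.prod_fintype _ _ (by simp), Finsupp.sum_fintype _ _ (by simp)]
    simp
    ring
  have hind := expMono_independent (F.image lbl)
    (fun p => ∑ I ∈ F with lbl I = p, c I) fun j => by
      rw [Finset.sum_image fun I _ J _ e => hinj e]
      simp only [hinj.eq_iff, hval]
      refine Eq.trans (Finset.sum_congr rfl fun I hI => ?_) (h (j true) (j false))
      rw [Finset.filter_eq' F I, if_pos hI, Finset.sum_singleton, mul_comm]
  intro I hI
  have := hind _ (Finset.mem_image_of_mem lbl hI)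
  simp only [hinj.eq_iff] at this
  rwa [Finset.filter_eq' F I, if_pos hI, Finset.sum_singleton] at this

theorem approach_marked_le (k : Fin M.numMarks) : approach (.marked k : Pt M) ≤ 𝓝[≠] 0 := by
  rw [approach]
  split_ifs
  · exact nhdsWithin_mono _ fun t ht => by rintro rfl; simp at ht
  · exact nhdsWithin_mono _ fun t ht => Complex.slitPlane_ne_zero ht

/-- The rays in the open upper half-plane are admissible for interior and for boundary points. -/
theorem tendsto_ray (k : Fin M.numMarks) {θ : ℝ} (h0 : 0 < θ) (hπ : θ < Real.pi) :
    Tendsto (fun s : ℝ => Complex.exp (s + θ * Complex.I)) atBot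
      (approach (.marked k : Pt M)) := by
  have h1 : Tendsto (fun s : ℝ => Complex.exp (s + θ * Complex.I)) atBot (𝓝 0) := by
    rw [tendsto_zero_iff_norm_tendsto_zero]
    simpa [Complex.norm_exp] using Real.tendsto_exp_atBot
  have him : ∀ s : ℝ, 0 < (Complex.exp (s + θ * Complex.I)).im := by
    intro s
    rw [Complex.exp_im]
    simpa using mul_pos (Real.exp_pos s) (Real.sin_pos_of_pos_of_lt_pi h0 hπ)
  rw [approach]
  split_ifs
  · exact tendsto_nhdsWithin_iff.2 ⟨h1, Eventually.of_forall him⟩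
  · exact tendsto_nhdsWithin_iff.2 ⟨h1, Eventually.of_forall fun s => Or.inr (him s).ne'⟩

/-- A finite combination of members of the scale of order at most `N` is determined by its
behaviour up to `o(‖t‖ ^ N)`: along each ray, the functions divided by `‖t‖ ^ N` solve a
recurrence in `log ‖t‖` without decaying solutions. -/
theorem scale_unique (k : Fin M.numMarks) {N : ℝ} (F : Finset ScaleIndex)
    (hF : ∀ I ∈ F, I.order ≤ N) (c : ScaleIndex → ℂ)
    (h : (fun t => ∑ I ∈ F, I.toFun t * c I) =o[approach (.marked k : Pt M)] fun t => ‖t‖ ^ N) :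
    ∀ I ∈ F, c I = 0 := by
  classical
  refine ScaleIndex.entire_independent F c ?_
  -- the combination vanishes on rays, hence as an entire function of `log t` and its conjugate
  have hray : ∀ θ : ℝ, 0 < θ → θ < Real.pi → ∀ s : ℝ,
      ∑ I ∈ F, I.entire (s + θ * Complex.I) (s - θ * Complex.I) * c I = 0 := by
    intro θ h0 hπ
    have hval : ∀ (I : ScaleIndex) (s : ℝ), I.toFun (Complex.exp (s + θ * Complex.I)) =
        I.entire (s + θ * Complex.I) (s - θ * Complex.I) := by
      intro I s
      have hlog : Complex.log (Complex.exp (s + θ * Complex.I)) = s + θ * Complex.I :=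
        Complex.log_exp (by simp; linarith) (by simp; linarith)
      rw [ScaleIndex.toFun, hlog, ScaleIndex.entire]
      simp [sub_eq_add_neg]
    set Φ : ℝ → ℂ := fun s => ∑ I ∈ F, c I • (Complex.exp (-N * s) *
      I.entire (s + θ * Complex.I) (s - θ * Complex.I)) with hΦ
    have hlim : Tendsto Φ atBot (𝓝 0) := by
      have h1 := h.comp_tendsto (tendsto_ray k h0 hπ)
      rw [tendsto_zero_iff_norm_tendsto_zero]
      refine h1.norm_left.tendsto_div_nhds_zero.congr fun s => ?_
      simp only [Function.comp_apply, hΦ]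
      simp only [hval, smul_eq_mul]
      have hn : ‖Complex.exp (s + θ * Complex.I)‖ ^ N = ‖Complex.exp (N * s)‖ := by
        rw [Complex.norm_exp, Complex.norm_exp, Real.rpow_def_of_pos (Real.exp_pos _), Real.log_exp]
        simp [mul_comm]
      rw [hn, ← norm_div, Finset.sum_div]
      congr 1
      refine Finset.sum_congr rfl fun I _ => ?_
      rw [neg_mul, Complex.exp_neg]
      ring
    have hzero : Φ = 0 := by
      refine eq_zero_of_recurrence (F.toList.flatMap fun I => List.replicate
        (1 + I.logConj + I.log) (Complex.exp (-(I.pow + I.powConj - N)))) ?_ hlim ?_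
      · intro μ hμ
        obtain ⟨I, hI, hμI⟩ := List.mem_flatMap.1 hμ
        rw [(List.mem_replicate.1 hμI).2, Complex.norm_exp, Real.one_le_exp_iff]
        have := hF I (Finset.mem_toList.1 hI)
        simp only [ScaleIndex.order] at this
        simp at this ⊢
        linarith
      · have hprod : ((F.toList.flatMap fun I => List.replicate (1 + I.logConj + I.log)
            (Complex.exp (-(I.pow + I.powConj - N)))).map
              fun μ => Polynomial.X - Polynomial.C μ).prod =
            ∏ I ∈ F, (Polynomial.X - Polynomial.C (Complex.exp (-(I.pow + I.powConj - N)))) ^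
              (1 + I.logConj + I.log) := by
          rw [← Finset.prod_map_toList]
          induction F.toList with
          | nil => simp
          | cons I l ih =>
            rw [List.flatMap_cons, List.map_append, List.prod_append, ih, List.map_cons,
              List.prod_cons, List.map_replicate, List.prod_replicate]
        rw [hprod, hΦ]
        have hsum : (fun s : ℝ => ∑ I ∈ F, c I • (Complex.exp (-N * s) *
            I.entire (s + θ * Complex.I) (s - θ * Complex.I))) = ∑ I ∈ F, c I • fun s : ℝ =>
              (Complex.exp (-N * s) * I.entire (s + θ * Complex.I) (s - θ * Complex.I)) := by
          funext s
          simp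
        rw [hsum, map_sum]
        refine Finset.sum_eq_zero fun I hI => ?_
        rw [map_smul, ← Finset.prod_erase_mul _ _ hI, map_mul, Module.End.mul_apply, map_pow,
          map_sub, Polynomial.aeval_X, Polynomial.aeval_C, Algebra.algebraMap_eq_smul_one,
          I.annihilated N θ, map_zero, smul_zero]
    intro s
    have := congrFun hzero s
    simp only [hΦ, Pi.zero_apply, smul_eq_mul] at this
    rw [← mul_right_inj' (Complex.exp_ne_zero (-N * s)), mul_zero, ← this, Finset.mul_sum]
    exact Finset.sum_congr rfl fun I _ => by ring
  have hd : ∀ f g : ℂ → ℂ, Differentiable ℂ f → Differentiable ℂ g →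
      Differentiable ℂ fun z => ∑ I ∈ F, I.entire (f z) (g z) * c I := by
    intro f g hf hg
    unfold ScaleIndex.entire
    fun_prop
  have hθ : ∀ (s : ℝ) (θ : ℂ),
      ∑ I ∈ F, I.entire (s + θ * Complex.I) (s - θ * Complex.I) * c I = 0 := fun s =>
    eq_zero_of_real_interval (hd _ _ (by fun_prop) (by fun_prop)) Real.pi_pos
      fun θ h0 hπ => hray θ h0 hπ s
  have hs : ∀ s θ : ℂ,
      ∑ I ∈ F, I.entire (s + θ * Complex.I) (s - θ * Complex.I) * c I = 0 := fun s θ =>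
    eq_zero_of_real_interval (f := fun s =>
      ∑ I ∈ F, I.entire (s + θ * Complex.I) (s - θ * Complex.I) * c I)
      (hd _ _ (by fun_prop) (by fun_prop)) zero_lt_one (fun s _ _ => hθ s θ) s
  intro u v
  have := hs ((u + v) / 2) ((u - v) / (2 * Complex.I))
  have h1 : (u + v) / 2 + (u - v) / (2 * Complex.I) * Complex.I = u := by
    field_simp; ring
  have h2 : (u + v) / 2 - (u - v) / (2 * Complex.I) * Complex.I = v := by
    field_simp; ring
  rwa [h1, h2] at this

/-! ### Nodes close to a marked point -/

/-- The position in the disc of a point near a marked point, as a function of the difference of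
coordinates. -/
def markDisc (k : Fin M.numMarks) (r : ℂ) : ℂ :=
  (M.chart (M.markChart k)).disc (M.markCoord k + r)

theorem markDisc_zero (k : Fin M.numMarks) : markDisc k 0 = M.mark k := by
  simp [markDisc, M.disc_markCoord]

theorem analyticAt_markDisc (k : Fin M.numMarks) : AnalyticAt ℂ (markDisc k) 0 :=
  AnalyticAt.fun_comp (g := (M.chart (M.markChart k)).disc) (by
    simpa using (M.chart (M.markChart k)).analyticAt_disc (M.markCoord_mem k))
    (analyticAt_const.add analyticAt_id)

theorem eventually_norm_markDisc (k : Fin M.numMarks) :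
    ∀ᶠ t in approach (.marked k : Pt M), ‖markDisc k t‖ < 1 := by
  rw [approach]
  have ht : Tendsto (fun t : ℂ => M.markCoord k + t) (𝓝 0) (𝓝 (M.markCoord k)) := by
    simpa using (continuous_const_add (M.markCoord k)).tendsto 0
  split_ifs with h1
  · filter_upwards [nhdsWithin_le_nhds (ht.eventually (M.boundary_chart k h1)),
      self_mem_nhdsWithin] with t h2 h3
    refine mem_ball_zero_iff.1 (h2.2 ?_)
    rw [Complex.add_im, M.markCoord_im k h1, zero_add]
    exact h3
  · refine nhdsWithin_le_nhds ((analyticAt_markDisc k).continuousAt.norm.eventually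
      (gt_mem_nhds ?_))
    change ‖markDisc k 0‖ < 1
    rw [markDisc_zero]
    exact lt_of_le_of_ne (M.norm_mark_le k) h1

namespace State

variable {S : Finset (Pt M)} {st : State M} {x y : Pt M} {k : Fin M.numMarks}

theorem pos_collide_self (h : x.chart = y.chart) (t : ℂ) :
    (st.collide x y t).pos x = y.chart.disc (st.coord y + t) := by
  simp [pos, collide, h]

theorem pos_collide_of_ne {z : Pt M} (hz : z ≠ x) (t : ℂ) :
    (st.collide x y t).pos z = st.pos z := by
  simp [pos, collide, hz]

theorem Valid.mono {T : Finset (Pt M)} (hst : st.Valid S) (h : T ⊆ S) : st.Valid T where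
  coord_marked := hst.coord_marked
  coord_mem z hz := hst.coord_mem z (h hz)
  pos_mem z hz := hst.pos_mem z (h hz)
  pos_ne z hz w hw := hst.pos_ne z (Finset.union_subset_union_left h hz) w
    (Finset.union_subset_union_left h hw)
  exp_logDeriv z hz := hst.exp_logDeriv z (Finset.union_subset_union_left h hz)
  exp_logDiff z hz w hw := hst.exp_logDiff z (Finset.union_subset_union_left h hz) w
    (Finset.union_subset_union_left h hw)

/-- The position of a node which approaches a marked point. -/
theorem Valid.tendsto_disc (hst : st.Valid S) (hy : y ∈ S ∪ marks M) :
    Tendsto (fun t : ℂ => y.chart.disc (st.coord y + t)) (𝓝 0) (𝓝 (st.pos y)) := by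
  have h := (hst.analyticAt_disc_add hy).continuousAt.tendsto
  simp only [add_zero] at h
  exact h

theorem Valid.eventually_source (hst : st.Valid S) (hy : y ∈ S ∪ marks M) :
    ∀ᶠ t in 𝓝 (0 : ℂ), st.coord y + t ∈ y.chart.source := by
  have h : Tendsto (fun t : ℂ => st.coord y + t) (𝓝 0) (𝓝 (st.coord y)) := by
    simpa using (continuous_const_add (st.coord y)).tendsto 0
  exact h.eventually (y.chart.isOpen_source.mem_nhds (hst.coord_mem' hy))

theorem Valid.eventually_disc_ne (hst : st.Valid S) (hy : y ∈ S ∪ marks M) :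
    ∀ᶠ t in 𝓝[≠] (0 : ℂ), y.chart.disc (st.coord y + t) ≠ st.pos y := by
  filter_upwards [nhdsWithin_le_nhds (hst.eventually_source hy), self_mem_nhdsWithin]
    with t h1 h2 h3
  have := y.chart.injOn_disc h1 (hst.coord_mem' hy) h3
  exact h2 (by simpa using this)

theorem Valid.eventually_deriv_ne (hst : st.Valid S) (hy : y ∈ S ∪ marks M) :
    ∀ᶠ t in 𝓝 (0 : ℂ), deriv y.chart.disc (st.coord y + t) ≠ 0 := by
  have h : Tendsto (fun t : ℂ => st.coord y + t) (𝓝 0) (𝓝 (st.coord y)) := by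
    simpa using (continuous_const_add (st.coord y)).tendsto 0
  exact h.eventually ((y.chart.analyticAt_disc (hst.coord_mem' hy)).deriv.continuousAt.eventually_ne
    (hst.deriv_ne_zero hy))

/-- A node close enough to a marked point, with the logarithms continued, gives a valid state. -/
theorem Valid.collide (hst : st.Valid (S.erase x)) (hn : x.IsNode)
    (hch : x.chartIndex = (Pt.marked k).chartIndex) :
    ∀ᶠ t in approach (.marked k : Pt M), (st.collide x (.marked k) t).Valid S := by
  have hchart := chart_eq_of_chartIndex_eq hch
  have hxm := hn.ne_marked k
  have hxk : x ∉ marks M := by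
    intro h
    obtain ⟨j, _, rfl⟩ := Finset.mem_image.1 h
    exact hn
  have hy : Pt.marked k ∈ S.erase x ∪ marks M := Finset.mem_union_right _ (mark_mem_marks k)
  have hold : ∀ z ∈ S ∪ marks M, z ≠ x → z ∈ S.erase x ∪ marks M := by
    intro z hz hne
    rcases Finset.mem_union.1 hz with h | h
    · exact Finset.mem_union_left _ (Finset.mem_erase.2 ⟨hne, h⟩)
    · exact Finset.mem_union_right _ h
  have hne' : ∀ᶠ t in 𝓝 (0 : ℂ), ∀ w ∈ S.erase x ∪ marks M, w ≠ .marked k →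
      (Pt.marked k).chart.disc (st.coord (.marked k) + t) ≠ st.pos w := by
    rw [Filter.eventually_all_finset]
    intro w hw
    by_cases hwk : w = .marked k
    · exact Eventually.of_forall fun _ h => absurd hwk h
    · filter_upwards [(hst.tendsto_disc hy).eventually_ne
        (hst.pos_ne _ hy w hw (Ne.symm hwk))] with t ht _ using ht
  filter_upwards [eventually_norm_markDisc k, approach_le _ (hst.eventually_source hy),
    approach_marked_le k (hst.eventually_disc_ne hy), approach_le _ (hst.eventually_deriv_ne hy),
    approach_le _ hne', approach_marked_le k self_mem_nhdsWithin]
    with t hnorm hsrc hdne hder hwne ht0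
  have hpne : ∀ w ∈ S ∪ marks M, w ≠ x →
      (Pt.marked k).chart.disc (st.coord (.marked k) + t) ≠ st.pos w := by
    intro w hw hwx
    by_cases hwk : w = .marked k
    · rw [hwk]; exact hdne
    · exact hwne w (hold w hw hwx) hwk
  have hl : Complex.exp (Complex.log t + st.logDeriv (.marked k) + Complex.log
      (((Pt.marked k).chart.disc (st.coord (.marked k) + t) - st.pos (.marked k)) /
        (t * deriv (Pt.marked k).chart.disc (st.coord (.marked k))))) =
      (Pt.marked k).chart.disc (st.coord (.marked k) + t) - st.pos (.marked k) := by
    have hd0 := hst.deriv_ne_zero hy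
    have ht0' : t ≠ 0 := ht0
    rw [Complex.exp_add, Complex.exp_add, Complex.exp_log ht0',
      hst.exp_logDeriv _ hy, Complex.exp_log (div_ne_zero (sub_ne_zero.2 hdne)
        (mul_ne_zero ht0' hd0))]
    field_simp
  refine ⟨hst.marksFixed.collide hn _ t, ?_, ?_, ?_, ?_, ?_⟩
  · intro z hz
    rcases eq_or_ne z x with rfl | hzx
    · simpa [State.collide, hchart] using hsrc
    · simpa [State.collide, hzx] using hst.coord_mem z (Finset.mem_erase.2 ⟨hzx, hz⟩)
  · intro z hz hzn
    rcases eq_or_ne z x with rfl | hzx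
    · rw [pos_collide_self hchart]
      rw [hst.coord_marked]
      exact mem_ball_zero_iff.2 hnorm
    · rw [pos_collide_of_ne hzx]
      exact hst.pos_mem z (Finset.mem_erase.2 ⟨hzx, hz⟩) hzn
  · intro z hz w hw hzw
    rcases eq_or_ne z x with rfl | hzx
    · rw [pos_collide_self hchart, pos_collide_of_ne hzw.symm]
      exact hpne w hw hzw.symm
    · rw [pos_collide_of_ne hzx]
      rcases eq_or_ne w x with rfl | hwx
      · rw [pos_collide_self hchart]
        exact (hpne z hz hzx).symm
      · rw [pos_collide_of_ne hwx]
        exact hst.pos_ne z (hold z hz hzx) w (hold w hw hwx) hzw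
  · intro z hz
    rcases eq_or_ne z x with rfl | hzx
    · have hd0 := hst.deriv_ne_zero hy
      simp only [State.collide, Function.update_self, hchart]
      rw [Complex.exp_add, hst.exp_logDeriv _ hy, Complex.exp_log (div_ne_zero hder hd0)]
      field_simp
    · simpa [State.collide, hzx] using hst.exp_logDeriv z (hold z hz hzx)
  · intro z hz w hw hzw
    rcases eq_or_ne z x with rfl | hzx
    · rw [pos_collide_self hchart, pos_collide_of_ne hzw.symm]
      rcases eq_or_ne w (.marked k) with rfl | hwk
      · simpa [State.collide, hxm.symm] using hl
      · simp only [State.collide, hzw.symm, and_false, if_false, hwk, hxm, if_true]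
        rw [Complex.exp_add, hst.exp_logDiff _ hy w (hold w hw hzw.symm) hwk.symm,
          Complex.exp_log (div_ne_zero (sub_ne_zero.2 (hpne w hw hzw.symm))
            (sub_ne_zero.2 (hst.pos_ne _ hy w (hold w hw hzw.symm) hwk.symm)))]
        have := sub_ne_zero.2 (hst.pos_ne _ hy w (hold w hw hzw.symm) hwk.symm)
        field_simp
    · rw [pos_collide_of_ne hzx]
      rcases eq_or_ne w x with rfl | hwx
      · rw [pos_collide_self hchart]
        rcases eq_or_ne z (.marked k) with rfl | hzk
        · simp only [State.collide, hzx, if_false, false_and, if_true, and_self]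
          rw [Complex.exp_add, hl, Complex.exp_pi_mul_I]
          ring
        · simp only [State.collide, hzx, hzk, if_false, false_and, if_true]
          have h0 := sub_ne_zero.2 (hst.pos_ne z (hold z hz hzx) _ hy hzk)
          rw [Complex.exp_add, hst.exp_logDiff z (hold z hz hzx) _ hy hzk,
            Complex.exp_log (div_ne_zero (sub_ne_zero.2 (hpne z hz hzx).symm) h0)]
          field_simp
      · rw [pos_collide_of_ne hwx]
        simpa [State.collide, hzx, hwx] using
          hst.exp_logDiff z (hold z hz hzx) w (hold w hw hwx) hzw

end State

/-! ### Functions with iterated expansions at the marked points -/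

/-- The evaluation of non-random functions at the valid states with nodes `S`. -/
def evState (S : Finset (Pt M)) (st : {st : State M // st.Valid S}) : Coeff M →ₐ[ℂ] ℂ :=
  Pi.evalAlgHom ℂ (fun _ => ℂ) st.1

theorem evState_apply {S : Finset (Pt M)} (st : {st : State M // st.Valid S}) (f : Coeff M) :
    evState S st f = f st.1 := rfl

/-- The functions of the points of `S` that have expansions as the nodes in the list `L` tend to
marked points, whose coefficients have expansions as the next nodes tend to marked points, and so
on. -/
def iterAlg : Punctures M → Finset (Pt M) → Subalgebra ℂ (Coeff M)
  | [], S => localAlg S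
  | (x, k) :: L, S =>
    { carrier := {f | f ∈ localAlg S ∧ Expands (approach (.marked k : Pt M)) (evState (S.erase x))
        (iterAlg L (S.erase x)) fun st t => f (st.1.collide x (.marked k) t)}
      mul_mem' := fun hf hg =>
        ⟨Subalgebra.mul_mem _ hf.1 hg.1, hf.2.mul (approach_marked_le k) hg.2⟩
      add_mem' := fun hf hg => ⟨Subalgebra.add_mem _ hf.1 hg.1, hf.2.add hg.2⟩
      algebraMap_mem' := fun c => ⟨Subalgebra.algebraMap_mem _ c,
        (Expands.const (approach_marked_le k) (Subalgebra.algebraMap_mem _ c)).congr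
          fun _ => EventuallyEq.rfl⟩ }

theorem iterAlg_le_localAlg (L : Punctures M) (S : Finset (Pt M)) : iterAlg L S ≤ localAlg S := by
  rcases L with _ | ⟨⟨x, k⟩, L⟩
  · exact le_rfl
  · exact fun f hf => hf.1

/-- The operations of `L` can be performed in order on functions with nodes `S`. -/
def Admissible : Punctures M → Finset (Pt M) → Prop
  | [], _ => True
  | (x, k) :: L, S => x ∈ S ∧ x.chartIndex = (Pt.marked k).chartIndex ∧ Admissible L (S.erase x)

/-- A function of points that no operation moves. -/
theorem mem_iterAlg_of_fixed {T : Finset (Pt M)} {f : Coeff M} (hf : f ∈ localAlg T)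
    (L : Punctures M) {S : Finset (Pt M)} (hS : ∀ x ∈ S, x.IsNode) (hT : T ⊆ S ∪ marks M)
    (hL : ∀ o ∈ L, o.1 ∉ T) (hadm : Admissible L S) : f ∈ iterAlg L S := by
  have hloc : ∀ S : Finset (Pt M), T ⊆ S ∪ marks M → f ∈ localAlg S := fun S hT => by
    rw [← localAlg_union_marks]
    exact localAlg_mono hT hf
  induction L generalizing S with
  | nil => exact hloc S hT
  | cons o L ih =>
    obtain ⟨x, k⟩ := o
    obtain ⟨hx, -, hadm⟩ := hadm
    have hxT : x ∉ T := hL (x, k) (by simp)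
    have hxm : x ∉ marks M := fun h => by
      obtain ⟨j, _, rfl⟩ := Finset.mem_image.1 h
      exact hS _ hx
    have hT' : T ⊆ S.erase x ∪ marks M := by
      intro z hz
      rcases Finset.mem_union.1 (hT hz) with h | h
      · exact Finset.mem_union_left _ (Finset.mem_erase.2 ⟨fun e => hxT (e ▸ hz), h⟩)
      · exact Finset.mem_union_right _ h
    refine ⟨hloc S hT, (Expands.const (approach_marked_le k)
      (ih (fun z hz => hS z (Finset.mem_of_mem_erase hz)) hT'
        (fun o ho => hL o (by simp [ho])) hadm)).congr
        fun st => Eventually.of_forall fun t => hf _ _ ?_⟩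
    have hz : ∀ z ∈ T ∪ marks M, z ≠ x := by
      rintro z hz rfl
      rcases Finset.mem_union.1 hz with h | h
      · exact hxT h
      · exact hxm h
    refine ⟨fun z hz' => ?_, fun z hz' w hw => ?_⟩
    · simp [State.collide, hz z hz']
    · simp [State.collide, hz z hz', hz w hw]

/-! ### The direct and the mirror logarithm at a marked point -/

theorem eventually_slitPlane (k : Fin M.numMarks) :
    ∀ᶠ t in approach (.marked k : Pt M), t ∈ Complex.slitPlane := by
  rw [approach]
  split_ifs
  · filter_upwards [self_mem_nhdsWithin] with t ht
    exact Or.inr (ne_of_gt ht)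
  · exact self_mem_nhdsWithin

/-- The region of approach to a marked point is open. -/
theorem eventually_approach_nhds {k : Fin M.numMarks} {P : ℂ → Prop}
    (h : ∀ᶠ t in approach (.marked k : Pt M), P t) :
    ∀ᶠ t in approach (.marked k : Pt M), ∀ᶠ r in 𝓝 t, P r := by
  have key : ∀ U : Set ℂ, IsOpen U → (∀ᶠ t in 𝓝[U] (0 : ℂ), P t) →
      ∀ᶠ t in 𝓝[U] (0 : ℂ), ∀ᶠ r in 𝓝 t, P r := by
    intro U hU hP
    filter_upwards [eventually_eventually_nhdsWithin.2 hP, self_mem_nhdsWithin] with t ht htU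
    rwa [hU.nhdsWithin_eq htU] at ht
  rw [approach] at h ⊢
  split_ifs at h ⊢
  · exact key _ (isOpen_lt continuous_const Complex.continuous_im) h
  · exact key _ Complex.isOpen_slitPlane h

/-- The function `t ^ c (log t) ^ n` for the sign `+`, its conjugate for the sign `-`. -/
def signIndex : Bool → ℂ → ℕ → ScaleIndex
  | true, c, n => ⟨c, 0, n, 0⟩
  | false, c, n => ⟨0, starRingEnd ℂ c, 0, n⟩

theorem toFun_signIndex (s : Bool) (c : ℂ) (n : ℕ) (t : ℂ) : (signIndex s c n).toFun t =
    conjSign s (Complex.exp (c * Complex.log t) * Complex.log t ^ n) := by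
  cases s
  · simp only [signIndex, ScaleIndex.toFun, conjSign, zero_mul, zero_add, pow_zero, mul_one]
    rw [map_mul, ← Complex.exp_conj, map_mul, map_pow]
  · simp [signIndex, ScaleIndex.toFun, conjSign]

theorem State.Valid.deriv_markDisc {S : Finset (Pt M)} {st : State M} (hst : st.Valid S)
    (k : Fin M.numMarks) : deriv (markDisc k) 0 =
      deriv (Pt.marked k).chart.disc (st.coord (.marked k)) := by
  have : markDisc k = fun r => (M.chart (M.markChart k)).disc (M.markCoord k + r) := rfl
  rw [this, deriv_comp_const_add, hst.coord_marked, add_zero]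
  rfl

theorem State.Valid.deriv_markDisc_ne_zero {S : Finset (Pt M)} {st : State M} (hst : st.Valid S)
    (k : Fin M.numMarks) : deriv (markDisc k) 0 ≠ 0 := by
  rw [hst.deriv_markDisc]
  exact hst.deriv_ne_zero (Finset.mem_union_right _ (mark_mem_marks k))

/-- The quotient `(w - w q_k) / (t w' q_k)`. -/
def relSlope (k : Fin M.numMarks) (r : ℂ) : ℂ :=
  dslope (markDisc k) 0 r / deriv (markDisc k) 0

theorem relSlope_of_ne (k : Fin M.numMarks) {r : ℂ} (hr : r ≠ 0) :
    relSlope k r = (markDisc k r - M.mark k) / (r * deriv (markDisc k) 0) := by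
  rw [relSlope, dslope_of_ne _ hr, slope_def_field, markDisc_zero, sub_zero, div_div]

theorem relSlope_zero (k : Fin M.numMarks) (hd : deriv (markDisc k) 0 ≠ 0) : relSlope k 0 = 1 := by
  rw [relSlope, dslope_same, div_self hd]

theorem analyticAt_relSlope (k : Fin M.numMarks) : AnalyticAt ℂ (relSlope k) 0 := by
  have h : AnalyticAt ℂ (dslope (markDisc k) 0) 0 := by
    obtain ⟨p, hp⟩ := analyticAt_markDisc k
    exact ⟨_, hp.has_fpower_series_dslope_fslope⟩
  exact h.div_const

theorem analyticAt_log_relSlope (k : Fin M.numMarks) (hd : deriv (markDisc k) 0 ≠ 0) :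
    AnalyticAt ℂ (fun r => Complex.log (relSlope k r)) 0 :=
  (analyticAt_relSlope k).clog (by simp [relSlope_zero k hd])

/-- At a marked boundary point the interior is the upper half-plane of the boundary chart, so the
direction `w' q_k` is `i w q_k`, up to a positive factor. -/
theorem boundary_direction (k : Fin M.numMarks) (h1 : ‖M.mark k‖ = 1)
    (hd : deriv (markDisc k) 0 ≠ 0) :
    (-starRingEnd ℂ (M.mark k) * deriv (markDisc k) 0).re = 0 ∧
      (-starRingEnd ℂ (M.mark k) * deriv (markDisc k) 0).im < 0 := by
  set c := -starRingEnd ℂ (M.mark k) * deriv (markDisc k) 0 with hc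
  have hq : M.mark k * starRingEnd ℂ (M.mark k) = 1 := by
    rw [Complex.mul_conj, Complex.normSq_eq_norm_sq, h1]; simp
  have hnn : ∀ e : ℂ, 0 < e.im → 0 ≤ (e * c).re := by
    intro e he
    have ht : Tendsto (fun ε : ℝ => (ε : ℂ) * e) (𝓝[>] 0) (approach (.marked k : Pt M)) := by
      rw [approach, if_pos h1]
      refine tendsto_nhdsWithin_iff.2 ⟨?_, ?_⟩
      · have : Tendsto (fun ε : ℝ => (ε : ℂ) * e) (𝓝 0) (𝓝 (((0 : ℝ) : ℂ) * e)) :=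
          (Complex.continuous_ofReal.mul continuous_const).tendsto 0
        rw [Complex.ofReal_zero, zero_mul] at this
        exact this.mono_left nhdsWithin_le_nhds
      · filter_upwards [self_mem_nhdsWithin] with ε hε
        simpa using mul_pos hε he
    have hlim : Tendsto (fun ε : ℝ => (e * c * relSlope k (ε * e)).re) (𝓝[>] 0)
        (𝓝 (e * c).re) := by
      have h0 := (analyticAt_relSlope k).continuousAt.tendsto.comp
        (ht.mono_right (approach_le _))
      rw [relSlope_zero k hd] at h0
      have := (Complex.continuous_re.tendsto _).comp (h0.const_mul (e * c))
      rw [mul_one] at this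
      exact this
    refine ge_of_tendsto hlim ?_
    filter_upwards [ht.eventually (eventually_norm_markDisc k),
      ht.eventually (approach_marked_le k self_mem_nhdsWithin), self_mem_nhdsWithin]
      with ε hn hne hε
    have hid : (ε : ℂ) * (e * c * relSlope k (ε * e)) =
        1 - markDisc k (ε * e) * starRingEnd ℂ (M.mark k) := by
      rw [relSlope_of_ne k hne, hc]
      have : (ε : ℂ) * e ≠ 0 := hne
      have hε' := left_ne_zero_of_mul this
      have he' := right_ne_zero_of_mul this
      field_simp
      linear_combination hq
    have hre : 0 < ((ε : ℂ) * (e * c * relSlope k (ε * e))).re := by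
      rw [hid]
      have h2 : ‖markDisc k (ε * e) * starRingEnd ℂ (M.mark k)‖ < 1 := by
        rw [norm_mul, Complex.norm_conj, h1, mul_one]; exact hn
      have := (abs_lt.1 ((Complex.abs_re_le_norm _).trans_lt h2)).2
      simpa using this
    rw [Complex.re_ofReal_mul] at hre
    exact (pos_of_mul_pos_right hre (le_of_lt hε)).le
  have hc0 : c ≠ 0 := by
    refine mul_ne_zero (neg_ne_zero.2 fun h => ?_) hd
    rw [h, mul_zero] at hq
    exact zero_ne_one hq
  have hx : ∀ x : ℝ, 0 ≤ x * c.re - c.im := fun x => by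
    simpa using hnn (x + Complex.I) (by simp)
  have hre : c.re = 0 := by
    by_contra hne
    have := hx ((c.im - 1) / c.re)
    rw [div_mul_cancel₀ _ hne] at this
    linarith
  refine ⟨hre, lt_of_le_of_ne (by simpa using hx 0) fun h => hc0 (Complex.ext hre h)⟩

/-- Near a marked boundary point, the mirror term of the potential has the same logarithmic
singularity as the direct term. -/
theorem log_mirror_boundary (k : Fin M.numMarks) (h1 : ‖M.mark k‖ = 1)
    (hd : deriv (markDisc k) 0 ≠ 0) : ∀ᶠ t in approach (.marked k : Pt M),
      Complex.log (1 - markDisc k t * starRingEnd ℂ (M.mark k)) = Complex.log t +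
        (Complex.log (-starRingEnd ℂ (M.mark k) * deriv (markDisc k) 0) +
          Complex.log (relSlope k t)) := by
  obtain ⟨hre, him⟩ := boundary_direction k h1 hd
  set c := -starRingEnd ℂ (M.mark k) * deriv (markDisc k) 0 with hc
  have hq : M.mark k * starRingEnd ℂ (M.mark k) = 1 := by
    rw [Complex.mul_conj, Complex.normSq_eq_norm_sq, h1]; simp
  have hc0 : c ≠ 0 := fun h => by rw [h] at him; simp at him
  have hargc : c.arg = -(Real.pi / 2) := Complex.arg_eq_neg_pi_div_two_iff.2 ⟨hre, him⟩
  have hone : ∀ᶠ t in 𝓝 (0 : ℂ), 0 < (relSlope k t).re := by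
    have h := (analyticAt_relSlope k).continuousAt.tendsto
    rw [relSlope_zero k hd] at h
    exact ((Complex.continuous_re.tendsto _).comp h).eventually (lt_mem_nhds (by simp))
  have happ : ∀ᶠ t in approach (.marked k : Pt M), 0 < t.im := by
    rw [approach, if_pos h1]
    exact self_mem_nhdsWithin
  filter_upwards [approach_le _ hone, happ, approach_marked_le k self_mem_nhdsWithin]
    with t hu ht ht0
  have ht0' : t ≠ 0 := ht0
  have hu0 : relSlope k t ≠ 0 := fun h => by rw [h] at hu; simp at hu
  have hid : 1 - markDisc k t * starRingEnd ℂ (M.mark k) = t * c * relSlope k t := by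
    rw [relSlope_of_ne k ht0, hc]
    field_simp
    linear_combination -hq
  have ha0 : 0 < t.arg := by
    rcases (Complex.arg_nonneg_iff.2 ht.le).lt_or_eq with h | h
    · exact h
    · have := Complex.arg_eq_zero_iff.1 h.symm
      linarith [this.2]
  have haπ : t.arg < Real.pi := Complex.arg_lt_pi_iff.2 (Or.inr ht.ne')
  have hlog1 : Complex.log (t * c) = Complex.log t + Complex.log c :=
    (Complex.log_mul_eq_add_log_iff ht0' hc0).2 (by
      rw [hargc]; constructor <;> linarith)
  have harg1 : (t * c).arg = t.arg - Real.pi / 2 := by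
    have := congrArg Complex.im hlog1
    rw [Complex.add_im, Complex.log_im, Complex.log_im, Complex.log_im, hargc] at this
    linarith
  have hargu := abs_lt.1 (Complex.abs_arg_lt_pi_div_two_iff.2 (Or.inl hu))
  rw [hid, (Complex.log_mul_eq_add_log_iff (mul_ne_zero ht0' hc0) hu0).2
    (by rw [harg1]; constructor <;> linarith), hlog1, add_assoc]

/-- The mirror terms have no singularity at `q_k`, except for that of `q_k` itself if it is a
boundary point. -/
theorem slitPlane_marks {k j : Fin M.numMarks} (h : j ≠ k ∨ ‖M.mark k‖ ≠ 1) :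
    1 - M.mark k * starRingEnd ℂ (M.mark j) ∈ Complex.slitPlane := by
  by_cases hk : ‖M.mark k‖ < 1
  · exact slitPlane_of_norm_lt hk (M.norm_mark_le j)
  have hk1 : ‖M.mark k‖ = 1 := le_antisymm (M.norm_mark_le k) (not_lt.1 hk)
  have hjk : j ≠ k := h.resolve_right fun h => h hk1
  refine Or.inl ?_
  have hle : ‖M.mark k * starRingEnd ℂ (M.mark j)‖ ≤ 1 := by
    rw [norm_mul, Complex.norm_conj, hk1, one_mul]; exact M.norm_mark_le j
  have hre := (Complex.re_le_norm (M.mark k * starRingEnd ℂ (M.mark j))).trans hle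
  rcases hre.lt_or_eq with h2 | h2
  · simpa using h2
  · exfalso
    -- the only point of the closed unit disc with real part one is one
    have hprod : M.mark k * starRingEnd ℂ (M.mark j) = 1 := by
      have h3 := Complex.sq_norm (M.mark k * starRingEnd ℂ (M.mark j))
      rw [Complex.normSq_apply, h2] at h3
      have h4 : ‖M.mark k * starRingEnd ℂ (M.mark j)‖ ^ 2 ≤ 1 := pow_le_one₀ (norm_nonneg _) hle
      refine Complex.ext h2 ?_
      have : (M.mark k * starRingEnd ℂ (M.mark j)).im ^ 2 ≤ 0 := by nlinarith
      simpa using pow_eq_zero_iff (two_ne_zero) |>.1 (le_antisymm this (sq_nonneg _))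
    have hj1 : ‖M.mark j‖ = 1 := by
      have := congrArg norm hprod
      rwa [norm_mul, Complex.norm_conj, hk1, one_mul, norm_one] at this
    have hjj : M.mark j * starRingEnd ℂ (M.mark j) = 1 := by
      rw [Complex.mul_conj, Complex.normSq_eq_norm_sq, hj1]; simp
    have hne : starRingEnd ℂ (M.mark j) ≠ 0 := fun h => by rw [h] at hjj; simp at hjj
    exact hjk (M.mark_injective (mul_right_cancel₀ hne (hjj.trans hprod.symm)))

/-! ### The regular part of the potential at a marked point -/

/-- The regular part at `q_k` of `log (w - w q_j)`, continued from the branches of `st`. -/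
def regularLog (k j : Fin M.numMarks) (st : State M) (r : ℂ) : ℂ :=
  if j = k then st.logDeriv (.marked k) + Complex.log (relSlope k r)
  else st.logDiff (.marked k) (.marked j) +
    Complex.log ((markDisc k r - M.mark j) / (M.mark k - M.mark j))

/-- The regular part at `q_k` of `log (1 - w conj (w q_j))`. -/
def regularMirror (k j : Fin M.numMarks) (r : ℂ) : ℂ :=
  if j = k ∧ ‖M.mark k‖ = 1 then
    Complex.log (-starRingEnd ℂ (M.mark k) * deriv (markDisc k) 0) + Complex.log (relSlope k r)
  else Complex.log (1 - markDisc k r * starRingEnd ℂ (M.mark j))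

theorem analyticAt_regularLog (k j : Fin M.numMarks) (st : State M)
    (hd : deriv (markDisc k) 0 ≠ 0) : AnalyticAt ℂ (regularLog k j st) 0 := by
  unfold regularLog
  split_ifs with h
  · exact analyticAt_const.add (analyticAt_log_relSlope k hd)
  · have h0 : M.mark k - M.mark j ≠ 0 :=
      sub_ne_zero.2 fun e => h (M.mark_injective e).symm
    refine analyticAt_const.add (AnalyticAt.clog ?_ ?_)
    · exact ((analyticAt_markDisc k).sub analyticAt_const).div analyticAt_const h0
    · rw [markDisc_zero, div_self h0]
      exact Complex.one_mem_slitPlane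

theorem analyticAt_regularMirror (k j : Fin M.numMarks) (hd : deriv (markDisc k) 0 ≠ 0) :
    AnalyticAt ℂ (regularMirror k j) 0 := by
  unfold regularMirror
  split_ifs with h
  · exact analyticAt_const.add (analyticAt_log_relSlope k hd)
  · refine AnalyticAt.clog (analyticAt_const.sub ((analyticAt_markDisc k).mul analyticAt_const)) ?_
    rw [markDisc_zero]
    exact slitPlane_marks (by tauto)

namespace BackgroundCharge

variable {b : ℝ}

/-- The coefficient of the logarithmic singularity of the potential at `q_k`: at a boundary point
the mirror charge contributes. -/
def leadingCharge (β₀ β : BackgroundCharge M b) (s : Bool) (k : Fin M.numMarks) : ℂ :=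
  logCharge β₀ β s k + if ‖M.mark k‖ = 1 then mirrorCharge β₀ β s k else 0

/-- The regular part of the potential at `q_k`. -/
def regularPotential (β₀ β : BackgroundCharge M b) (s : Bool) (k : Fin M.numMarks) (st : State M)
    (r : ℂ) : ℂ := -Complex.I * ∑ j, (logCharge β₀ β s j * regularLog k j st r +
      mirrorCharge β₀ β s j * regularMirror k j r)

theorem analyticAt_regularPotential (β₀ β : BackgroundCharge M b) (s : Bool) (k : Fin M.numMarks)
    (st : State M) (hd : deriv (markDisc k) 0 ≠ 0) :
    AnalyticAt ℂ (regularPotential β₀ β s k st) 0 := by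
  refine analyticAt_const.mul (Finset.analyticAt_fun_sum _ fun j _ => ?_)
  exact (analyticAt_const.mul (analyticAt_regularLog k j st hd)).add
    (analyticAt_const.mul (analyticAt_regularMirror k j hd))

theorem regularPotential_congr (β₀ β : BackgroundCharge M b) (s : Bool) (k : Fin M.numMarks)
    {st st' : State M} (h : State.AgreeOn (marks M) st st') :
    regularPotential β₀ β s k st = regularPotential β₀ β s k st' := by
  funext r
  unfold regularPotential regularLog
  simp only [(h.1 _ (mark_mem_marks k)).2, h.2 _ (mark_mem_marks k) _ (mark_mem_marks _)]

/-- The potential near `q_k` is a multiple of `log t` plus an analytic function of `t`. -/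
theorem potential_eq_regular (β₀ β : BackgroundCharge M b) (s : Bool) (k : Fin M.numMarks)
    (st : State M) (hd : deriv (markDisc k) 0 ≠ 0) : ∀ᶠ t in approach (.marked k : Pt M),
      potential β₀ β s (fun j r => (if j = k then Complex.log r else 0) + regularLog k j st r)
        (markDisc k) t = -Complex.I * leadingCharge β₀ β s k * Complex.log t +
          regularPotential β₀ β s k st t := by
  have hm : ∀ᶠ t in approach (.marked k : Pt M),
      Complex.log (1 - markDisc k t * starRingEnd ℂ (M.mark k)) =
        (if ‖M.mark k‖ = 1 then Complex.log t else 0) + regularMirror k k t := by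
    by_cases h1 : ‖M.mark k‖ = 1
    · filter_upwards [log_mirror_boundary k h1 hd] with t ht
      simp [regularMirror, h1, ht]
    · exact Eventually.of_forall fun t => by simp [regularMirror, h1]
  filter_upwards [hm] with t ht
  have hm' : ∀ j, Complex.log (1 - markDisc k t * starRingEnd ℂ (M.mark j)) =
      (if j = k then (if ‖M.mark k‖ = 1 then Complex.log t else 0) else 0) +
        regularMirror k j t := by
    intro j
    by_cases hj : j = k
    · subst hj; simp [ht]
    · simp [regularMirror, hj]
  unfold potential regularPotential leadingCharge
  simp only [hm', mul_add, Finset.sum_add_distrib, mul_ite, mul_zero, Finset.sum_ite_eq',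
    Finset.mem_univ, if_true]
  split_ifs <;> ring

/-- The translation at a node near `q_k`. -/
theorem shift_collide (β₀ β : BackgroundCharge M b) {S : Finset (Pt M)} {st : State M} {x : Pt M}
    {k : Fin M.numMarks} (hst : st.Valid S) (hx : x.IsNode)
    (hch : x.chartIndex = (Pt.marked k).chartIndex) (s : Bool) (m : ℕ) :
    ∀ᶠ t in approach (.marked k : Pt M), shift β₀ β (x, s, m) (st.collide x (.marked k) t) =
      conjSign s (iteratedDeriv m (fun r => -Complex.I * leadingCharge β₀ β s k * Complex.log r +
        regularPotential β₀ β s k st r) t) := by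
  have hd := hst.deriv_markDisc_ne_zero k
  have hchart : x.chart = (Pt.marked k : Pt M).chart := chart_eq_of_chartIndex_eq hch
  have hdisc : ∀ r, x.chart.disc (M.markCoord k + r) = markDisc k r := fun r => by
    rw [hchart]; rfl
  have hmk : Pt.marked k ∈ S ∪ marks M := Finset.mem_union_right _ (mark_mem_marks k)
  have hne : ∀ᶠ t in approach (.marked k : Pt M), ∀ j, markDisc k t ≠ M.mark j := by
    refine eventually_all.2 fun j => ?_
    by_cases hj : j = k
    · subst hj
      have := approach_marked_le j (hst.eventually_disc_ne hmk)
      filter_upwards [this] with t ht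
      rw [hst.coord_marked, hst.marksFixed.pos_marked] at ht
      exact ht
    · refine approach_le _ ((analyticAt_markDisc k).continuousAt.eventually_ne ?_)
      rw [markDisc_zero]
      exact fun e => hj (M.mark_injective e).symm
  filter_upwards [eventually_approach_nhds (potential_eq_regular β₀ β s k st hd),
    eventually_approach_nhds (eventually_norm_markDisc k), eventually_approach_nhds hne,
    eventually_approach_nhds (approach_marked_le k self_mem_nhdsWithin),
    eventually_slitPlane k, approach_le _ (eventually_all.2 fun j =>
      (analyticAt_regularLog k j st hd).eventually_analyticAt)]
    with t hpot hnorm hne hz0 hslit han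
  have hrel : ∀ r : ℂ, r ≠ 0 → relSlope k r = (markDisc k r - M.mark k) /
      (r * deriv (Pt.marked k).chart.disc (st.coord (.marked k))) := fun r hr => by
    rw [relSlope_of_ne k hr, hst.deriv_markDisc]
  have hzt : t ≠ 0 := hz0.self_of_nhds
  rw [shift_eq_of_branch (t := t) β₀ β (hst.marksFixed.collide hx _ t) hx
    (z₀ := M.markCoord k) (ℓ := fun j r => (if j = k then Complex.log r else 0) +
      regularLog k j st r)]
  · congr 1
    refine Filter.EventuallyEq.iteratedDeriv_eq m ?_
    filter_upwards [hpot] with r hr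
    rw [← hr]
    simp only [hdisc]
  · simp [State.collide, hst.coord_marked]
  · filter_upwards [hnorm] with r hr
    rwa [hdisc]
  · intro j
    by_cases hj : j = k
    · simp only [hj, if_true]
      exact (continuousAt_clog hslit).add (han k).continuousAt
    · simpa [hj] using (han j).continuousAt
  · intro j
    filter_upwards [hne, hz0] with r hr hr0
    have hr0' : r ≠ 0 := hr0
    rw [hdisc]
    by_cases hj : j = k
    · subst hj
      have hdd := hst.deriv_ne_zero hmk
      have h1 : (markDisc j r - M.mark j) / (r * deriv (Pt.marked j).chart.disc
          (st.coord (.marked j))) ≠ 0 :=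
        div_ne_zero (sub_ne_zero.2 (hr j)) (mul_ne_zero hr0' hdd)
      simp only [regularLog, if_true]
      rw [Complex.exp_add, Complex.exp_add, Complex.exp_log hr0', hst.exp_logDeriv _ hmk,
        hrel r hr0', Complex.exp_log h1]
      field_simp
    · have h0 : M.mark k - M.mark j ≠ 0 :=
        sub_ne_zero.2 fun e => hj (M.mark_injective e).symm
      have hkj : (Pt.marked k : Pt M) ≠ .marked j := fun e => hj (by cases e; rfl)
      simp only [regularLog, if_neg hj]
      rw [zero_add, Complex.exp_add, Complex.exp_log (div_ne_zero (sub_ne_zero.2 (hr j)) h0),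
        hst.exp_logDiff _ hmk _ (Finset.mem_union_right _ (mark_mem_marks j)) hkj,
        hst.marksFixed.pos_marked, hst.marksFixed.pos_marked]
      field_simp
  · intro j
    have hp : (Pt.marked k : Pt M).chart.disc (st.coord (.marked k) + t) = markDisc k t := by
      rw [hst.coord_marked]; rfl
    by_cases hj : j = k
    · subst hj
      simp only [State.collide, (hx.ne_marked j).symm, and_false, if_false, and_self, if_true,
        regularLog, hp, hrel t hzt, hst.marksFixed.pos_marked]
      ring
    · have hkj : (Pt.marked j : Pt M) ≠ .marked k := fun e => hj (by cases e; rfl)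
      simp only [State.collide, (hx.ne_marked j).symm, and_false, if_false, hkj, if_true,
        hx.ne_marked k, regularLog, if_neg hj, hp, hst.marksFixed.pos_marked]
      ring

end BackgroundCharge

/-- The derivatives of the logarithm. -/
theorem iteratedDeriv_succ_log (m : ℕ) : ∃ c : ℂ, ∀ t ∈ Complex.slitPlane,
    iteratedDeriv (m + 1) Complex.log t = c * Complex.exp (-(m + 1 : ℕ) * Complex.log t) := by
  refine ⟨(-1) ^ m * m.factorial, fun t ht => ?_⟩
  have h : deriv Complex.log =ᶠ[𝓝 t] Inv.inv := by
    filter_upwards [Complex.isOpen_slitPlane.mem_nhds ht] with r hr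
    exact (Complex.hasDerivAt_log hr).deriv
  rw [iteratedDeriv_succ', h.iteratedDeriv_eq, iteratedDeriv_eq_iterate, iter_deriv_inv]
  congr 1
  rw [neg_mul, Complex.exp_neg, Complex.exp_nat_mul, Complex.exp_log (Complex.slitPlane_ne_zero ht),
    ← zpow_natCast, ← zpow_neg]
  congr 1
  push_cast
  ring

theorem Expands.congr' {R Ω : Type*} [CommRing R] [Algebra ℂ R] {l : Filter ℂ}
    {ev : Ω → R →ₐ[ℂ] ℂ} {A : Subalgebra ℂ R} {G G' : Ω → ℂ → ℂ} (h : Expands l ev A G)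
    (hG : ∀ ω, ∀ᶠ t in l, G' ω t = G ω t) : Expands l ev A G' := h.congr hG

/-- A numerical multiple of a member of the scale. -/
theorem Expands.const_term {R Ω : Type*} [CommRing R] [Algebra ℂ R] {l : Filter ℂ}
    {ev : Ω → R →ₐ[ℂ] ℂ} {A : Subalgebra ℂ R} (hl : l ≤ 𝓝[≠] 0) (I : ScaleIndex) (c : ℂ) :
    Expands l ev A fun _ t => c * I.toFun t :=
  (Expands.term hl I (A.algebraMap_mem c)).congr' fun ω => Eventually.of_forall fun t => by
    rw [AlgHom.commutes, mul_comm]; rfl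

theorem notMem_marks {x : Pt M} (hx : x.IsNode) : x ∉ marks M := fun h => by
  obtain ⟨j, _, rfl⟩ := Finset.mem_image.1 h
  exact hx

namespace BackgroundCharge

variable {b : ℝ}

/-- Expansions, at a marked point, of functions that are analytic there, up to conjugation, and
depend on the marked points only. -/
theorem expands_analytic_marks {L : Punctures M} {S : Finset (Pt M)} (k : Fin M.numMarks)
    (hS : ∀ x ∈ S, x.IsNode) (hadm : Admissible L S) (s : Bool)
    {f : State M → ℂ → ℂ} (hf : ∀ st : State M, st.Valid S → AnalyticAt ℂ (f st) 0)
    (hcongr : ∀ st st', State.AgreeOn (marks M) st st' → f st = f st') :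
    Expands (approach (.marked k : Pt M)) (evState S) (iterAlg L S)
      fun st t => conjSign s (f st.1 t) := by
  refine Expands.analytic (approach_marked_le k) s (fun ω => hf ω.1 ω.2)
    (c := fun n st => conjSign s (iteratedDeriv n (f st) 0)) (fun n => ?_) fun ω n => rfl
  refine mem_iterAlg_of_fixed (T := ∅) (fun st st' h => ?_) L hS (by simp) (by simp) hadm
  rw [hcongr st st' (by simpa using h)]

/-- The translations and the exponentials of their multiples have iterated expansions at the marked
points. -/
theorem shift_mem_iterAlg (β₀ β : BackgroundCharge M b) (L : Punctures M) {S : Finset (Pt M)}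
    (hS : ∀ x ∈ S, x.IsNode) (hadm : Admissible L S) {z : Pt M} (hz : z ∈ S) (s : Bool) (m : ℕ) :
    shift β₀ β (z, s, m) ∈ iterAlg L S ∧
      ∀ a : ℂ, (fun st => Complex.exp (a * shift β₀ β (z, s, 0) st)) ∈ iterAlg L S := by
  have hloc : ∀ (S : Finset (Pt M)) m, z ∈ S → shift β₀ β (z, s, m) ∈ localAlg S := fun S m hz =>
    shift_mem_localAlg β₀ β hz
  have hexp : ∀ (S : Finset (Pt M)), z ∈ S → ∀ a : ℂ,
      (fun st => Complex.exp (a * shift β₀ β (z, s, 0) st)) ∈ localAlg S := fun S hz a st st' h =>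
    congrArg (fun v => Complex.exp (a * v)) (hloc S 0 hz st st' h)
  induction L generalizing S with
  | nil => exact ⟨hloc S m hz, hexp S hz⟩
  | cons o L ih =>
    obtain ⟨x, k⟩ := o
    obtain ⟨hx, hch, hadm⟩ := hadm
    have hS' : ∀ y ∈ S.erase x, y.IsNode := fun y hy => hS y (Finset.mem_of_mem_erase hy)
    have hl := approach_marked_le (M := M) k
    rcases eq_or_ne z x with rfl | hzx
    · have hA := fun (st : State M) (hst : st.Valid (S.erase z)) =>
        analyticAt_regularPotential β₀ β s k st (hst.deriv_markDisc_ne_zero k)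
      refine ⟨⟨hloc S m hz, ?_⟩, fun a => ⟨hexp S hz a, ?_⟩⟩
      · have h1 : Expands (approach (.marked k : Pt M)) (evState (S.erase z))
            (iterAlg L (S.erase z)) fun _ t => conjSign s (-Complex.I * leadingCharge β₀ β s k *
              iteratedDeriv m Complex.log t) := by
          rcases m with _ | m
          · refine (Expands.const_term hl (signIndex s 0 1)
              (conjSign s (-Complex.I * leadingCharge β₀ β s k))).congr' fun ω =>
                Eventually.of_forall fun t => ?_
            rw [toFun_signIndex, ← map_mul, iteratedDeriv_zero]
            simp
          · obtain ⟨c, hc⟩ := iteratedDeriv_succ_log m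
            refine (Expands.const_term hl (signIndex s (-(m + 1 : ℕ)) 0)
              (conjSign s (-Complex.I * leadingCharge β₀ β s k * c))).congr' fun ω => ?_
            filter_upwards [eventually_slitPlane k] with t ht
            rw [toFun_signIndex, ← map_mul, hc t ht, pow_zero, mul_one, ← mul_assoc]
        have h2 := expands_analytic_marks k hS' hadm s
          (f := fun st => iteratedDeriv m (regularPotential β₀ β s k st))
          (fun st hst => by rw [iteratedDeriv_eq_iterate]; exact (hA st hst).iterated_deriv m)
          (fun st st' h => by simp only [regularPotential_congr β₀ β s k h])
        refine (h1.add h2).congr' fun ω => ?_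
        filter_upwards [shift_collide β₀ β ω.2 (hS z hz) hch s m, eventually_slitPlane k,
          approach_le _ (hA ω.1 ω.2).eventually_analyticAt] with t ht hslit hat
        rw [ht, ← map_add]
        congr 1
        have hlog : ContDiffAt ℂ m (fun r => -Complex.I * leadingCharge β₀ β s k *
            Complex.log r) t :=
          (analyticAt_const.mul (analyticAt_clog hslit)).contDiffAt
        rw [iteratedDeriv_fun_add hlog hat.contDiffAt,
          iteratedDeriv_const_mul_field]
      · have h1 : Expands (approach (.marked k : Pt M)) (evState (S.erase z))
            (iterAlg L (S.erase z)) fun _ t => (signIndex s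
              (conjSign s a * (-Complex.I * leadingCharge β₀ β s k)) 0).toFun t :=
          (Expands.const_term hl _ 1).congr' fun ω => Eventually.of_forall fun t => (one_mul _).symm
        have h2 := expands_analytic_marks k hS' hadm s
          (f := fun st r => Complex.exp (conjSign s a * regularPotential β₀ β s k st r))
          (fun st hst => (analyticAt_const.mul (hA st hst)).cexp)
          (fun st st' h => by simp only [regularPotential_congr β₀ β s k h])
        refine (h1.mul hl h2).congr' fun ω => ?_
        filter_upwards [shift_collide β₀ β ω.2 (hS z hz) hch s 0] with t ht
        have hc : ∀ w, Complex.exp (conjSign s w) = conjSign s (Complex.exp w) := by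
          intro w
          cases s
          · exact (Complex.exp_conj w)
          · rfl
        rw [ht, toFun_signIndex, pow_zero, mul_one, ← map_mul, ← Complex.exp_add, ← hc,
          iteratedDeriv_zero]
        congr 1
        simp only [map_add, map_mul, conjSign_conjSign]
        ring
    · have hzS : z ∈ S.erase x := Finset.mem_erase.2 ⟨hzx, hz⟩
      have hagree : ∀ (st : State M) (t : ℂ), State.AgreeOn ({z} ∪ marks M)
          (st.collide x (.marked k) t) st := by
        intro st t
        have hne : ∀ y ∈ {z} ∪ marks M, y ≠ x := by
          rintro y hy rfl
          rcases Finset.mem_union.1 hy with h | h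
          · exact hzx (Finset.mem_singleton.1 h).symm
          · exact notMem_marks (hS _ hx) h
        exact ⟨fun y hy => by simp [State.collide, hne y hy],
          fun y hy w hw => by simp [State.collide, hne y hy, hne w hw]⟩
      obtain ⟨ih1, ih2⟩ := ih hS' hadm hzS
      refine ⟨⟨hloc S m hz, (Expands.const hl ih1).congr' fun ω =>
          Eventually.of_forall fun t => ?_⟩,
        fun a => ⟨hexp S hz a, (Expands.const hl (ih2 a)).congr' fun ω =>
          Eventually.of_forall fun t => ?_⟩⟩
      · exact hloc {z} m (by simp) _ _ (hagree _ _)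
      · exact hexp {z} (by simp) a _ _ (hagree _ _)

theorem expoFactor_mem_iterAlg (β₀ β : BackgroundCharge M b) (L : Punctures M) {S : Finset (Pt M)}
    (hS : ∀ x ∈ S, x.IsNode) (hadm : Admissible L S) {η : Expo M}
    (hη : ∀ x ∈ η.support, x.1 ∈ S) : expoFactor (shift β₀ β) η ∈ iterAlg L S := by
  have h : expoFactor (shift β₀ β) η = ∏ x ∈ η.support,
      (fun st => Complex.exp (η x * shift β₀ β (x.1, x.2, 0) st) : Coeff M) := by
    funext st
    rw [Finset.prod_apply, ← Complex.exp_sum]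
    rfl
  rw [h]
  exact Subalgebra.prod_mem _ fun x hx =>
    (shift_mem_iterAlg β₀ β L hS hadm (hη x hx) x.2 0).2 _

end BackgroundCharge

/-! ### Iterated operator product expansions of fields with expandable coefficients -/

/-- Valid states together with test functions. -/
abbrev TestState (S : Finset (Pt M)) :=
  {ω : State M × ((ℂ → ℂ) × (ℂ → ℂ)) // ω.1.Valid S ∧ IsTest S ω.1 ω.2}

/-- The correlation with a Wick exponential, as a homomorphism of `⊙`-algebras. -/
def evTest (S : Finset (Pt M)) (ω : TestState S) : Fock M →ₐ[ℂ] ℂ :=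
  evalJet ω.1.1 (jet ω.1.2 ω.1.1)

theorem jet_of_coord {h : (ℂ → ℂ) × (ℂ → ℂ)} {st : State M} {x : Pt M} {k : Fin M.numMarks} {t : ℂ}
    (hch : x.chart = (Pt.marked k : Pt M).chart) (hx : st.coord x = M.markCoord k + t)
    (s : Bool) (m : ℕ) : jet h st (x, s, m) =
      conjSign s (iteratedDeriv m (fun r => component h s (markDisc k r)) t) := by
  rw [jet_eq, hx]
  congr 1
  have : (fun r => component h s (markDisc k r)) =
      fun r => (fun z => component h s (x.chart.disc z)) (M.markCoord k + r) := by
    funext r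
    rw [hch]
    rfl
  rw [this, iteratedDeriv_comp_const_add m (fun z => component h s (x.chart.disc z))]

theorem State.MarksFixed.jet_marked {st : State M} (hst : st.MarksFixed)
    {h : (ℂ → ℂ) × (ℂ → ℂ)} (k : Fin M.numMarks) (s : Bool) (m : ℕ) :
    jet h st (.marked k, s, m) =
      conjSign s (iteratedDeriv m (fun r => component h s (markDisc k r)) 0) :=
  jet_of_coord rfl (by rw [hst k, add_zero]) s m

theorem jet_collide_self {h : (ℂ → ℂ) × (ℂ → ℂ)} {st : State M} (hst : st.MarksFixed) {x : Pt M}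
    {k : Fin M.numMarks} (hch : x.chart = (Pt.marked k : Pt M).chart) (t : ℂ) (s : Bool) (m : ℕ) :
    jet h (st.collide x (.marked k) t) (x, s, m) =
      conjSign s (iteratedDeriv m (fun r => component h s (markDisc k r)) t) :=
  jet_of_coord hch (by simp [State.collide, hst k]) s m

theorem jet_collide_of_ne {h : (ℂ → ℂ) × (ℂ → ℂ)} {st : State M} {x y z : Pt M} (hz : z ≠ x) (t : ℂ)
    (s : Bool) (m : ℕ) : jet h (st.collide x y t) (z, s, m) = jet h st (z, s, m) := by
  simp only [jet_eq, State.collide, Function.update_of_ne hz]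

theorem analyticAt_test_mark {S : Finset (Pt M)} {st : State M} (hst : st.Valid S)
    {h : (ℂ → ℂ) × (ℂ → ℂ)} (ht : IsTest S st h) (k : Fin M.numMarks) (s : Bool) :
    AnalyticAt ℂ (fun r => component h s (markDisc k r)) 0 := by
  refine AnalyticAt.fun_comp (g := component h s) ?_ (analyticAt_markDisc k)
  rw [markDisc_zero, ← hst.marksFixed.pos_marked k]
  exact isTest_iff.1 ht _ (Finset.mem_union_right _ (mark_mem_marks k)) s

/-- The derivatives of `exp (c H)` are polynomials in those of `H`, times `exp (c H)`. -/
theorem iteratedDeriv_succ_exp {H : ℂ → ℂ} {z : ℂ} (hH : AnalyticAt ℂ H z) (c : ℂ) (n : ℕ) :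
    iteratedDeriv (n + 1) (fun r => Complex.exp (c * H r)) z =
      ∑ i ∈ Finset.range (n + 1), c * n.choose i * iteratedDeriv (i + 1) H z *
        iteratedDeriv (n - i) (fun r => Complex.exp (c * H r)) z := by
  have hE : AnalyticAt ℂ (fun r => Complex.exp (c * H r)) z := (analyticAt_const.mul hH).cexp
  have hev : deriv (fun r => Complex.exp (c * H r)) =ᶠ[𝓝 z]
      (fun r => c * deriv H r) * fun r => Complex.exp (c * H r) := by
    filter_upwards [hH.eventually_analyticAt] with r hr
    have := ((hr.differentiableAt.hasDerivAt.const_mul c).cexp).deriv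
    rw [this, Pi.mul_apply, mul_comm]
  rw [iteratedDeriv_succ', hev.iteratedDeriv_eq,
    iteratedDeriv_mul (f := fun r => c * deriv H r)
      (analyticAt_const.mul hH.deriv).contDiffAt hE.contDiffAt]
  refine Finset.sum_congr rfl fun i _ => ?_
  rw [iteratedDeriv_const_mul_field, iteratedDeriv_succ' (f := H)]
  ring

theorem conjSign_exp (s : Bool) (w : ℂ) :
    Complex.exp (conjSign s w) = conjSign s (Complex.exp w) := by
  cases s
  · exact Complex.exp_conj w
  · rfl

/-- Fields at the marked point whose correlations are the Taylor coefficients of a Wick exponential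
at a nearby node. -/
theorem exists_taylor_wickExp {B : Subalgebra ℂ (Coeff M)} {S T : Finset (Pt M)}
    (k : Fin M.numMarks) (hk : Pt.marked k ∈ T) (s : Bool) (a : ℂ) (n : ℕ) :
    ∃ X ∈ fieldAlg B (labelsOn T), ∀ ω : TestState S, evTest S ω X = conjSign s
      (iteratedDeriv n (fun r => Complex.exp (conjSign s a *
        component ω.1.2 s (markDisc k r))) 0) := by
  induction n using Nat.strong_induction_on with
  | _ n ih =>
    rcases n with _ | n
    · refine ⟨wickExp (Finsupp.single (.marked k, s) a), wickExp_mem fun x hx => ?_, fun ω => ?_⟩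
      · rw [Finset.mem_singleton.1 (Finsupp.support_single_subset hx)]
        exact hk
      · rw [evTest, evalJet_wickExp, Finsupp.sum_single_index (zero_mul _),
          ω.2.1.marksFixed.jet_marked, iteratedDeriv_zero, iteratedDeriv_zero, ← conjSign_exp,
          map_mul, conjSign_conjSign]
    · choose! E hE hEv using ih
      refine ⟨∑ i ∈ Finset.range (n + 1), (a * n.choose i : ℂ) •
        (gauss (.marked k, s, i + 1) * E (n - i)), Subalgebra.sum_mem _ fun i hi =>
          Subalgebra.smul_mem _ (Subalgebra.mul_mem _ (gauss_mem hk)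
            (hE _ (by have := Finset.mem_range.1 hi; omega))) _, fun ω => ?_⟩
      rw [iteratedDeriv_succ_exp (analyticAt_test_mark ω.2.1 ω.2.2 k s), map_sum, map_sum]
      refine Finset.sum_congr rfl fun i hi => ?_
      rw [map_smul, map_mul, hEv _ (by have := Finset.mem_range.1 hi; omega), evTest,
        evalJet_gauss, ω.2.1.marksFixed.jet_marked]
      simp only [map_mul, conjSign_conjSign, map_natCast, smul_eq_mul]
      ring

section

variable {L : Punctures M} {S : Finset (Pt M)} {x : Pt M} {k : Fin M.numMarks}

/-- The symbols near a marked point have Taylor expansions. -/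
theorem expands_jet (hch : x.chart = (Pt.marked k : Pt M).chart) {g : Sym M}
    (hg : g.1 ∈ S ∪ marks M) : Expands (approach (.marked k : Pt M)) (evTest (S.erase x))
      (fieldAlg (iterAlg L (S.erase x)) (labelsOn (S.erase x ∪ marks M)))
      fun ω t => jet ω.1.2 (ω.1.1.collide x (.marked k) t) g := by
  obtain ⟨y, s, m⟩ := g
  have hl := approach_marked_le (M := M) k
  rcases eq_or_ne y x with rfl | hyx
  · refine (Expands.analytic hl s (f := fun ω : TestState (S.erase y) =>
      iteratedDeriv m fun r => component ω.1.2 s (markDisc k r)) (fun ω => ?_)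
      (c := fun n => gauss (.marked k, s, n + m)) (fun n => gauss_mem
        (Finset.mem_union_right _ (mark_mem_marks k))) fun ω n => ?_).congr' fun ω =>
          Eventually.of_forall fun t => jet_collide_self ω.2.1.marksFixed hch t s m
    · rw [iteratedDeriv_eq_iterate]
      exact (analyticAt_test_mark ω.2.1 ω.2.2 k s).iterated_deriv m
    · rw [evTest, evalJet_gauss, ω.2.1.marksFixed.jet_marked]
      simp only [iteratedDeriv_eq_iterate, Function.iterate_add_apply]
  · have hy : y ∈ S.erase x ∪ marks M := by
      rcases Finset.mem_union.1 hg with h | h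
      · exact Finset.mem_union_left _ (Finset.mem_erase.2 ⟨hyx, h⟩)
      · exact Finset.mem_union_right _ h
    refine (Expands.const hl (gauss_mem (g := (y, s, m)) hy)).congr' fun ω =>
      Eventually.of_forall fun t => ?_
    rw [evTest, evalJet_gauss, jet_collide_of_ne hyx]

/-- The Wick exponentials of symbols near a marked point have Taylor expansions. -/
theorem expands_exp_jet (hch : x.chart = (Pt.marked k : Pt M).chart) {y : Pt M × Bool}
    (hy : y.1 ∈ S ∪ marks M) (a : ℂ) : Expands (approach (.marked k : Pt M)) (evTest (S.erase x))
      (fieldAlg (iterAlg L (S.erase x)) (labelsOn (S.erase x ∪ marks M)))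
      fun ω t => Complex.exp (a * jet ω.1.2 (ω.1.1.collide x (.marked k) t) (y.1, y.2, 0)) := by
  obtain ⟨y, s⟩ := y
  have hl := approach_marked_le (M := M) k
  rcases eq_or_ne y x with rfl | hyx
  · have hex := fun n => exists_taylor_wickExp (B := iterAlg L (S.erase y)) (S := S.erase y)
      (T := S.erase y ∪ marks M) k (Finset.mem_union_right _ (mark_mem_marks k)) s a n
    choose c hc hcv using hex
    refine (Expands.analytic hl s (f := fun ω : TestState (S.erase y) => fun r =>
      Complex.exp (conjSign s a * component ω.1.2 s (markDisc k r))) (fun ω =>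
        (analyticAt_const.mul (analyticAt_test_mark ω.2.1 ω.2.2 k s)).cexp) hc
        fun ω n => hcv n ω).congr' fun ω => Eventually.of_forall fun t => ?_
    rw [jet_collide_self ω.2.1.marksFixed hch, iteratedDeriv_zero, ← conjSign_exp, map_mul,
      conjSign_conjSign]
  · have hy' : y ∈ S.erase x ∪ marks M := by
      rcases Finset.mem_union.1 hy with h | h
      · exact Finset.mem_union_left _ (Finset.mem_erase.2 ⟨hyx, h⟩)
      · exact Finset.mem_union_right _ h
    refine (Expands.const hl (wickExp_mem (η := Finsupp.single (y, s) a) fun z hz => ?_)).congr'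
      fun ω => Eventually.of_forall fun t => ?_
    · rw [Finset.mem_singleton.1 (Finsupp.support_single_subset hz)]
      exact hy'
    · rw [evTest, evalJet_wickExp, Finsupp.sum_single_index (zero_mul _), jet_collide_of_ne hyx]

/-- The correlations of a field whose coefficients have iterated expansions have expansions, with
coefficients of the same kind. -/
theorem expands_evalAt (hch : x.chart = (Pt.marked k : Pt M).chart) {X : Fock M}
    (hX : X ∈ fieldAlg (iterAlg ((x, k) :: L) S) (labelsOn (S ∪ marks M))) :
    Expands (approach (.marked k : Pt M)) (evTest (S.erase x))
      (fieldAlg (iterAlg L (S.erase x)) (labelsOn (S.erase x ∪ marks M)))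
      fun ω t => evalAt ω.1.2 X (ω.1.1.collide x (.marked k) t) := by
  have hl := approach_marked_le (M := M) k
  simp only [evalAt_eq, evalJet_apply, Finsupp.sum, monoVal, Finsupp.prod, Complex.exp_sum]
  refine Expands.sum hl _ fun p hp => ?_
  obtain ⟨hpT, hpB⟩ := hX p hp
  refine (Expands.map (ev := evState (S.erase x)) (ev' := evTest (S.erase x)) nonrandom
    (fun ω : TestState (S.erase x) => ⟨ω.1.1, ω.2.1⟩) (fun ω f => evalJet_nonrandom _ _ f)
    (fun f hf => nonrandom_mem hf) hpB.2).mul hl ((Expands.prod hl _ fun g hg => ?_).mul hl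
      (Expands.prod hl _ fun y hy => ?_))
  · exact (expands_jet hch (hpT.1 g hg)).pow hl _
  · exact expands_exp_jet hch (hpT.2 y hy) _

/-- Collecting the terms of an expansion that carry the same member of the scale. -/
theorem hasOPE_of_expands (hx : x ∈ S) (hn : x.IsNode)
    (hch : x.chartIndex = (Pt.marked k).chartIndex) {X : Fock M}
    {A : Subalgebra ℂ (Fock M)}
    (hA : A ≤ fieldAlg (localAlg (S.erase x)) (labelsOn (S.erase x ∪ marks M)))
    (h : Expands (approach (.marked k : Pt M)) (evTest (S.erase x)) A
      fun ω t => evalAt ω.1.2 X (ω.1.1.collide x (.marked k) t)) :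
    ∃ D : ScaleIndex → Fock M, HasOPE S X x (.marked k) (S.erase x ∪ marks M) D ∧
      ∀ I, D I ∈ A := by
  classical
  obtain ⟨ι, idx, C, F, hF, hC, hexp⟩ := h
  let D : ScaleIndex → Fock M := fun I => ∑ i ∈ F I.order with idx i = I, C i
  have hD : ∀ I, D I ∈ A := fun I => Subalgebra.sum_mem _ fun i _ => hC i
  refine ⟨D, ⟨hx, hn.ne_marked k, hch, fun I => fieldOn_union_marks_iff.2 (hA (hD I)),
    fun N => {I ∈ (F N).image idx | D I ≠ 0}, fun N I => ?_, fun st hst h ht N => ?_⟩, hD⟩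
  · simp only [Finset.mem_filter, Finset.mem_image]
    constructor
    · rintro ⟨⟨i, hi, rfl⟩, hne⟩
      exact ⟨hne, (hF _ _).1 hi⟩
    · rintro ⟨hne, hN⟩
      obtain ⟨i, hi, -⟩ := Finset.exists_ne_zero_of_sum_ne_zero hne
      obtain ⟨-, rfl⟩ := Finset.mem_filter.1 hi
      exact ⟨⟨i, (hF _ _).2 hN, rfl⟩, hne⟩
  · refine (hexp ⟨(st, h), hst, ht⟩ N).congr' (Eventually.of_forall fun t => ?_) EventuallyEq.rfl
    change _ - _ = _ - _
    congr 1
    simp only [evTest, ← evalAt_eq]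
    have hfil : ∑ I ∈ (F N).image idx with D I ≠ 0, I.toFun t * evalAt h (D I) st =
        ∑ I ∈ (F N).image idx, I.toFun t * evalAt h (D I) st := by
      refine Finset.sum_filter_of_ne fun I _ hne hD0 => hne ?_
      rw [hD0, evalAt_eq, map_zero, mul_zero]
    rw [hfil, ← Finset.sum_fiberwise_of_maps_to (s := F N) (g := idx)
      fun i hi => Finset.mem_image_of_mem idx hi]
    refine Finset.sum_congr rfl fun I hI => ?_
    obtain ⟨i₀, hi₀, rfl⟩ := Finset.mem_image.1 hI
    have hset : {i ∈ F N | idx i = idx i₀} = {i ∈ F (idx i₀).order | idx i = idx i₀} := by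
      ext i
      simp only [Finset.mem_filter, hF, and_congr_left_iff]
      intro hi
      rw [hi]
      exact ⟨fun _ => le_rfl, fun _ => (hF _ _).1 hi₀⟩
    simp only [D]
    rw [hset, evalAt_eq, map_sum, Finset.mul_sum]
    refine Finset.sum_congr rfl fun i hi => ?_
    rw [(Finset.mem_filter.1 hi).2, evalAt_eq]

end

/-- A field whose coefficients have iterated expansions at the marked points has an iterated
operator product expansion. -/
theorem exists_iteratedOPE (L : Punctures M) {S : Finset (Pt M)} (hS : ∀ x ∈ S, x.IsNode)
    (hadm : Admissible L S) {X : Fock M}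
    (hX : X ∈ fieldAlg (iterAlg L S) (labelsOn (S ∪ marks M))) :
    ∃ C, IteratedOPE L S X C := by
  induction L generalizing S X with
  | nil => exact ⟨fun _ => X, rfl⟩
  | cons o L ih =>
    obtain ⟨x, k⟩ := o
    obtain ⟨hx, hch, hadm⟩ := hadm
    obtain ⟨D, hD, hDA⟩ := hasOPE_of_expands hx (hS x hx) hch
      (fieldAlg_mono (iterAlg_le_localAlg L _) le_rfl)
      (expands_evalAt (chart_eq_of_chartIndex_eq hch) hX)
    choose C hC using fun I =>
      ih (fun y hy => hS y (Finset.mem_of_mem_erase hy)) hadm (hDA I)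
    exact ⟨fun l => match l with
      | [] => 0
      | I :: l => C I l, D, hD, hC⟩

/-! ### Test functions with prescribed germs, and separation of fields -/

theorem jet_eq_germ (h : (ℂ → ℂ) × (ℂ → ℂ)) (st : State M) (y : Pt M) (s : Bool) (m : ℕ) :
    jet h st (y, s, m) = conjSign s
      (iteratedDeriv m (fun r => component h s (y.chart.disc (st.coord y + r))) 0) := by
  rw [jet_eq, iteratedDeriv_comp_const_add m (fun z => component h s (y.chart.disc z))]
  beta_reduce
  rw [add_zero]

/-- Test functions with prescribed germs, in the chart coordinates, at the nodes and at the marked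
points. -/
theorem exists_test {S : Finset (Pt M)} {st : State M} (hst : st.Valid S)
    (G : Pt M → Bool → ℂ → ℂ) (hG : ∀ y ∈ S ∪ marks M, ∀ s, AnalyticAt ℂ (G y s) 0) :
    ∃ h, IsTest S st h ∧ ∀ y ∈ S ∪ marks M, ∀ s,
      (fun r => component h s (y.chart.disc (st.coord y + r))) =ᶠ[𝓝 0] G y s := by
  have hinv : ∀ y ∈ S ∪ marks M, ∃ f : ℂ → ℂ, AnalyticAt ℂ f (st.pos y) ∧ f (st.pos y) = 0 ∧
      ∀ᶠ r in 𝓝 (0 : ℂ), f (y.chart.disc (st.coord y + r)) = r := by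
    intro y hy
    have han := hst.analyticAt_disc_add hy
    have hd : deriv (fun r => y.chart.disc (st.coord y + r)) 0 ≠ 0 := by
      rw [deriv_comp_const_add, add_zero]
      exact hst.deriv_ne_zero hy
    have h1 := han.analyticAt_localInverse hd
    have h2 := han.hasStrictDerivAt.eventually_left_inverse hd
    have hp : y.chart.disc (st.coord y + 0) = st.pos y := by rw [add_zero]; rfl
    simp only [hp] at h1
    exact ⟨_, h1, by simpa only [hp] using h2.self_of_nhds, h2⟩
  choose! f hf hf0 hfr using hinv
  have hinj : Set.InjOn st.pos (S ∪ marks M : Finset (Pt M)) := by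
    intro x hx y hy hxy
    by_contra hne
    exact hst.pos_ne x hx y hy hne hxy
  choose H hH using fun s => exists_glue (S ∪ marks M) st.pos hinj fun y z => G y s (f y z)
  have hc : ∀ s, component (H true, H false) s = H s := by
    intro s
    cases s <;> rfl
  refine ⟨(H true, H false), isTest_iff.2 fun y hy s => ?_, fun y hy s => ?_⟩
  · rw [hc]
    refine AnalyticAt.congr ?_ (hH s y hy).symm
    exact AnalyticAt.fun_comp (g := G y s) (by rw [hf0 y hy]; exact hG y hy s) (hf y hy)
  · rw [hc]
    filter_upwards [(hst.tendsto_disc hy).eventually (hH s y hy), hfr y hy] with r h1 h2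
    rw [h1, h2]

theorem iteratedDeriv_eval (m : ℕ) (p : Polynomial ℂ) :
    iteratedDeriv m (fun r => p.eval r) = fun r => ((Polynomial.derivative^[m]) p).eval r := by
  induction m generalizing p with
  | zero => rfl
  | succ m ih =>
    have : deriv (fun r => p.eval r) = fun r => (Polynomial.derivative p).eval r := by
      funext r
      exact p.deriv
    rw [iteratedDeriv_succ', this, ih, Function.iterate_succ_apply]

theorem analyticAt_eval (p : Polynomial ℂ) (z : ℂ) : AnalyticAt ℂ (fun r => p.eval r) z :=
  Differentiable.analyticAt p.differentiable z

/-- The jets of test functions with polynomial germs. -/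
def polyJet (P : Pt M → Bool → Polynomial ℂ) : Sym M → ℂ := fun g =>
  conjSign g.2.1 (((Polynomial.derivative^[g.2.2]) (P g.1 g.2.1)).eval 0)

/-- The jets of test functions with polynomial germs when the node `x` has the coordinate `t`
relative to `y`. -/
def collideJet (P : Pt M → Bool → Polynomial ℂ) (x y : Pt M) (t : ℂ) : Sym M → ℂ := fun g =>
  if g.1 = x then conjSign g.2.1 (((Polynomial.derivative^[g.2.2]) (P y g.2.1)).eval t)
  else polyJet P g

/-- A polynomial germ at a marked point determines the jets at a nearby node as well. -/
theorem exists_poly_test {S : Finset (Pt M)} {st : State M} (hst : st.Valid S)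
    (P : Pt M → Bool → Polynomial ℂ) : ∃ h, IsTest S st h ∧
      (∀ g : Sym M, g.1 ∈ S ∪ marks M → jet h st g = polyJet P g) ∧
      ∀ (x : Pt M) (k : Fin M.numMarks), x.chart = (Pt.marked k : Pt M).chart →
        ∀ᶠ t in 𝓝 (0 : ℂ), ∀ g : Sym M, g.1 ∈ insert x (S ∪ marks M) →
          jet h (st.collide x (.marked k) t) g = collideJet P x (.marked k) t g := by
  obtain ⟨h, ht, hh⟩ := exists_test hst (fun y s r => (P y s).eval r)
    fun y _ s => analyticAt_eval _ _
  have hj : ∀ g : Sym M, g.1 ∈ S ∪ marks M → jet h st g = polyJet P g := by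
    rintro ⟨y, s, m⟩ hy
    rw [jet_eq_germ, (hh y hy s).iteratedDeriv_eq, iteratedDeriv_eval]
    rfl
  refine ⟨h, ht, hj, fun x k hch => ?_⟩
  have hmk : Pt.marked k ∈ S ∪ marks M := Finset.mem_union_right _ (mark_mem_marks k)
  have hev := eventually_all.2 fun s => (hh _ hmk s).eventually_nhds
  filter_upwards [hev] with t ht g hg
  obtain ⟨y, s, m⟩ := g
  by_cases hy : y = x
  · subst hy
    rw [jet_collide_self hst.marksFixed hch, collideJet, if_pos rfl]
    have h1 : (fun r => component h s (markDisc k r)) =ᶠ[𝓝 t]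
        fun r => (P (.marked k) s).eval r := by
      filter_upwards [ht s] with r hr
      rw [← hr, hst.coord_marked]
      rfl
    rw [h1.iteratedDeriv_eq, iteratedDeriv_eval]
  · rw [jet_collide_of_ne hy, collideJet, if_neg hy]
    exact hj _ ((Finset.mem_insert.1 hg).resolve_left hy)

/-- The polynomial germs with the derivatives `j` of order less than `N` at the origin. -/
def jetPoly (N : ℕ) (j : Sym M → ℂ) (y : Pt M) (s : Bool) : Polynomial ℂ :=
  ∑ m ∈ Finset.range N, Polynomial.C (conjSign s (j (y, s, m)) / m.factorial) * Polynomial.X ^ m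

theorem polyJet_jetPoly (N : ℕ) (j : Sym M → ℂ) {g : Sym M} (hg : g.2.2 < N) :
    polyJet (jetPoly N j) g = j g := by
  obtain ⟨y, s, m⟩ := g
  have h1 : ((Polynomial.derivative^[m]) (jetPoly N j y s)).eval 0 = conjSign s (j (y, s, m)) := by
    rw [← Polynomial.coeff_zero_eq_eval_zero, Polynomial.coeff_iterate_derivative, zero_add,
      Nat.descFactorial_self]
    have : (jetPoly N j y s).coeff m = conjSign s (j (y, s, m)) / m.factorial := by
      simp only [jetPoly, Polynomial.finsetSum_coeff, Polynomial.coeff_C_mul_X_pow]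
      rw [Finset.sum_ite_eq, if_pos (Finset.mem_range.2 hg)]
    rw [this, nsmul_eq_mul, mul_div_cancel₀ _ (by exact_mod_cast m.factorial_ne_zero)]
  rw [polyJet, h1, conjSign_conjSign]

/-- A bound for the orders of the derivatives in a field. -/
theorem exists_jet_order (X : Fock M) : ∃ N : ℕ, 0 < N ∧
    ∀ p ∈ X.coeff.support, ∀ g ∈ p.1.support, g.2.2 < N := by
  refine ⟨(X.coeff.support.sup fun p => p.1.support.sup fun g => g.2.2) + 1, by omega,
    fun p hp g hg => Nat.lt_succ_of_le ?_⟩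
  exact (Finset.le_sup (f := fun g : Sym M => g.2.2) hg).trans
    (Finset.le_sup (f := fun p : (Sym M →₀ ℕ) × Expo M => p.1.support.sup fun g => g.2.2) hp)

theorem monoVal_congr {p : (Sym M →₀ ℕ) × Expo M} {j j' : Sym M → ℂ}
    (h : ∀ g ∈ p.1.support, j g = j' g)
    (h' : ∀ x ∈ p.2.support, j (x.1, x.2, 0) = j' (x.1, x.2, 0)) :
    monoVal j p = monoVal j' p := by
  unfold monoVal
  congr 1
  · exact Finset.prod_congr rfl fun g hg => congrArg (· ^ p.1 g) (h g hg)
  · congr 1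
    exact Finset.sum_congr rfl fun x hx => congrArg (p.2 x * ·) (h' x hx)

/-- Evaluation at jets which agree at the points of `T`, up to the order of `X`. -/
theorem evalJet_congr_order {B : Subalgebra ℂ (Coeff M)} {T : Finset (Pt M)} {X : Fock M}
    (hX : X ∈ fieldAlg B (labelsOn T)) {N : ℕ} (hN : 0 < N)
    (hXN : ∀ p ∈ X.coeff.support, ∀ g ∈ p.1.support, g.2.2 < N) (st : State M) {j j' : Sym M → ℂ}
    (h : ∀ g : Sym M, g.1 ∈ T → g.2.2 < N → j g = j' g) : evalJet st j X = evalJet st j' X := by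
  rw [evalJet_apply, evalJet_apply]
  refine Finsupp.sum_congr fun p hp => ?_
  rw [monoVal_congr (fun g hg => h g ((hX p hp).1.1 g hg) (hXN p hp g hg))
    fun x hx => h (x.1, x.2, 0) ((hX p hp).1.2 x hx) hN]

/-- Combinations of evaluations at jets that extract one basic field among finitely many. -/
theorem exists_monoVal_weights (P : Finset ((Sym M →₀ ℕ) × Expo M)) (p₀ : (Sym M →₀ ℕ) × Expo M) :
    ∃ w : (Sym M → ℂ) →₀ ℂ, ∀ p ∈ P,
      (w.sum fun j c => c * monoVal j p) = if p = p₀ then 1 else 0 := by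
  classical
  let ι : Pt M × Bool ↪ Sym M :=
    ⟨fun x => (x.1, x.2, 0), fun x y h => by simpa [Prod.ext_iff] using h⟩
  let lbl : (Sym M →₀ ℕ) × Expo M → (Sym M →₀ ℕ) × (Sym M →₀ ℂ) :=
    fun p => (p.1, p.2.embDomain ι)
  have hinj : Function.Injective lbl := fun p q h =>
    Prod.ext (congrArg (fun q => q.1) h : (lbl p).1 = (lbl q).1)
      (Finsupp.embDomain_injective ι (congrArg (fun q => q.2) h : (lbl p).2 = (lbl q).2))
  have hval : ∀ p j, monoVal j p = expMono (lbl p) j := by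
    intro p j
    simp only [monoVal, expMono, lbl, Finsupp.sum_embDomain]
    rfl
  refine exists_weights P (fun p j => monoVal j p) (fun c hc => ?_) p₀
  have := expMono_independent (P.image lbl) (fun q => ∑ p ∈ P with lbl p = q, c p) fun j => by
    rw [Finset.sum_image fun p _ q _ e => hinj e]
    simp only [hinj.eq_iff, ← hval]
    refine Eq.trans (Finset.sum_congr rfl fun p hp => ?_) (hc j)
    rw [Finset.filter_eq' P p, if_pos hp, Finset.sum_singleton]
  intro p hp
  have h := this _ (Finset.mem_image_of_mem lbl hp)
  simp only [hinj.eq_iff] at h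
  rwa [Finset.filter_eq' P p, if_pos hp, Finset.sum_singleton] at h

/-- The coefficients of a field are combinations of its evaluations at finitely many jets. -/
theorem exists_coeff_weights (X : Fock M) (p₀ : (Sym M →₀ ℕ) × Expo M) :
    ∃ w : (Sym M → ℂ) →₀ ℂ, ∀ st, X.coeff p₀ st = w.sum fun j c => c * evalJet st j X := by
  classical
  obtain ⟨w, hw⟩ := exists_monoVal_weights X.coeff.support p₀
  refine ⟨w, fun st => ?_⟩
  simp only [evalJet_apply, Finsupp.sum, Finset.mul_sum] at hw ⊢
  rw [Finset.sum_comm]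
  have : ∀ p ∈ X.coeff.support, ∑ j ∈ w.support, w j * (X.coeff p st * monoVal j p) =
      if p = p₀ then X.coeff p₀ st else 0 := by
    intro p hp
    have h1 : ∑ j ∈ w.support, w j * (X.coeff p st * monoVal j p) =
        X.coeff p st * ∑ j ∈ w.support, w j * monoVal j p := by
      rw [Finset.mul_sum]
      exact Finset.sum_congr rfl fun j _ => by ring
    rw [h1, hw p hp]
    split_ifs with h
    · rw [h, mul_one]
    · rw [mul_zero]
  rw [Finset.sum_congr rfl this, Finset.sum_ite_eq']
  split_ifs with h
  · rfl
  · rw [Finsupp.notMem_support_iff.1 h]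
    rfl

/-- Linear relations between the correlations of a field are inherited by the coefficients of its
operator product expansion. -/
theorem HasOPE.sum_eq_zero {S T : Finset (Pt M)} {X : Fock M} {x : Pt M} {k : Fin M.numMarks}
    {D : ScaleIndex → Fock M} (hD : HasOPE S X x (.marked k) T D) {st : State M}
    (hst : st.Valid (S.erase x)) {κ : Type*} (s : Finset κ) (c : κ → ℂ)
    {h : κ → (ℂ → ℂ) × (ℂ → ℂ)} (hh : ∀ i ∈ s, IsTest (S.erase x) st (h i))
    (h0 : ∀ᶠ t in approach (.marked k : Pt M),
      ∑ i ∈ s, c i * evalAt (h i) X (st.collide x (.marked k) t) = 0) (I : ScaleIndex) :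
    ∑ i ∈ s, c i * evalAt (h i) (D I) st = 0 := by
  obtain ⟨-, -, -, -, F, hF, hexp⟩ := hD
  by_cases hI : D I = 0
  · exact Finset.sum_eq_zero fun i _ => by rw [hI, evalAt_eq, map_zero, mul_zero]
  refine scale_unique k (N := I.order) (F I.order) (fun J hJ => ((hF _ _).1 hJ).2)
    (fun J => ∑ i ∈ s, c i * evalAt (h i) (D J) st) ?_ I ((hF _ _).2 ⟨hI, le_rfl⟩)
  have h1 : (fun t : ℂ => ∑ i ∈ s, c i * (evalAt (h i) X (st.collide x (.marked k) t) -
      ∑ J ∈ F I.order, J.toFun t * evalAt (h i) (D J) st)) =o[approach (.marked k : Pt M)]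
        fun t => ‖t‖ ^ I.order :=
    IsLittleO.fun_sum fun i hi => (hexp st hst (h i) (hh i hi) I.order).const_mul_left (c i)
  refine (h1.neg_left).congr' ?_ EventuallyEq.rfl
  filter_upwards [h0] with t ht
  simp only [mul_sub, Finset.sum_sub_distrib, ht, zero_sub, neg_neg, Finset.mul_sum]
  rw [Finset.sum_comm]
  refine Finset.sum_congr rfl fun J _ => Finset.sum_congr rfl fun i _ => by ring

/-! ### Charges of the coefficients of expansions -/

/-- All basic fields in `X` whose coefficients do not vanish at valid states have the exponents `e`
at the points of `T`. -/
def ChargedOn (T S : Finset (Pt M)) (X : Fock M) (e : Pt M → Bool → ℂ) : Prop :=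
  ∀ st : State M, st.Valid S → ∀ p, X.coeff p st ≠ 0 → ∀ y ∈ T, ∀ s, p.2 (y, s) = e y s

/-- Along a line of jets, a basic field is a polynomial times an exponential. -/
theorem monoVal_line (j Δ : Sym M → ℂ) (p : (Sym M →₀ ℕ) × Expo M) :
    ∃ Q : Polynomial ℂ, Q.natDegree ≤ p.1.degree ∧ ∀ v : ℂ, monoVal (j + v • Δ) p =
      Q.eval v * Complex.exp ((p.2.sum fun x a => a * Δ (x.1, x.2, 0)) * v) := by
  refine ⟨Polynomial.C (Complex.exp (p.2.sum fun x a => a * j (x.1, x.2, 0))) *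
    ∏ g ∈ p.1.support, (Polynomial.C (j g) + Polynomial.C (Δ g) * Polynomial.X) ^ p.1 g, ?_,
    fun v => ?_⟩
  · refine (Polynomial.natDegree_C_mul_le _ _).trans
      ((Polynomial.natDegree_prod_le _ _).trans (Finset.sum_le_sum fun g _ => ?_))
    refine Polynomial.natDegree_pow_le.trans ((Nat.mul_le_mul_left _ ?_).trans (mul_one _).le)
    compute_degree
  · rw [monoVal, Polynomial.eval_mul, Polynomial.eval_C, Polynomial.eval_prod]
    have h1 : (p.2.sum fun x a => a * (j + v • Δ) (x.1, x.2, 0)) =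
        (p.2.sum fun x a => a * j (x.1, x.2, 0)) +
          (p.2.sum fun x a => a * Δ (x.1, x.2, 0)) * v := by
      rw [Finsupp.sum, Finsupp.sum, Finsupp.sum, Finset.sum_mul, ← Finset.sum_add_distrib]
      refine Finset.sum_congr rfl fun x _ => ?_
      simp only [Pi.add_apply, Pi.smul_apply, smul_eq_mul]
      ring
    rw [h1, Complex.exp_add]
    have h2 : (p.1.prod fun g n => (j + v • Δ) g ^ n) = ∏ g ∈ p.1.support,
        ((Polynomial.C (j g) + Polynomial.C (Δ g) * Polynomial.X) ^ p.1 g).eval v := by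
      refine Finset.prod_congr rfl fun g _ => ?_
      simp only [Polynomial.eval_pow, Polynomial.eval_add, Polynomial.eval_mul, Polynomial.eval_C,
        Polynomial.eval_X, Pi.add_apply, Pi.smul_apply, smul_eq_mul, mul_comm v]
    rw [h2]
    ring

/-- Combinations of evaluations that extract, among exponential polynomials of bounded degree, the
value at zero of the component with a given frequency. -/
theorem exists_line_weights (d : ℕ) (Γ : Finset ℂ) (γ₀ : ℂ) : ∃ w : (Unit → ℂ) →₀ ℂ,
    ∀ Q : Polynomial ℂ, Q.natDegree ≤ d → ∀ γ ∈ Γ,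
      (w.sum fun v c => c * (Q.eval (v ()) * Complex.exp (γ * v ()))) =
        if γ = γ₀ then Q.eval 0 else 0 := by
  classical
  let lbl : ℕ × ℂ → (Unit →₀ ℕ) × (Unit →₀ ℂ) :=
    fun q => (Finsupp.single () q.1, Finsupp.single () q.2)
  obtain ⟨w, hw⟩ := exists_weights ((Finset.range (d + 1) ×ˢ Γ).image lbl) expMono
    (expMono_independent _) (lbl (0, γ₀))
  refine ⟨w, fun Q hQ γ hγ => ?_⟩
  have hval : ∀ n (v : Unit → ℂ), expMono (lbl (n, γ)) v = v () ^ n * Complex.exp (γ * v ()) := by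
    intro n v
    simp [expMono, lbl]
  have h1 : ∀ n ∈ Finset.range (d + 1), ∑ v ∈ w.support,
      w v * (Q.coeff n * (v () ^ n * Complex.exp (γ * v ()))) =
        if n = 0 then (if γ = γ₀ then Q.coeff 0 else 0) else 0 := by
    intro n hn
    have h2 := hw (lbl (n, γ)) (Finset.mem_image_of_mem lbl (Finset.mem_product.2 ⟨hn, hγ⟩))
    simp only [hval, Finsupp.sum] at h2
    have h3 : ∑ v ∈ w.support, w v * (Q.coeff n * (v () ^ n * Complex.exp (γ * v ()))) =
        Q.coeff n * ∑ v ∈ w.support, w v * (v () ^ n * Complex.exp (γ * v ())) := by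
      rw [Finset.mul_sum]
      exact Finset.sum_congr rfl fun v _ => by ring
    have h4 : lbl (n, γ) = lbl (0, γ₀) ↔ n = 0 ∧ γ = γ₀ := by
      simp only [lbl, Prod.mk.injEq, (Finsupp.single_injective ()).eq_iff]
    rw [h3, h2]
    simp only [h4]
    by_cases hn0 : n = 0
    · subst hn0; split_ifs <;> simp_all
    · simp [hn0]
  rw [Finsupp.sum]
  simp only [Polynomial.eval_eq_sum_range' (Nat.lt_succ_of_le hQ), Finset.sum_mul, Finset.mul_sum]
  rw [Finset.sum_comm]
  simp only [mul_assoc] at h1 ⊢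
  rw [Finset.sum_congr rfl h1, Finset.sum_ite_eq', if_pos (Finset.mem_range.2 (Nat.succ_pos d))]
  congr 1
  simp [Finset.sum_range_succ']

theorem iterate_derivative_add_const (m : ℕ) (p : Polynomial ℂ) (a : ℂ) :
    (Polynomial.derivative^[m]) (p + Polynomial.C a) =
      (Polynomial.derivative^[m]) p + if m = 0 then Polynomial.C a else 0 := by
  rcases m with _ | m
  · simp
  · rw [iterate_map_add, Polynomial.iterate_derivative_C (Nat.succ_pos m)]
    simp

theorem eval_iterate_derivative_add_ite (m : ℕ) (p : Polynomial ℂ) (a z : ℂ) (q : Prop)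
    [Decidable q] (s : Bool) :
    conjSign s (((Polynomial.derivative^[m])
      (p + if q then Polynomial.C (conjSign s a) else 0)).eval z) =
      conjSign s (((Polynomial.derivative^[m]) p).eval z) + if q ∧ m = 0 then a else 0 := by
  by_cases hq : q
  · simp only [hq, if_true, true_and, iterate_derivative_add_const]
    split_ifs <;> simp [conjSign_conjSign]
  · simp [hq]

/-- The coefficients of an operator product expansion at a marked point have definite charges if the
field has, the charge of the node being added to that of the marked point. -/
theorem ChargedOn.coeff {B B' : Subalgebra ℂ (Coeff M)} {S T : Finset (Pt M)} {X : Fock M}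
    {x : Pt M} {k : Fin M.numMarks} {D : ScaleIndex → Fock M} {e : Pt M → Bool → ℂ}
    (h : ChargedOn T S X e) (hS : ∀ x ∈ S, x.IsNode)
    (hX : X ∈ fieldAlg B (labelsOn (S ∪ marks M)))
    (hD : HasOPE S X x (.marked k) (S.erase x ∪ marks M) D)
    (hxT : x ∈ T) (hT : T ⊆ S ∪ marks M) (I : ScaleIndex)
    (hDI : D I ∈ fieldAlg B' (labelsOn (S.erase x ∪ marks M))) :
    ChargedOn (T.erase x) (S.erase x) (D I)
      fun y s => e y s + if y = .marked k then e x s else 0 := by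
  classical
  intro st hst p₀ hp₀ y hy s
  obtain ⟨hyx, hyT⟩ := Finset.mem_erase.1 hy
  have hyS : y ∈ S.erase x ∪ marks M := by
    rcases Finset.mem_union.1 (hT hyT) with h | h
    · exact Finset.mem_union_left _ (Finset.mem_erase.2 ⟨hyx, h⟩)
    · exact Finset.mem_union_right _ h
  have hxS := hD.1
  have hch := chart_eq_of_chartIndex_eq hD.2.2.1
  by_contra hne
  -- the contribution of the labels with the exponent of `p₀` at `(y, s)` is extracted from the
  -- correlations with test functions that are varied by constants at `y`; the correlations of `X`
  -- have the single frequency `c` in these constants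
  set c := e y s + if y = .marked k then e x s else 0 with hc
  set γ₀ := p₀.2 (y, s) with hγ₀
  obtain ⟨N, hN, hDN⟩ := exists_jet_order (D I)
  obtain ⟨w, hw⟩ := exists_line_weights
    ((X.coeff.support ∪ (D I).coeff.support).sup fun p => p.1.degree)
    (insert c ((D I).coeff.support.image fun p => p.2 (y, s))) γ₀
  have hdeg : ∀ p ∈ X.coeff.support ∪ (D I).coeff.support, p.1.degree ≤
      (X.coeff.support ∪ (D I).coeff.support).sup fun p => p.1.degree := fun p hp =>
    Finset.le_sup (f := fun p : (Sym M →₀ ℕ) × Expo M => p.1.degree) hp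
  have key : ∀ j : Sym M → ℂ, ∑ p ∈ (D I).coeff.support with p.2 (y, s) = γ₀,
      (D I).coeff p st * monoVal j p = 0 := by
    intro j
    let P : ℂ → Pt M → Bool → Polynomial ℂ := fun v y' s' =>
      jetPoly N j y' s' + if y' = y ∧ s' = s then Polynomial.C (conjSign s' v) else 0
    have hPj : ∀ v, polyJet (P v) = polyJet (jetPoly N j) +
        v • fun g : Sym M => if (g.1 = y ∧ g.2.1 = s) ∧ g.2.2 = 0 then (1 : ℂ) else 0 := by
      intro v
      funext g
      simp only [polyJet, P, eval_iterate_derivative_add_ite, Pi.add_apply, Pi.smul_apply,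
        smul_eq_mul, mul_ite, mul_one, mul_zero]
    have hPc : ∀ v t, collideJet (P v) x (.marked k) t = collideJet (jetPoly N j) x (.marked k) t +
        v • fun g : Sym M => if ((if g.1 = x then .marked k else g.1) = y ∧ g.2.1 = s) ∧ g.2.2 = 0
          then (1 : ℂ) else 0 := by
      intro v t
      funext g
      by_cases hg : g.1 = x
      · simp only [collideJet, hg, if_true, P, eval_iterate_derivative_add_ite, Pi.add_apply,
          Pi.smul_apply, smul_eq_mul, mul_ite, mul_one, mul_zero]
      · simp only [collideJet, hg, if_false, hPj, Pi.add_apply, Pi.smul_apply, smul_eq_mul, mul_ite,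
          mul_one, mul_zero]
    choose g hgt hgj hgc using fun v => exists_poly_test hst (P v)
    have h0 : ∀ᶠ t in approach (.marked k : Pt M), ∑ v ∈ w.support,
        w v * evalAt (g (v ())) X (st.collide x (.marked k) t) = 0 := by
      have hjets : ∀ᶠ t in 𝓝 (0 : ℂ), ∀ v ∈ w.support, ∀ g' : Sym M,
          g'.1 ∈ insert x (S.erase x ∪ marks M) →
            jet (g (v ())) (st.collide x (.marked k) t) g' =
              collideJet (P (v ())) x (.marked k) t g' :=
        (Filter.eventually_all_finset _).2 fun v _ => hgc (v ()) x k hch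
      filter_upwards [approach_le _ hjets, hst.collide (hS x hxS) hD.2.2.1] with t ht hval
      have hins : insert x (S.erase x ∪ marks M) = S ∪ marks M := by
        rw [← Finset.insert_union, Finset.insert_erase hxS]
      rw [hins] at ht
      have h1 : ∀ v ∈ w.support, w v * evalAt (g (v ())) X (st.collide x (.marked k) t) =
          ∑ p ∈ X.coeff.support, X.coeff p (st.collide x (.marked k) t) *
            (w v * monoVal (collideJet (P (v ())) x (.marked k) t) p) := by
        intro v hv
        rw [evalAt_eq, evalJet_congr hX _ (ht v hv), evalJet_apply, Finsupp.sum, Finset.mul_sum]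
        exact Finset.sum_congr rfl fun p _ => by ring
      rw [Finset.sum_congr rfl h1, Finset.sum_comm]
      refine Finset.sum_eq_zero fun p hp => ?_
      rw [← Finset.mul_sum]
      by_cases hpc : X.coeff p (st.collide x (.marked k) t) = 0
      · rw [hpc, zero_mul]
      have hp2 := h _ hval p hpc
      obtain ⟨Q, hQ, hQv⟩ := monoVal_line (collideJet (jetPoly N j) x (.marked k) t)
        (fun g : Sym M => if ((if g.1 = x then .marked k else g.1) = y ∧ g.2.1 = s) ∧ g.2.2 = 0
          then (1 : ℂ) else 0) p
      have hfreq : (p.2.sum fun z a => a * (fun g : Sym M =>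
          if ((if g.1 = x then .marked k else g.1) = y ∧ g.2.1 = s) ∧ g.2.2 = 0 then (1 : ℂ) else 0)
            (z.1, z.2, 0)) = c := by
        have h2 : ∀ (z : Pt M × Bool) (a : ℂ), a * (fun g : Sym M =>
            if ((if g.1 = x then .marked k else g.1) = y ∧ g.2.1 = s) ∧ g.2.2 = 0
              then (1 : ℂ) else 0) (z.1, z.2, 0) = (if z = (y, s) then a else 0) +
                if z = (x, s) then (if y = .marked k then a else 0) else 0 := by
          rintro ⟨z, s'⟩ a
          by_cases hzx : z = x
          · have hzy : z ≠ y := fun e => hyx (e ▸ hzx)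
            subst hzx
            by_cases hyk : y = .marked k
            · simp [hyk, (hS _ hxS).ne_marked k]
            · simp [hyk, hzy, Ne.symm hyk]
          · simp [hzx, Prod.ext_iff]
        refine (Finset.sum_congr rfl fun z _ => h2 z _).trans ?_
        simp only [Finset.sum_add_distrib, Finset.sum_ite_eq']
        rw [hc, ← hp2 y hyT s, ← hp2 x hxT s]
        congr 1
        · split_ifs with h3
          · rfl
          · exact (Finsupp.notMem_support_iff.1 h3).symm
        · split_ifs with h3 h4 h4
          · rfl
          · rfl
          · exact (Finsupp.notMem_support_iff.1 ‹_›).symm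
          · rfl
      rw [hfreq] at hQv
      have h3 := hw Q (hQ.trans (hdeg p (Finset.mem_union_left _ hp))) c
        (Finset.mem_insert_self _ _)
      rw [if_neg (Ne.symm hne)] at h3
      simp only [hPc, hQv]
      exact mul_eq_zero_of_right _ h3
    have h1 := hD.sum_eq_zero hst w.support (fun v => w v) (h := fun v => g (v ()))
      (fun v _ => hgt (v ())) h0 I
    have h2 : ∀ v ∈ w.support, w v * evalAt (g (v ())) (D I) st =
        ∑ p ∈ (D I).coeff.support, (D I).coeff p st * (w v * monoVal (polyJet (P (v ()))) p) := by
      intro v _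
      rw [evalAt_eq, evalJet_congr hDI _ (hgj (v ())), evalJet_apply, Finsupp.sum, Finset.mul_sum]
      exact Finset.sum_congr rfl fun p _ => by ring
    rw [Finset.sum_congr rfl h2, Finset.sum_comm] at h1
    rw [Finset.sum_filter]
    refine Eq.trans (Finset.sum_congr rfl fun p hp => ?_) h1
    rw [← Finset.mul_sum]
    obtain ⟨Q, hQ, hQv⟩ := monoVal_line (polyJet (jetPoly N j))
      (fun g : Sym M => if (g.1 = y ∧ g.2.1 = s) ∧ g.2.2 = 0 then (1 : ℂ) else 0) p
    have hfreq : (p.2.sum fun z a => a * (fun g : Sym M =>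
        if (g.1 = y ∧ g.2.1 = s) ∧ g.2.2 = 0 then (1 : ℂ) else 0) (z.1, z.2, 0)) = p.2 (y, s) := by
      have h2 : ∀ (z : Pt M × Bool) (a : ℂ), a * (fun g : Sym M =>
          if (g.1 = y ∧ g.2.1 = s) ∧ g.2.2 = 0 then (1 : ℂ) else 0) (z.1, z.2, 0) =
            if z = (y, s) then a else 0 := by
        rintro ⟨z, s'⟩ a
        simp [Prod.ext_iff]
      refine (Finset.sum_congr rfl fun z _ => h2 z _).trans ?_
      simp only [Finset.sum_ite_eq']
      split_ifs with h3
      · rfl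
      · exact (Finsupp.notMem_support_iff.1 h3).symm
    rw [hfreq] at hQv
    have h3 := hw Q (hQ.trans (hdeg p (Finset.mem_union_right _ hp))) (p.2 (y, s))
      (Finset.mem_insert_of_mem (Finset.mem_image_of_mem
        (fun p : (Sym M →₀ ℕ) × Expo M => p.2 (y, s)) hp))
    simp only [hPj, hQv]
    rw [Finsupp.sum] at h3
    rw [h3]
    split_ifs with h4
    · have h5 := hQv 0
      rw [zero_smul, add_zero, mul_zero, Complex.exp_zero, mul_one] at h5
      rw [← h5]
      congr 1
      exact (monoVal_congr (fun g hg => polyJet_jetPoly N j (hDN p hp g hg))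
        fun z hz => polyJet_jetPoly N j hN).symm
    · rw [mul_zero]
  obtain ⟨w', hw'⟩ := exists_monoVal_weights
    ((D I).coeff.support.filter fun p => p.2 (y, s) = γ₀) p₀
  have hp₀s : p₀ ∈ (D I).coeff.support := by
    by_contra h1
    rw [Finsupp.notMem_support_iff.1 h1] at hp₀
    exact hp₀ rfl
  have hsum : ∑ j ∈ w'.support, w' j * ∑ p ∈ (D I).coeff.support with p.2 (y, s) = γ₀,
      (D I).coeff p st * monoVal j p = (D I).coeff p₀ st := by
    simp only [Finset.mul_sum]
    rw [Finset.sum_comm, Finset.sum_eq_single p₀]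
    · have := hw' p₀ (Finset.mem_filter.2 ⟨hp₀s, rfl⟩)
      rw [if_pos rfl, Finsupp.sum] at this
      calc _ = (D I).coeff p₀ st * ∑ j ∈ w'.support, w' j * monoVal j p₀ := by
            rw [Finset.mul_sum]; exact Finset.sum_congr rfl fun j _ => by ring
        _ = _ := by rw [this, mul_one]
    · intro p hp hpp
      have := hw' p hp
      rw [if_neg hpp, Finsupp.sum] at this
      calc _ = (D I).coeff p st * ∑ j ∈ w'.support, w' j * monoVal j p := by
            rw [Finset.mul_sum]; exact Finset.sum_congr rfl fun j _ => by ring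
        _ = _ := by rw [this, mul_zero]
    · intro h1
      exact absurd ((Finset.mem_filter (p := fun p : (Sym M →₀ ℕ) × Expo M =>
        p.2 (y, s) = γ₀)).2 ⟨hp₀s, rfl⟩) h1
  apply hp₀
  rw [← hsum]
  exact Finset.sum_eq_zero fun j _ => by rw [key j, mul_zero]

/-! ### Interpolation at a pair of colliding points -/

theorem eval_iterate_derivative_of_dvd {N m : ℕ} (hm : m < N) {c : ℂ} {p : Polynomial ℂ}
    (h : (Polynomial.X - Polynomial.C c) ^ N ∣ p) : ((Polynomial.derivative^[m]) p).eval c = 0 := by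
  refine Polynomial.eval_eq_zero_of_dvd_of_eval_eq_zero
    (Polynomial.pow_sub_dvd_iterate_derivative_of_pow_dvd m h) ?_
  simp [Nat.sub_ne_zero_of_lt hm]

/-- The Hermite interpolation polynomials for jets of order `N` at two points. -/
theorem exists_hermite (N : ℕ) {c c' : ℂ} (hc : c ≠ c') (m : ℕ) : ∃ A : Polynomial ℂ,
    ∀ n < N, ((Polynomial.derivative^[n]) A).eval c = (if n = m then 1 else 0) ∧
      ((Polynomial.derivative^[n]) A).eval c' = 0 := by
  obtain ⟨u, v, huv⟩ : IsCoprime ((Polynomial.X - Polynomial.C c) ^ N)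
      ((Polynomial.X - Polynomial.C c') ^ N) :=
    (Polynomial.isCoprime_X_sub_C_of_isUnit_sub (sub_ne_zero.2 hc).isUnit).pow
  let T : Polynomial ℂ := Polynomial.C (1 / (m.factorial : ℂ)) * (Polynomial.X - Polynomial.C c) ^ m
  refine ⟨T * (v * (Polynomial.X - Polynomial.C c') ^ N), fun n hn => ⟨?_, ?_⟩⟩
  · have h1 : T * (v * (Polynomial.X - Polynomial.C c') ^ N) =
        T + -(T * u) * (Polynomial.X - Polynomial.C c) ^ N := by
      linear_combination T * huv
    rw [h1, iterate_map_add, Polynomial.eval_add,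
      eval_iterate_derivative_of_dvd hn (dvd_mul_left _ _), add_zero,
      Polynomial.iterate_derivative_C_mul, Polynomial.iterate_derivative_X_sub_pow]
    rcases lt_trichotomy n m with h | h | h
    · simp [h.ne, Nat.sub_ne_zero_of_lt h]
    · subst h
      simp [n.factorial_ne_zero, Nat.descFactorial_self]
    · simp [h.ne', Nat.descFactorial_of_lt h]
  · exact eval_iterate_derivative_of_dvd hn
      (dvd_mul_of_dvd_right (dvd_mul_left _ _) _)

/-- The `m`-th derivative of `z ^ n`. -/
theorem eval_iterate_derivative_X_pow (n m : ℕ) (z : ℂ) :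
    ((Polynomial.derivative^[m]) (Polynomial.X ^ n : Polynomial ℂ)).eval z =
      n.descFactorial m * z ^ (n - m) := by
  rw [Polynomial.iterate_derivative_X_pow_eq_natCast_mul]
  simp

/-- Coefficients of polynomials with prescribed jets at the points `0` and `1`. -/
theorem exists_hermite_coeff (N : ℕ) : ∃ (K : ℕ) (a : Bool → ℕ → Fin K → ℂ),
    ∀ ε, ∀ m < N, ∀ ε', ∀ n < N,
      ∑ i, a ε m i * ((i : ℕ).descFactorial n * (ε'.toNat : ℂ) ^ ((i : ℕ) - n)) =
        if ε' = ε ∧ n = m then 1 else 0 := by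
  have hne : ∀ ε : Bool, (ε.toNat : ℂ) ≠ ((!ε).toNat : ℂ) := by
    rintro (_ | _) <;> simp
  choose A hA using fun (ε : Bool) m => exists_hermite N (hne ε) m
  refine ⟨(Finset.univ ×ˢ Finset.range N).sup (fun q => (A q.1 q.2).natDegree) + 1,
    fun ε m i => (A ε m).coeff i, fun ε m hm ε' n hn => ?_⟩
  have hdeg : (A ε m).natDegree <
      (Finset.univ ×ˢ Finset.range N).sup (fun q => (A q.1 q.2).natDegree) + 1 :=
    Nat.lt_succ_of_le (Finset.le_sup (b := (ε, m))
      (f := fun q : Bool × ℕ => (A q.1 q.2).natDegree)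
      (Finset.mem_product.2 ⟨Finset.mem_univ ε, Finset.mem_range.2 hm⟩))
  have h1 : ((Polynomial.derivative^[n]) (A ε m)).eval (ε'.toNat : ℂ) =
      if ε' = ε ∧ n = m then 1 else 0 := by
    rcases eq_or_ne ε' ε with rfl | h
    · simp [(hA _ m n hn).1]
    · have h2 : ε' = !ε := by cases ε <;> cases ε' <;> simp_all
      rw [if_neg fun h3 => h h3.1, h2]
      exact (hA ε m n hn).2
  rw [← h1]
  conv_rhs => rw [(A ε m).as_sum_range' _ hdeg]
  rw [Polynomial.iterate_derivative_sum, Polynomial.eval_finsetSum, Finset.sum_range]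
  refine Finset.sum_congr rfl fun i _ => ?_
  rw [← Polynomial.C_mul_X_pow_eq_monomial, Polynomial.iterate_derivative_C_mul,
    Polynomial.eval_mul, Polynomial.eval_C, eval_iterate_derivative_X_pow]

/-- The rescaled interpolation polynomials: prescribed jets at the points `0` and `τ`. -/
theorem hermite_rescale {N K : ℕ} {a : Bool → ℕ → Fin K → ℂ}
    (ha : ∀ ε, ∀ m < N, ∀ ε', ∀ n < N,
      ∑ i, a ε m i * ((i : ℕ).descFactorial n * (ε'.toNat : ℂ) ^ ((i : ℕ) - n)) =
        if ε' = ε ∧ n = m then 1 else 0)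
    (v : Bool → ℕ → ℂ) {τ : ℂ} (hτ : τ ≠ 0) (ε' : Bool) {n : ℕ} (hn : n < N) :
    ∑ i, (∑ ε, ∑ m ∈ Finset.range N, v ε m * a ε m i * (τ ^ m / τ ^ (i : ℕ))) *
      ((i : ℕ).descFactorial n * (τ * (ε'.toNat : ℂ)) ^ ((i : ℕ) - n)) = v ε' n := by
  have h1 : ∀ (i : Fin K) (m : ℕ), τ ^ m / τ ^ (i : ℕ) *
      ((i : ℕ).descFactorial n * (τ * (ε'.toNat : ℂ)) ^ ((i : ℕ) - n)) =
      τ ^ m / τ ^ n * ((i : ℕ).descFactorial n * (ε'.toNat : ℂ) ^ ((i : ℕ) - n)) := by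
    intro i m
    rcases lt_or_ge (i : ℕ) n with h | h
    · simp [Nat.descFactorial_of_lt h]
    · rw [mul_pow, ← Nat.sub_add_cancel h, Nat.add_sub_cancel, pow_add]
      field_simp
  have h2 : ∀ ε, ∀ m ∈ Finset.range N, ∑ i, v ε m * a ε m i * (τ ^ m / τ ^ (i : ℕ)) *
      ((i : ℕ).descFactorial n * (τ * (ε'.toNat : ℂ)) ^ ((i : ℕ) - n)) =
      if ε' = ε then (if n = m then v ε' n else 0) else 0 := by
    intro ε m hm
    have h3 : ∀ i, v ε m * a ε m i * (τ ^ m / τ ^ (i : ℕ)) *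
        ((i : ℕ).descFactorial n * (τ * (ε'.toNat : ℂ)) ^ ((i : ℕ) - n)) =
        v ε m * (τ ^ m / τ ^ n) *
          (a ε m i * ((i : ℕ).descFactorial n * (ε'.toNat : ℂ) ^ ((i : ℕ) - n))) := fun i => by
      rw [mul_assoc, h1]
      ring
    simp only [h3]
    rw [← Finset.mul_sum, ha ε m (Finset.mem_range.1 hm) ε' n hn]
    by_cases h4 : ε' = ε
    · by_cases h5 : n = m
      · subst h4 h5
        simp [hτ]
      · simp [h5]
    · simp [h4]
  simp only [Finset.sum_mul]
  rw [Finset.sum_comm]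
  refine (Finset.sum_congr rfl fun ε _ =>
    Finset.sum_comm.trans (Finset.sum_congr rfl (h2 ε))).trans ?_
  have h6 : ∀ ε : Bool,
      (∑ m ∈ Finset.range N, if ε' = ε then (if n = m then v ε' n else 0) else 0) =
      if ε' = ε then v ε' n else 0 := fun ε => by
    split_ifs
    · rw [Finset.sum_ite_eq, if_pos (Finset.mem_range.2 hn)]
    · simp
  simp only [h6]
  simp

/-- The values of polynomials of bounded degree are determined by their values at finitely many
points. -/
theorem exists_interpolation (σ : Type*) [Fintype σ] [DecidableEq σ] (d : ℕ) :
    ∃ (s : Finset (σ →₀ ℕ)) (w : (σ →₀ ℕ) → (σ → ℂ) →₀ ℂ), ∀ Q : MvPolynomial σ ℂ,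
      Q.totalDegree ≤ d → ∀ b : σ → ℂ, MvPolynomial.eval b Q =
        ∑ m ∈ s, (∏ i, b i ^ m i) * (w m).sum fun b' c => c * MvPolynomial.eval b' Q := by
  classical
  let s : Finset (σ →₀ ℕ) := Finset.Icc 0 (Finsupp.equivFunOnFinite.symm fun _ => d)
  let lbl : (σ →₀ ℕ) → (σ →₀ ℕ) × (σ →₀ ℂ) := fun m => (m, 0)
  have hlbl : ∀ m m', lbl m = lbl m' ↔ m = m' := fun m m' => by simp [lbl]
  have hval : ∀ m b, expMono (lbl m) b = ∏ i, b i ^ m i := by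
    intro m b
    simp only [expMono, lbl, Finsupp.sum_zero_index, Complex.exp_zero, mul_one]
    exact Finsupp.prod_fintype _ _ fun i => pow_zero _
  choose w hw using fun m => exists_weights (s.image lbl) expMono (expMono_independent _) (lbl m)
  refine ⟨s, w, fun Q hQ b => ?_⟩
  have hsup : Q.support ⊆ s := by
    intro m hm
    refine Finset.mem_Icc.2 ⟨zero_le, fun i => ?_⟩
    refine le_trans ?_ ((MvPolynomial.le_totalDegree hm).trans hQ)
    exact (Finsupp.le_degree i m).trans (le_of_eq rfl)
  have hev : ∀ b, MvPolynomial.eval b Q = ∑ m ∈ s, Q.coeff m * ∏ i, b i ^ m i := by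
    intro b
    rw [MvPolynomial.eval_eq']
    exact Finset.sum_subset hsup fun m _ hm => by
      rw [MvPolynomial.notMem_support_iff.1 hm, zero_mul]
  rw [hev]
  refine Finset.sum_congr rfl fun m hm => ?_
  rw [mul_comm]
  congr 1
  simp only [hev, Finsupp.sum, Finset.mul_sum]
  rw [Finset.sum_comm, Finset.sum_eq_single m]
  · have := hw m (lbl m) (Finset.mem_image_of_mem lbl hm)
    simp only [if_true, Finsupp.sum, hval] at this
    calc Q.coeff m = Q.coeff m * ∑ b' ∈ (w m).support, w m b' * ∏ i, b' i ^ m i := by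
          rw [this, mul_one]
      _ = _ := by
          rw [Finset.mul_sum]
          exact Finset.sum_congr rfl fun _ _ => by ring
  · intro m' hm' hne
    have := hw m (lbl m') (Finset.mem_image_of_mem lbl hm')
    rw [if_neg ((hlbl _ _).not.2 hne)] at this
    simp only [Finsupp.sum, hval] at this
    calc _ = Q.coeff m' * ∑ b' ∈ (w m).support, w m b' * ∏ i, b' i ^ m' i := by
          rw [Finset.mul_sum]
          exact Finset.sum_congr rfl fun _ _ => by ring
      _ = 0 := by rw [this, mul_zero]
  · exact fun h => absurd hm h

/-- The charge of the points of `U` in the exponent of a Wick exponential, at a jet. -/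
def chargeForm (U : Finset (Pt M)) (e : Pt M → Bool → ℂ) (j : Sym M → ℂ) : ℂ :=
  ∑ z ∈ U ×ˢ Finset.univ, e z.1 z.2 * j (z.1, z.2, 0)

/-- On an affine family of jets that is constant away from the points of `U`, a field with definite
charges at these points is a polynomial times an exponential. -/
theorem ChargedOn.exists_mvPolynomial {T S U : Finset (Pt M)} {X : Fock M} {e : Pt M → Bool → ℂ}
    (h : ChargedOn T S X e) (hU : U ⊆ T) {st : State M} (hst : st.Valid S) {σ : Type*} [Fintype σ]
    (J : Sym M → ℂ) (Δ : σ → Sym M → ℂ) (hΔ : ∀ i g, g.1 ∉ U → Δ i g = 0) :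
    ∃ Q : MvPolynomial σ ℂ, Q.totalDegree ≤ (X.coeff.support.sup fun p => p.1.degree) ∧
      ∀ b : σ → ℂ, evalJet st (fun g => J g + ∑ i, b i * Δ i g) X *
        Complex.exp (-chargeForm U e fun g => J g + ∑ i, b i * Δ i g) = MvPolynomial.eval b Q := by
  classical
  refine ⟨∑ p ∈ X.coeff.support, MvPolynomial.C (X.coeff p st * Complex.exp
      (∑ z ∈ p.2.support with z.1 ∉ U, p.2 z * J (z.1, z.2, 0))) *
        ∏ g ∈ p.1.support, (MvPolynomial.C (J g) +
          ∑ i, MvPolynomial.X i * MvPolynomial.C (Δ i g)) ^ p.1 g, ?_, fun b => ?_⟩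
  · refine MvPolynomial.totalDegree_finsetSum_le fun p hp => ?_
    refine (MvPolynomial.totalDegree_mul _ _).trans ?_
    rw [MvPolynomial.totalDegree_C, zero_add]
    refine (MvPolynomial.totalDegree_finsetProd _ _).trans (le_trans ?_
      (Finset.le_sup (f := fun p : (Sym M →₀ ℕ) × Expo M => p.1.degree) hp))
    refine Finset.sum_le_sum fun g _ => ?_
    refine (MvPolynomial.totalDegree_pow _ _).trans
      ((Nat.mul_le_mul_left _ ?_).trans (mul_one _).le)
    refine (MvPolynomial.totalDegree_add _ _).trans (max_le ?_ ?_)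
    · rw [MvPolynomial.totalDegree_C]
      exact zero_le
    · refine MvPolynomial.totalDegree_finsetSum_le fun i _ => ?_
      refine (MvPolynomial.totalDegree_mul _ _).trans ?_
      rw [MvPolynomial.totalDegree_C, MvPolynomial.totalDegree_X, add_zero]
  · set j : Sym M → ℂ := fun g => J g + ∑ i, b i * Δ i g with hj
    rw [evalJet_apply, Finsupp.sum, Finset.sum_mul, map_sum]
    refine Finset.sum_congr rfl fun p _ => ?_
    by_cases hp : X.coeff p st = 0
    · rw [hp]
      simp
    have hexp : (p.2.sum fun z a => a * j (z.1, z.2, 0)) =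
        chargeForm U e j + ∑ z ∈ p.2.support with z.1 ∉ U, p.2 z * J (z.1, z.2, 0) := by
      rw [Finsupp.sum, ← Finset.sum_filter_add_sum_filter_not _ fun z : Pt M × Bool => z.1 ∈ U]
      congr 1
      · rw [chargeForm]
        refine (Finset.sum_subset (fun z hz => Finset.mem_product.2
          ⟨(Finset.mem_filter.1 hz).2, Finset.mem_univ _⟩) fun z hz hz' => ?_).trans
            (Finset.sum_congr rfl fun z hz => ?_)
        · have h1 : z ∉ p.2.support := fun h1 =>
            hz' (Finset.mem_filter.2 ⟨h1, (Finset.mem_product.1 hz).1⟩)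
          rw [Finsupp.notMem_support_iff.1 h1, zero_mul]
        · rw [← h st hst p hp z.1 (hU (Finset.mem_product.1 hz).1) z.2]
      · refine Finset.sum_congr rfl fun z hz => ?_
        simp [hj, hΔ _ (z.1, z.2, 0) (Finset.mem_filter.1 hz).2]
    rw [monoVal, hexp, Complex.exp_add, Complex.exp_neg]
    simp only [map_mul, map_prod, map_pow, map_add, map_sum, MvPolynomial.eval_C,
      MvPolynomial.eval_X]
    rw [Finsupp.prod]
    have := Complex.exp_ne_zero (chargeForm U e j)
    field_simp
    rfl

/-! ### The coefficients of a field with an iterated expansion -/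

theorem IteratedOPE.admissible {L : Punctures M} {S : Finset (Pt M)} {X : Fock M}
    {C : List ScaleIndex → Fock M} (h : IteratedOPE L S X C) : Admissible L S := by
  induction L generalizing S X C with
  | nil => trivial
  | cons o L ih =>
    obtain ⟨x, k⟩ := o
    obtain ⟨D, hD, hC⟩ := h
    exact ⟨hD.1, hD.2.2.1, ih (hC ScaleIndex.zero)⟩

theorem Admissible.mem {L : Punctures M} {S : Finset (Pt M)} (h : Admissible L S)
    {o : Pt M × Fin M.numMarks} (ho : o ∈ L) : o.1 ∈ S := by
  induction L generalizing S with
  | nil => simp at ho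
  | cons o' L ih =>
    obtain ⟨x, k⟩ := o'
    obtain ⟨hx, -, h'⟩ := h
    rcases List.mem_cons.1 ho with rfl | ho
    · exact hx
    · exact Finset.mem_of_mem_erase (ih h' ho)

theorem evalJet_mem {B : Subalgebra ℂ (Coeff M)} {X : Fock M}
    (hX : ∀ p ∈ X.coeff.support, X.coeff p ∈ B) (j : Sym M → ℂ) :
    (fun st => evalJet st j X) ∈ B := by
  have : (fun st => evalJet st j X) = ∑ p ∈ X.coeff.support, monoVal j p • X.coeff p := by
    funext st
    rw [evalJet_apply, Finsupp.sum, Finset.sum_apply]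
    exact Finset.sum_congr rfl fun p _ => mul_comm _ _
  rw [this]
  exact Subalgebra.sum_mem _ fun p hp => B.smul_mem (hX p hp) _

/-- The jets depend affinely on the coefficients of the germs. -/
theorem collideJet_combination {σ : Type*} [Fintype σ] (P₀ : Pt M → Bool → Polynomial ℂ)
    (E : σ → Pt M → Bool → Polynomial ℂ) (b : σ → ℂ) (x y : Pt M) (t : ℂ) :
    collideJet (fun z s => P₀ z s + ∑ i, Polynomial.C (conjSign s (b i)) * E i z s) x y t =
      fun g => collideJet P₀ x y t g + ∑ i, b i * collideJet (E i) x y t g := by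
  funext g
  unfold collideJet polyJet
  split_ifs <;>
  simp only [iterate_map_add, Polynomial.iterate_derivative_sum,
    Polynomial.iterate_derivative_C_mul, Polynomial.eval_add, Polynomial.eval_finsetSum, Polynomial.eval_mul,
    Polynomial.eval_C, map_add, map_sum, map_mul, conjSign_conjSign]

/-- The correlations of a field with test functions whose germs are given polynomials have
expansions, whose coefficients come from those of its operator product expansion. -/
theorem HasOPE.expands_collideJet {A B : Subalgebra ℂ (Coeff M)} {S : Finset (Pt M)} {X : Fock M}
    {x : Pt M} {k : Fin M.numMarks} {D : ScaleIndex → Fock M}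
    (hX : X ∈ fieldAlg B (labelsOn (S ∪ marks M)))
    (hD : HasOPE S X x (.marked k) (S.erase x ∪ marks M) D)
    (hA : ∀ I j, (fun st => evalJet st j (D I)) ∈ A) (P : Pt M → Bool → Polynomial ℂ) :
    Expands (approach (.marked k : Pt M)) (evState (S.erase x)) A fun st t =>
      evalJet (st.1.collide x (.marked k) t) (collideJet P x (.marked k) t) X := by
  classical
  obtain ⟨hxS, -, hch, hDf, F, hF, hexp⟩ := hD
  refine ⟨{I // D I ≠ 0}, Subtype.val, fun I st => evalJet st (polyJet P) (D I),
    fun N => (F N).subtype fun I => D I ≠ 0, fun N I => ?_, fun I => hA _ _, ?_⟩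
  · rw [Finset.mem_subtype, hF]
    exact ⟨fun h => h.2, fun h => ⟨I.2, h⟩⟩
  · rintro ⟨st, hst⟩ N
    obtain ⟨h, ht, hj, hc⟩ := exists_poly_test hst P
    refine (hexp st hst h ht N).congr' ?_ EventuallyEq.rfl
    filter_upwards [approach_le _ (hc x k (chart_eq_of_chartIndex_eq hch))] with t htj
    rw [← Finset.insert_union, Finset.insert_erase hxS] at htj
    rw [evalAt_eq, evalJet_congr hX _ htj]
    congr 1
    rw [Finset.sum_subtype_of_mem (f := fun I => I.toFun t * evState (S.erase x) ⟨st, hst⟩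
      fun st => evalJet st (polyJet P) (D I)) fun I hI => ((hF _ _).1 hI).1]
    refine Finset.sum_congr rfl fun I _ => ?_
    rw [evalAt_eq, evState_apply, evalJet_congr (fieldOn_union_marks_iff.1 (hDf I)) _ hj]

/-- The factor due to the charges of a field has an expansion, along test functions with polynomial
germs. -/
theorem expands_exp_chargeForm {A : Subalgebra ℂ (Coeff M)} {S : Finset (Pt M)} {x : Pt M}
    {k : Fin M.numMarks} (U : Finset (Pt M)) (e : Pt M → Bool → ℂ)
    (P : Pt M → Bool → Polynomial ℂ) :
    Expands (approach (.marked k : Pt M)) (evState S) A fun _ t =>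
      Complex.exp (-chargeForm U e (collideJet P x (.marked k) t)) := by
  have hl := approach_marked_le (M := M) k
  simp only [chargeForm, ← Finset.sum_neg_distrib, Complex.exp_sum]
  refine Expands.prod hl _ fun z _ => ?_
  obtain ⟨y, s⟩ := z
  by_cases hy : y = x
  · refine (Expands.analytic (ev := evState S) (A := A) hl s (f := fun _ r =>
      Complex.exp (conjSign s (-e y s) * (P (.marked k) s).eval r))
      (fun _ => (analyticAt_const.mul (analyticAt_eval _ _)).cexp)
      (c := fun n => algebraMap ℂ _ (conjSign s (iteratedDeriv n (fun r =>
        Complex.exp (conjSign s (-e y s) * (P (.marked k) s).eval r)) 0)))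
      (fun n => A.algebraMap_mem _) fun ω n => AlgHom.commutes _ _).congr' fun ω =>
        Eventually.of_forall fun t => ?_
    simp only [collideJet, hy, if_true, Function.iterate_zero, id]
    rw [← conjSign_exp, map_mul, conjSign_conjSign, neg_mul]
  · refine (Expands.const (ev := evState S) hl (A.algebraMap_mem
      (Complex.exp (-(e y s * polyJet P (y, s, 0)))))).congr' fun ω =>
        Eventually.of_forall fun t => ?_
    rw [AlgHom.commutes]
    simp only [collideJet, hy, if_false]
    rfl

/-- If a field with definite charges at the points involved has an iterated operator product
expansion, then its evaluations at constant jets have iterated expansions. Such an evaluation is not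
a correlation, as the jets at the colliding points do not come from a fixed test function.
It is recovered from correlations by interpolation: as the germ at the marked point ranges over
polynomials, the correlation is a polynomial in their coefficients, up to the factor due to the
charges; its values at finitely many fixed germs determine that at the germ, depending on `t`, which
has the given jets at both points. -/
theorem IteratedOPE.evalJet_mem (L : Punctures M) : ∀ {S T : Finset (Pt M)} {X : Fock M}
    {e : Pt M → Bool → ℂ} {C : List ScaleIndex → Fock M}, (∀ x ∈ S, x.IsNode) →
    FieldOn (S ∪ marks M) X → ChargedOn T S X e → T ⊆ S ∪ marks M → (∀ o ∈ L, o.1 ∈ T) →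
    marks M ⊆ T → IteratedOPE L S X C → ∀ j, (fun st => evalJet st j X) ∈ iterAlg L S := by
  induction L with
  | nil =>
    intro S T X e C hS hX _ _ _ _ _ j
    exact CoulombGas.evalJet_mem
      (fun p hp => (fieldOn_union_marks_iff.1 hX p hp).2) j
  | cons o L ih =>
    intro S T X e C hS hX he hT hL hmT hC j
    have hadm := hC.admissible
    obtain ⟨x, k⟩ := o
    obtain ⟨D, hD, hDC⟩ := hC
    have hX' := fieldOn_union_marks_iff.1 hX
    have hxT : x ∈ T := hL (x, k) List.mem_cons_self
    have hkT : Pt.marked k ∈ T := hmT (mark_mem_marks k)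
    have hxS := hD.1
    have hxm := notMem_marks (hS x hxS)
    have hkx : Pt.marked k ≠ x := fun h => hxm (h ▸ mark_mem_marks k)
    have hl := approach_marked_le (M := M) k
    have hDA : ∀ I j, (fun st => evalJet st j (D I)) ∈ iterAlg L (S.erase x) := by
      intro I j
      have hDI := hD.2.2.2.1 I
      refine ih (fun y hy => hS y (Finset.mem_of_mem_erase hy)) hDI
        (he.coeff hS hX' hD hxT hT I (fieldOn_union_marks_iff.1 hDI)) ?_ ?_ ?_ (hDC I) j
      · intro y hy
        obtain ⟨hyx, hyT⟩ := Finset.mem_erase.1 hy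
        rcases Finset.mem_union.1 (hT hyT) with h | h
        · exact Finset.mem_union_left _ (Finset.mem_erase.2 ⟨hyx, h⟩)
        · exact Finset.mem_union_right _ h
      · intro o ho
        exact Finset.mem_erase.2 ⟨(Finset.mem_erase.1 (hadm.2.2.mem ho)).1,
          hL o (List.mem_cons_of_mem _ ho)⟩
      · intro y hy
        exact Finset.mem_erase.2 ⟨fun h => hxm (h ▸ hy), hmT hy⟩
    refine ⟨CoulombGas.evalJet_mem (fun p hp => (hX' p hp).2) j, ?_⟩
    obtain ⟨N, hN, hXN⟩ := exists_jet_order X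
    obtain ⟨K, a, ha⟩ := exists_hermite_coeff N
    obtain ⟨ms, w, hw⟩ := exists_interpolation (Bool × Fin K)
      (X.coeff.support.sup fun p => p.1.degree)
    let U : Finset (Pt M) := {x, .marked k}
    have hU : U ⊆ T := by
      intro y hy
      rcases Finset.mem_insert.1 hy with rfl | hy
      · exact hxT
      · rwa [Finset.mem_singleton.1 hy]
    let P₀ : Pt M → Bool → Polynomial ℂ := fun y s => if y = .marked k then 0 else jetPoly N j y s
    let E : Bool × Fin K → Pt M → Bool → Polynomial ℂ := fun i y s =>
      if y = .marked k ∧ s = i.1 then Polynomial.X ^ (i.2 : ℕ) else 0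
    let P : (Bool × Fin K → ℂ) → Pt M → Bool → Polynomial ℂ := fun b y s =>
      P₀ y s + ∑ i, Polynomial.C (conjSign s (b i)) * E i y s
    let v : Bool → Bool → ℕ → ℂ := fun s ε m => j (if ε then x else .marked k, s, m)
    let bt : ℂ → Bool × Fin K → ℂ := fun t i => ∑ ε, ∑ m ∈ Finset.range N,
      v i.1 ε m * a ε m i.2 * (conjSign i.1 t ^ m / conjSign i.1 t ^ (i.2 : ℕ))
    -- the germs with the coefficients `bt t` have the jets `j` at both points
    have hbt : ∀ t ≠ 0, ∀ g : Sym M, g.2.2 < N →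
        collideJet (P (bt t)) x (.marked k) t g = j g := by
      rintro t ht ⟨y, s, n⟩ hn
      have hτ : conjSign s t ≠ 0 := (map_ne_zero _).2 ht
      have hform := congrFun (collideJet_combination P₀ E (bt t) x (.marked k) t) (y, s, n)
      refine hform.trans ?_
      have hpt : ∀ ε : Bool, y = (if ε then x else .marked k) →
          collideJet P₀ x (.marked k) t (y, s, n) +
            ∑ i, bt t i * collideJet (E i) x (.marked k) t (y, s, n) = j (y, s, n) := by
        intro ε hε
        have h0 : collideJet P₀ x (.marked k) t (y, s, n) = 0 := by
          cases ε
          · simp [collideJet, polyJet, hε, hkx, P₀]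
          · simp [collideJet, hε, P₀]
        have h1 : ∀ i : Bool × Fin K, collideJet (E i) x (.marked k) t (y, s, n) =
            if s = i.1 then ((i.2 : ℕ).descFactorial n *
              (conjSign s t * (ε.toNat : ℂ)) ^ ((i.2 : ℕ) - n) : ℂ) else 0 := by
          intro i
          by_cases hs : s = i.1
          · cases ε <;> simp [collideJet, polyJet, hε, hkx, E, hs, eval_iterate_derivative_X_pow]
          · cases ε <;>
            simp [collideJet, polyJet, hε, hkx, E, hs]
        rw [h0, zero_add]
        simp only [h1, mul_ite, mul_zero]
        rw [Fintype.sum_prod_type]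
        simp only
        rw [Finset.sum_comm]
        simp only [Finset.sum_ite_eq, Finset.mem_univ, if_true]
        have h2 := hermite_rescale ha (v s) hτ ε hn
        refine h2.trans ?_
        simp only [v, hε]
      by_cases hyx : y = x
      · exact hpt true hyx
      by_cases hyk : y = .marked k
      · exact hpt false hyk
      have h0 : collideJet P₀ x (.marked k) t (y, s, n) = j (y, s, n) := by
        rw [← polyJet_jetPoly N j hn]
        simp only [collideJet, hyx, if_false, polyJet, P₀, hyk]
      have h1 : ∀ i : Bool × Fin K, collideJet (E i) x (.marked k) t (y, s, n) = 0 := by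
        intro i
        simp [collideJet, polyJet, hyx, hyk, E]
      simp [h0, h1]
    have hexpand : Expands (approach (.marked k : Pt M)) (evState (S.erase x))
        (iterAlg L (S.erase x)) fun st t => Complex.exp (chargeForm U e j) *
          ∑ m ∈ ms, (∏ i, bt t i ^ m i) * ∑ b' ∈ (w m).support, w m b' *
            (evalJet (st.1.collide x (.marked k) t) (collideJet (P b') x (.marked k) t) X *
              Complex.exp (-chargeForm U e (collideJet (P b') x (.marked k) t))) := by
      have hconst : ∀ c : ℂ, Expands (approach (.marked k : Pt M)) (evState (S.erase x))
          (iterAlg L (S.erase x)) fun _ _ => c := fun c =>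
        (Expands.const hl (Subalgebra.algebraMap_mem _ c)).congr' fun ω =>
          Eventually.of_forall fun t => (AlgHom.commutes (evState (S.erase x) ω) c).symm
      refine (hconst _).mul hl (Expands.sum hl _ fun m _ => (Expands.prod hl _ fun i _ =>
        Expands.pow hl ?_ _).mul hl (Expands.sum hl _ fun b' _ => (hconst _).mul hl
          ((hD.expands_collideJet hX' hDA (P b')).mul hl (expands_exp_chargeForm U e (P b')))))
      refine Expands.sum hl _ fun ε _ => Expands.sum hl _ fun m _ =>
        (Expands.const_term hl (signIndex i.1 (m - (i.2 : ℕ)) 0) (v i.1 ε m * a ε m i.2)).congr'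
          fun ω => ?_
      filter_upwards [hl self_mem_nhdsWithin] with t ht
      rw [toFun_signIndex, pow_zero, mul_one, sub_mul, Complex.exp_sub, exp_nat_mul_log ht,
        exp_nat_mul_log ht, map_div₀, map_pow, map_pow]
    refine hexpand.congr' ?_
    rintro ⟨st, hst⟩
    filter_upwards [hl self_mem_nhdsWithin, hst.collide (hS x hxS) hD.2.2.1] with t ht hval
    obtain ⟨Q, hQ, hQb⟩ := he.exists_mvPolynomial hU hval (collideJet P₀ x (.marked k) t)
      (fun i => collideJet (E i) x (.marked k) t) (by
        intro i g hg
        simp only [U, Finset.mem_insert, Finset.mem_singleton, not_or] at hg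
        simp [collideJet, polyJet, hg.1, hg.2, E])
    have hQb' : ∀ b, evalJet (st.collide x (.marked k) t) (collideJet (P b) x (.marked k) t) X *
        Complex.exp (-chargeForm U e (collideJet (P b) x (.marked k) t)) = MvPolynomial.eval b Q :=
      fun b => by
        rw [← hQb, ← collideJet_combination]
    have h1 := hw Q hQ (bt t)
    simp only [← hQb', Finsupp.sum] at h1
    rw [← h1]
    have h2 : chargeForm U e (collideJet (P (bt t)) x (.marked k) t) = chargeForm U e j :=
      Finset.sum_congr rfl fun z _ => by rw [hbt t ht _ hN]
    have h3 : evalJet (st.collide x (.marked k) t) (collideJet (P (bt t)) x (.marked k) t) X =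
        evalJet (st.collide x (.marked k) t) j X :=
      evalJet_congr_order hX' hN hXN _ fun g _ hg => hbt t ht g hg
    rw [h2, h3, mul_left_comm, ← Complex.exp_add, add_neg_cancel, Complex.exp_zero, mul_one]

/-- The coefficients of a field with an iterated operator product expansion have iterated
expansions, if the field has definite charges at the points involved. -/
theorem IteratedOPE.mem_fieldAlg {L : Punctures M} {S T : Finset (Pt M)} {X : Fock M}
    {e : Pt M → Bool → ℂ} {C : List ScaleIndex → Fock M} (hS : ∀ x ∈ S, x.IsNode)
    (hX : FieldOn (S ∪ marks M) X) (he : ChargedOn T S X e) (hT : T ⊆ S ∪ marks M)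
    (hL : ∀ o ∈ L, o.1 ∈ T) (hmT : marks M ⊆ T) (hC : IteratedOPE L S X C) :
    X ∈ fieldAlg (iterAlg L S) (labelsOn (S ∪ marks M)) := by
  intro p hp
  refine ⟨(fieldOn_union_marks_iff.1 hX p hp).1, ?_⟩
  obtain ⟨w, hw⟩ := exists_coeff_weights X p
  have : X.coeff p = ∑ j ∈ w.support, w j • fun st => evalJet st j X := by
    funext st
    rw [hw, Finsupp.sum, Finset.sum_apply]
    rfl
  rw [this]
  exact Subalgebra.sum_mem _ fun j _ => Subalgebra.smul_mem _
    (IteratedOPE.evalJet_mem L hS hX he hT hL hmT hC j) _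

/-! ### Strings and the insertion of the background charge -/

theorem Pt.IsNode.notMem {S : Finset (Pt M)} (hS : ∀ x ∈ S, x.IsNode) {y : Pt M}
    (hy : y ∈ marks M) : y ∉ S := fun h => notMem_marks (hS y h) hy

/-- The translation of the symbols does not change the exponents of the Wick exponentials. -/
theorem exists_expo_of_mem_support_translate (c : Sym M → Coeff M) (X : Fock M)
    {p : (Sym M →₀ ℕ) × Expo M} (hp : p ∈ (translate c X).coeff.support) :
    ∃ q ∈ X.coeff.support, p.2 = q.2 := by
  classical
  by_contra hne
  push Not at hne
  refine (Finsupp.mem_support_iff.1 hp) ?_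
  let P : AddSubmonoid ((Sym M →₀ ℕ) × Expo M) := AddMonoidHom.mker (AddMonoidHom.snd _ _)
  have hsum : translate c X =
      ∑ q ∈ X.coeff.support, translate c (AddMonoidAlgebra.single q (X.coeff q)) := by
    conv_lhs => rw [← X.sum_coeff_single, map_finsuppSum]
    rfl
  rw [hsum]
  have hcoeff :
      (∑ q ∈ X.coeff.support, translate c (AddMonoidAlgebra.single q (X.coeff q))).coeff p =
      ∑ q ∈ X.coeff.support, (translate c (AddMonoidAlgebra.single q (X.coeff q))).coeff p := by
    simp
  rw [hcoeff]
  refine Finset.sum_eq_zero fun q hq => ?_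
  by_contra hpq
  have hA : nonrandom (X.coeff q) * (q.1.prod fun g n => (gauss g + nonrandom (c g)) ^ n) *
      nonrandom (fun st => Complex.exp (q.2.sum fun x a => a * c (x.1, x.2, 0) st)) ∈
        fieldAlg ⊤ P := by
    refine Subalgebra.mul_mem _ (Subalgebra.mul_mem _ (nonrandom_mem Algebra.mem_top)
      (Subalgebra.prod_mem _
      fun g _ => Subalgebra.pow_mem _ (Subalgebra.add_mem _ (single_mem rfl Algebra.mem_top)
        (nonrandom_mem Algebra.mem_top)) _)) (nonrandom_mem Algebra.mem_top)
  rw [translate_single, ← nonrandom_mul, ← mul_assoc, ← mul_assoc] at hpq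
  have h1 := AddMonoidAlgebra.support_coeff_mul_single_subset _ _ _
    (Finsupp.mem_support_iff.2 hpq)
  obtain ⟨r, hr, rfl⟩ := Finset.mem_image.1 h1
  have h2 : r.2 = 0 := (hA r hr).1
  exact hne q hq (by simp [h2])

theorem HasCharges.translate {L : Punctures M} {X : Fock M} {σ : Pt M → ℂ × ℂ}
    (h : HasCharges L X σ) (c : Sym M → Coeff M) : HasCharges L (translate c X) σ := by
  intro o ho p hp
  obtain ⟨q, hq, hpq⟩ := exists_expo_of_mem_support_translate c X hp
  rw [hpq]
  exact h o ho q hq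

/-- The coefficients of a field with definite charges that has an iterated expansion have iterated
expansions. -/
theorem HasCharges.mem_fieldAlg {L : Punctures M} {S : Finset (Pt M)} {X : Fock M}
    {σ : Pt M → ℂ × ℂ} {C : List ScaleIndex → Fock M} (hσ : HasCharges L X σ)
    (hS : ∀ x ∈ S, x.IsNode) (hX : FieldOn S X) (hC : IteratedOPE L S X C) :
    X ∈ fieldAlg (iterAlg L S) (labelsOn S) := by
  classical
  -- the nodes of `S` carry all charges of `X`, the marked points none
  let e : Pt M → Bool → ℂ := fun y s =>
    if y ∈ marks M then 0 else if s then Complex.I * (σ y).1 else -Complex.I * (σ y).2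
  have he : ChargedOn ((L.map fun o => o.1).toFinset ∪ marks M) S X e := by
    intro st _ p hp y hy s
    have hps : p ∈ X.coeff.support := by
      by_contra h
      rw [Finsupp.notMem_support_iff.1 h] at hp
      exact hp rfl
    by_cases hym : y ∈ marks M
    · simp only [e, if_pos hym]
      by_contra h
      exact Pt.IsNode.notMem hS hym ((hX p hps).2.1 (y, s) (Finsupp.mem_support_iff.2 h))
    · simp only [e, if_neg hym]
      obtain ⟨o, ho, rfl⟩ := List.mem_map.1
        (List.mem_toFinset.1 ((Finset.mem_union.1 hy).resolve_right hym))
      cases s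
      · exact (hσ o ho p hps).2
      · exact (hσ o ho p hps).1
  have hmem := hC.mem_fieldAlg hS (hX.mono Finset.subset_union_left) he ?_ ?_
    Finset.subset_union_right
  · exact fun p hp => ⟨(fieldOn_iff.1 hX p hp).1, (hmem p hp).2⟩
  · refine Finset.union_subset_union_left fun y hy => ?_
    obtain ⟨o, ho, rfl⟩ := List.mem_map.1 (List.mem_toFinset.1 hy)
    exact hC.admissible.mem ho
  · exact fun o ho => Finset.mem_union_left _ (List.mem_toFinset.2 (List.mem_map_of_mem ho))

/-- Fields whose evaluations at valid states agree have the same expansions. -/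
theorem HasOPE.congr {S T : Finset (Pt M)} {X X' : Fock M} {x : Pt M} {k : Fin M.numMarks}
    {D : ScaleIndex → Fock M} (h : HasOPE S X x (.marked k) T D) (hn : x.IsNode)
    (hX : ∀ st : State M, st.Valid S → ∀ j, evalJet st j X' = evalJet st j X) :
    HasOPE S X' x (.marked k) T D := by
  obtain ⟨hx, hne, hch, hT, F, hF, hexp⟩ := h
  refine ⟨hx, hne, hch, hT, F, hF, fun st hst g hg N => ?_⟩
  refine (hexp st hst g hg N).congr' ?_ EventuallyEq.rfl
  filter_upwards [hst.collide hn hch] with t ht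
  rw [evalAt_eq, evalAt_eq, hX _ ht]

theorem IteratedOPE.exists_congr {L : Punctures M} {S : Finset (Pt M)} {X X' : Fock M}
    {C : List ScaleIndex → Fock M} (hC : IteratedOPE L S X C) (hS : ∀ x ∈ S, x.IsNode)
    (hX : ∀ st : State M, st.Valid S → ∀ j, evalJet st j X' = evalJet st j X) :
    ∃ C', IteratedOPE L S X' C' := by
  cases L with
  | nil => exact ⟨fun _ => X', rfl⟩
  | cons o L =>
    obtain ⟨D, hD, hDC⟩ := hC
    exact ⟨C, D, hD.congr (hS _ hD.1) hX, hDC⟩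

theorem expect_eq_evalAt (X : Fock M) (st : State M) : expect X st = evalAt (0, 0) X st := by
  rw [expect_eq, evalAt_eq]
  congr 2
  funext g
  obtain ⟨y, s, m⟩ := g
  rw [jet_eq]
  have : (fun z => component ((0, 0) : (ℂ → ℂ) × (ℂ → ℂ)) s (y.chart.disc z)) = fun _ => 0 := by
    cases s <;> rfl
  rw [this, iteratedDeriv_const]
  simp

theorem isTest_zero (S : Finset (Pt M)) (st : State M) : IsTest S st (0, 0) :=
  fun _ _ => ⟨analyticAt_const, analyticAt_const⟩

/-- Fields with equal expectations have expansions whose coefficients have equal expectations. -/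
theorem HasOPE.expect_eq {S T T' : Finset (Pt M)} {X X' : Fock M} {x : Pt M} {k : Fin M.numMarks}
    {D D' : ScaleIndex → Fock M} (h : HasOPE S X x (.marked k) T D)
    (h' : HasOPE S X' x (.marked k) T' D') (hn : x.IsNode)
    (hX : ∀ st : State M, st.Valid S → expect X st = expect X' st) (I : ScaleIndex)
    {st : State M} (hst : st.Valid (S.erase x)) : expect (D I) st = expect (D' I) st := by
  classical
  obtain ⟨hx, hne, hch, -, F, hF, hexp⟩ := h
  obtain ⟨-, -, -, -, F', hF', hexp'⟩ := h'
  have h0 : ∀ (E : ScaleIndex → Fock M) J, E J = 0 → expect (E J) st = 0 := fun E J hJ => by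
    rw [hJ, CoulombGas.expect_eq, map_zero]
  have hsum : ∀ (E : ScaleIndex → Fock M) (G G' : ℝ → Finset ScaleIndex),
      (∀ N I, I ∈ G N ↔ E I ≠ 0 ∧ (I.pow + I.powConj).re ≤ N) →
      (∀ N, ∀ I ∈ G' N, (I.pow + I.powConj).re ≤ N) → ∀ (N : ℝ) (t : ℂ),
      ∑ J ∈ G N, J.toFun t * expect (E J) st =
        ∑ J ∈ G N ∪ G' N, J.toFun t * expect (E J) st := by
    intro E G G' hG hG' N t
    refine Finset.sum_subset Finset.subset_union_left fun J hJ hJG => ?_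
    have hJ' : E J = 0 := by
      by_contra hE
      exact hJG ((hG N J).2 ⟨hE, hG' N J ((Finset.mem_union.1 hJ).resolve_left hJG)⟩)
    rw [h0 E J hJ', mul_zero]
  by_cases hI : I ∈ F I.order ∪ F' I.order
  · refine sub_eq_zero.1 (scale_unique k (N := I.order) (F I.order ∪ F' I.order) (fun J hJ => ?_)
      (fun J => expect (D J) st - expect (D' J) st) ?_ I hI)
    · rcases Finset.mem_union.1 hJ with h | h
      · exact ((hF _ _).1 h).2
      · exact ((hF' _ _).1 h).2
    · have h1 := (hexp' st hst _ (isTest_zero _ _) I.order).sub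
        (hexp st hst _ (isTest_zero _ _) I.order)
      refine h1.congr' ?_ EventuallyEq.rfl
      filter_upwards [hst.collide hn hch] with t ht
      simp only [← expect_eq_evalAt, hX _ ht]
      rw [hsum D F F' hF (fun N J hJ => ((hF' N J).1 hJ).2),
        hsum D' F' F hF' (fun N J hJ => ((hF N J).1 hJ).2), Finset.union_comm (F' _)]
      simp only [mul_sub, Finset.sum_sub_distrib]
      ring
  · rw [Finset.mem_union, not_or, hF, hF'] at hI
    have h1 : D I = 0 := by
      by_contra h
      exact hI.1 ⟨h, le_rfl⟩
    have h2 : D' I = 0 := by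
      by_contra h
      exact hI.2 ⟨h, le_rfl⟩
    rw [h0 D I h1, h0 D' I h2]

theorem remaining_cons (o : Pt M × Fin M.numMarks) (L : Punctures M) (S : Finset (Pt M)) :
    remaining (o :: L) S = remaining L (S.erase o.1) := by
  ext y
  simp only [remaining, List.map_cons, List.toFinset_cons, Finset.mem_sdiff, Finset.mem_insert,
    Finset.mem_erase]
  tauto

/-- Corresponding coefficients of iterated expansions of fields with equal expectations have equal
expectations. -/
theorem IteratedOPE.expect_eq {L : Punctures M} {S : Finset (Pt M)} {X X' : Fock M}
    {C C' : List ScaleIndex → Fock M} (hC : IteratedOPE L S X C) (hC' : IteratedOPE L S X' C')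
    (hS : ∀ x ∈ S, x.IsNode)
    (hX : ∀ st : State M, st.Valid S → expect X st = expect X' st) {l : List ScaleIndex}
    (hl : l.length = L.length) {st : State M} (hst : st.Valid (remaining L S)) :
    expect (C l) st = expect (C' l) st := by
  induction L generalizing S X X' C C' l with
  | nil =>
    rw [List.length_nil, List.length_eq_zero_iff] at hl
    rw [hl, show C [] = X from hC, show C' [] = X' from hC']
    exact hX st (hst.mono (by simp [remaining]))
  | cons o L ih =>
    obtain ⟨D, hD, hDC⟩ := hC
    obtain ⟨D', hD', hDC'⟩ := hC'
    rcases l with _ | ⟨I, l⟩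
    · simp at hl
    rw [remaining_cons] at hst
    exact ih (hDC I) (hDC' I) (fun y hy => hS y (Finset.mem_of_mem_erase hy))
      (fun st hst => hD.expect_eq hD' (hS _ hD.1) hX I hst) (by simpa using hl) hst

namespace BackgroundCharge

variable {b : ℝ}

/-- Translation preserves the fields whose coefficients have iterated expansions. -/
theorem hat_mem_fieldAlg (β₀ β : BackgroundCharge M b) {L : Punctures M} {S : Finset (Pt M)}
    (hS : ∀ x ∈ S, x.IsNode) (hadm : Admissible L S) {X : Fock M}
    (hX : X ∈ fieldAlg (iterAlg L S) (labelsOn S)) :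
    BackgroundCharge.hat β₀ β X ∈ fieldAlg (iterAlg L S) (labelsOn S) :=
  translate_mem hX (fun g hg => (shift_mem_iterAlg β₀ β L hS hadm hg g.2.1 g.2.2).1)
    fun _ hη => expoFactor_mem_iterAlg β₀ β L hS hadm hη

theorem iPhi_diff_support (β₀ β : BackgroundCharge M b) {x : Pt M × Bool}
    (hx : x ∈ (iPhi (β.diff β₀)).support) : x.1 ∈ marks M := by
  obtain ⟨d, hd, hdx⟩ := exists_mem_of_mem_support_iPhi hx
  obtain ⟨k, -, rfl⟩ := List.mem_map.1 hd
  exact hdx ▸ mark_mem_marks k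

/-- The insertion of `V^⊙[β - β₀]` and the image of a field have iterated expansions if the
coefficients of the field do. -/
theorem exists_iteratedOPE_tensor (β₀ β : BackgroundCharge M b) {L : Punctures M}
    {S : Finset (Pt M)} (hS : ∀ x ∈ S, x.IsNode) (hadm : Admissible L S) {X : Fock M}
    (hXS : FieldOn S X) (hX : X ∈ fieldAlg (iterAlg L S) (labelsOn S)) :
    (∃ CV, IteratedOPE L S (CoulombGas.tensor X (vertexWick (β.diff β₀))) CV) ∧
      ∃ C, IteratedOPE L S (BackgroundCharge.hat β₀ β X) C := by
  have hhat := fieldAlg_mono le_rfl (labelsOn_mono (Finset.subset_union_left (s₂ := marks M)))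
    (hat_mem_fieldAlg β₀ β hS hadm hX)
  refine ⟨?_, exists_iteratedOPE L hS hadm hhat⟩
  obtain ⟨C, hC⟩ := exists_iteratedOPE L hS hadm (Subalgebra.mul_mem _ hhat
    (wickExp_mem (η := iPhi (β.diff β₀)) fun x hx =>
      Finset.mem_union_right _ (iPhi_diff_support β₀ β hx)))
  exact hC.exists_congr hS fun st hst j => evalJet_tensor_vertexWick β₀ β hS hXS hst j

theorem shiftIndex_shiftIndex (β₀ β : BackgroundCharge M b) (σ : Pt M → ℂ × ℂ)
    (o : Pt M × Fin M.numMarks) (I : ScaleIndex) :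
    shiftIndex β₀ β σ o (shiftIndex β β₀ σ o I) = I := by
  refine ScaleIndex.ext' ?_ ?_ rfl rfl
  · simp only [shiftIndex]
    ring
  · simp only [shiftIndex]
    split_ifs <;> ring

theorem zipWith_shiftIndex (β₀ β : BackgroundCharge M b) (σ : Pt M → ℂ × ℂ) {L : Punctures M}
    {l : List ScaleIndex} (hl : l.length = L.length) :
    List.zipWith (shiftIndex β₀ β σ) L (List.zipWith (shiftIndex β β₀ σ) L l) = l := by
  induction L generalizing l with
  | nil =>
    rw [List.length_nil, List.length_eq_zero_iff] at hl
    rw [hl]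
    rfl
  | cons o L ih =>
    rcases l with _ | ⟨I, l⟩
    · simp at hl
    · simp only [List.zipWith_cons_cons, shiftIndex_shiftIndex]
      rw [ih (by simpa using hl)]

/-- By the part on `F_β₀(D^*)`, the fields expanded on both sides have equal expectations; the
coefficients inherit this by uniqueness of expansions. -/
theorem Inserted.correct {β₀ β : BackgroundCharge M b} {S : Finset (Pt M)} {Y W Z : Fock M}
    (h : Inserted β₀ β S Y W Z) : β₀.ExtFamily S Y ∧ β.ExtFamily S Z ∧
      ∀ st : State M, st.Valid S → expect W st = expect Z st := by
  induction h with
  | @string S X L σ C CV C' l hX hσ hC hCV hC' hl =>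
    have hl' : (List.zipWith (shiftIndex β₀ β σ) L l).length = L.length := by
      rw [List.length_zipWith, hl, min_self]
    obtain ⟨hS, hXS⟩ := Family.fieldOn hX
    exact ⟨.string hX hσ hC hl, .string (Family.hat β hX) (hσ.translate _) hC' hl',
      fun st hst => hCV.expect_eq hC' hS
        (fun st hst => expect_tensor_vertexWick β₀ β hS hXS hst) hl' hst⟩
  | add _ _ ih ih' =>
    refine ⟨ih.1.add ih'.1, ih.2.1.add ih'.2.1, fun st hst => ?_⟩
    have h1 := ih.2.2 st hst
    have h2 := ih'.2.2 st hst
    rw [CoulombGas.expect_eq, CoulombGas.expect_eq] at h1 h2 ⊢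
    rw [map_add, map_add, h1, h2]
  | smul a _ ih =>
    refine ⟨ih.1.smul a, ih.2.1.smul a, fun st hst => ?_⟩
    have h1 := ih.2.2 st hst
    rw [CoulombGas.expect_eq, CoulombGas.expect_eq] at h1 ⊢
    rw [map_smul, map_smul, h1]

theorem ExtFamily.exists_inserted {β₀ : BackgroundCharge M b} (β : BackgroundCharge M b)
    {S : Finset (Pt M)} {Y : Fock M} (h : β₀.ExtFamily S Y) :
    ∃ W Z, Inserted β₀ β S Y W Z := by
  induction h with
  | @string S X L σ C l hX hσ hC hl =>
    obtain ⟨hS, hXS⟩ := Family.fieldOn hX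
    obtain ⟨⟨CV, hCV⟩, C', hC'⟩ := exists_iteratedOPE_tensor β₀ β hS hC.admissible hXS
      (hσ.mem_fieldAlg hS hXS hC)
    exact ⟨_, _, .string hX hσ hC hCV hC' hl⟩
  | add _ _ ih ih' =>
    obtain ⟨W, Z, h⟩ := ih
    obtain ⟨W', Z', h'⟩ := ih'
    exact ⟨_, _, h.add h'⟩
  | smul a _ ih =>
    obtain ⟨W, Z, h⟩ := ih
    exact ⟨_, _, h.smul a⟩

/-- Strings of `F_β` are obtained from strings of `F_β₀` by translating back, the exponents being
shifted back. -/
theorem ExtFamily.exists_preimage (β₀ : BackgroundCharge M b) {β : BackgroundCharge M b}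
    {S : Finset (Pt M)} {Z : Fock M} (h : β.ExtFamily S Z) :
    ∃ Y W, Inserted β₀ β S Y W Z := by
  induction h with
  | @string S X L σ C l hX hσ hC hl =>
    obtain ⟨hS, hXS⟩ := Family.fieldOn hX
    have hadm := hC.admissible
    have hX₀ := hat_mem_fieldAlg β β₀ hS hadm (hσ.mem_fieldAlg hS hXS hC)
    have hF₀ := Family.hat β₀ hX
    have hX₀S := (Family.fieldOn hF₀).2
    obtain ⟨C₀, hC₀⟩ := exists_iteratedOPE L hS hadm
      (fieldAlg_mono le_rfl (labelsOn_mono Finset.subset_union_left) hX₀)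
    obtain ⟨⟨CV, hCV⟩, -⟩ := exists_iteratedOPE_tensor β₀ β hS hadm hX₀S hX₀
    rw [← hat_hat β₀ β X] at hC
    have := Inserted.string hF₀ (hσ.translate _) hC₀ hCV hC
      (l := List.zipWith (shiftIndex β β₀ σ) L l) (by rw [List.length_zipWith, hl, min_self])
    rw [zipWith_shiftIndex β₀ β σ hl] at this
    exact ⟨_, _, this⟩
  | add _ _ ih ih' =>
    obtain ⟨Y, W, h⟩ := ih
    obtain ⟨Y', W', h'⟩ := ih'
    exact ⟨_, _, h.add h'⟩
  | smul a _ ih =>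
    obtain ⟨Y, W, h⟩ := ih
    exact ⟨_, _, h.smul a⟩

end BackgroundCharge

end CoulombGas

end

theorem mainTheorem5 (M : CoulombGas.MarkedDomain) (b : ℝ)
    (β₀ β : CoulombGas.BackgroundCharge M b) :
    -- the operator `X ↦ X̂` sends `Φ_β₀` to `Φ_β` and `O_β₀` to `O_β`
    (∀ τ : CoulombGas.DoubleDivisor M, τ.IsNeutral →
      CoulombGas.BackgroundCharge.hat β₀ β (β₀.bosonic τ) = β.bosonic τ ∧
      CoulombGas.BackgroundCharge.hat β₀ β (β₀.opeExp τ) = β.opeExp τ) ∧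
    -- it commutes with differentiation
    (∀ (S : Finset (CoulombGas.Pt M)) (X Y Y' : CoulombGas.Fock M) (x : CoulombGas.Pt M),
      (∀ y ∈ S, y.IsNode) → x ∈ S → CoulombGas.FieldOn S X → CoulombGas.FieldOn S Y →
      CoulombGas.FieldOn S Y' → CoulombGas.HasDerivs S X x Y Y' →
      CoulombGas.HasDerivs S (CoulombGas.BackgroundCharge.hat β₀ β X) x
        (CoulombGas.BackgroundCharge.hat β₀ β Y) (CoulombGas.BackgroundCharge.hat β₀ β Y')) ∧
    -- the image of `F_β₀(D*)` is `F_β(D*)`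
    (∀ S : Finset (CoulombGas.Pt M),
      CoulombGas.BackgroundCharge.hat β₀ β '' {X | β₀.Family S X} = {X | β.Family S X}) ∧
    -- within correlations it is the insertion of `V^⊙[β - β₀]`
    (∀ (S : Finset (CoulombGas.Pt M)) (X : CoulombGas.Fock M), β₀.Family S X →
      ∀ st : CoulombGas.State M, st.Valid S →
        CoulombGas.expect (CoulombGas.tensor X (CoulombGas.vertexWick (β.diff β₀))) st =
          CoulombGas.expect (CoulombGas.BackgroundCharge.hat β₀ β X) st) ∧
    -- the insertion maps the extended family of `β₀` to that of `β`, within correlations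
    (∀ (S : Finset (CoulombGas.Pt M)) (Y W Z : CoulombGas.Fock M),
      CoulombGas.BackgroundCharge.Inserted β₀ β S Y W Z →
        β₀.ExtFamily S Y ∧ β.ExtFamily S Z ∧
        ∀ st : CoulombGas.State M, st.Valid S →
          CoulombGas.expect W st = CoulombGas.expect Z st) ∧
    (∀ (S : Finset (CoulombGas.Pt M)) (Y : CoulombGas.Fock M), β₀.ExtFamily S Y →
      ∃ W Z, CoulombGas.BackgroundCharge.Inserted β₀ β S Y W Z) ∧
    (∀ (S : Finset (CoulombGas.Pt M)) (Z : CoulombGas.Fock M), β.ExtFamily S Z →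
      ∃ Y W, CoulombGas.BackgroundCharge.Inserted β₀ β S Y W Z) := by
  refine ⟨fun τ _ => ⟨CoulombGas.BackgroundCharge.hat_bosonic β₀ β τ,
    CoulombGas.BackgroundCharge.hat_opeExp β₀ β τ⟩,
    fun S X Y Y' x hS hx hX hY hY' h =>
      CoulombGas.BackgroundCharge.hasDerivs_hat β₀ β hS hx hX hY hY' h,
    CoulombGas.BackgroundCharge.image_family β₀ β, fun S X hX st hst => ?_,
    fun S Y W Z h => h.correct, fun S Y h => h.exists_inserted β, fun S Z h => h.exists_preimage β₀⟩
  obtain ⟨hS, hXS⟩ := hX.fieldOn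
  exact CoulombGas.BackgroundCharge.expect_tensor_vertexWick β₀ β hS hXS hst
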